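/- Let $\nu\in\mathbb{C}\smallsetminus\mathbb{Z}$ with $|\mathrm{Re}(\nu)|<1$ and let $p\in\mathbb{Z}$. **Bessel function.** For $z\in\mathbb{C}^{\times}$ put $J_{\nu,p}(z)=J_{\nu+p}(z)J_{\nu-p}(\bar z)$, where $J_\mu(z)=\sum_{n\ge 0}\frac{(-1)^n(z/2)^{\mu+2n}}{n!\,\Gamma(\mu+n+1)}$ and the powers are taken on conjugate branches, so that $(z/2)^{\nu+p}(\bar z/2)^{\nu-p}=|z/2|^{2\nu}(z/|z|)^{2p}$, and $$\boldsymbol{B}_{\nu,p}(z)=\frac{1}{\sin(\pi\nu)}\bigl(J_{-\nu,-p}(4\pi z)-J_{\nu,p}(4\pi z)\bigr),$$ an even function on $\mathbb{C}^{\times}$. **Spaces.** Let $\mathscr{S}_{\mathrm{sis}}^{\nu,p}(\mathbb{C}^\times)$ be the space of functions $|z|^{\nu}(z/|z|)^p\phi_+(z)+|z|^{-\nu}(z/|z|)^{-p}\phi_-(z)$ on $\mathbb{C}^\times$ with $\phi_\pm\in\mathscr{S}(\mathbb{C})$ (Schwartz functions), with the quotient topology from $\mathscr{S}(\mathbb{C})\times\mathscr{S}(\mathbb{C})$,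 and let $\mathscr{T}_{\mathrm{sis}}^{\nu,p}(\mathbb{C}^\times)$ be the space of continuous linear functionals on it. Let $\nabla=z\,\partial/\partial z$ and $\overline\nabla=\bar z\,\partial/\partial\bar z$ on $\mathscr{S}_{\mathrm{sis}}^{\nu,p}(\mathbb{C}^\times)$, and for $f\in\mathscr{T}_{\mathrm{sis}}^{\nu,p}(\mathbb{C}^\times)$ set $$\langle\nabla f,\phi\rangle=-\langle f,\nabla\phi+\phi\rangle,\qquad \langle\overline\nabla f,\phi\rangle=-\langle f,\overline\nabla\phi+\phi\rangle,\qquad \langle zf,\phi\rangle=\langle f,z\phi\rangle,\qquad \langle\bar zf,\phi\rangle=\langle f,\bar z\phi\rangle .$$ **Hankel transform.** For $\phi\in\mathscr{S}_{\mathrm{sis}}^{\nu,p}(\mathbb{C}^\times)$ and $u\in\mathbb{C}^\times$ the integral $$\mathrm{H}_{\nu,p}\phi(u)=2\pi^2\iint_{\mathbb{C}^\times}\phi(z)\,\boldsymbol{B}_{\nu,p}(\sqrt{uz})\,i\,dz\wedge d\bar z$$ (where $i\,dz\wedge d\bar z$ is twice Lebesgue measure) converges absolutely and defines a continuous linear operator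 $\mathrm{H}_{\nu,p}$ of $\mathscr{S}_{\mathrm{sis}}^{\nu,p}(\mathbb{C}^\times)$ into itself. Hence $\langle\mathrm{H}_{\nu,p}f,\phi\rangle=\langle f,\mathrm{H}_{\nu,p}\phi\rangle$ defines $\mathrm{H}_{\nu,p}f\in\mathscr{T}_{\mathrm{sis}}^{\nu,p}(\mathbb{C}^\times)$ for every $f\in\mathscr{T}_{\mathrm{sis}}^{\nu,p}(\mathbb{C}^\times)$. **Proposition.** For all $f\in\mathscr{T}_{\mathrm{sis}}^{\nu,p}(\mathbb{C}^\times)$, writing $\mathrm{H}=\mathrm{H}_{\nu,p}$ and $u$ for the variable of the transformed distributions, $$\nabla\mathrm{H}f=-\mathrm{H}(\nabla f+f),\qquad \overline\nabla\mathrm{H}f=-\mathrm{H}(\overline\nabla f+f),$$ $$\nabla^2\mathrm{H}f=\mathrm{H}(\nabla^2f+2\nabla f+f),\qquad \overline\nabla{}^2\mathrm{H}f=\mathrm{H}(\overline\nabla{}^2f+2\overline\nabla f+f),$$ $$4\nabla^2\mathrm{H}f=(\nu+p)^2\,\mathrm{H}f-16\pi^2u\,\mathrm{H}(zf),\qquad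 4\overline\nabla{}^2\mathrm{H}f=(\nu-p)^2\,\mathrm{H}f-16\pi^2\bar u\,\mathrm{H}(\bar zf).$$ -/

import Mathlib

open scoped SchwartzMap

noncomputable section

namespace Hankel

open Complex

/-! ### Bessel functions over the complex numbers -/

/-- The entire even function `∑ (-1)^n (z/2)^(2n) / (n! Γ(μ+n+1))`, that is,
`(z/2)^(-μ) J_μ(z)`. -/
def besselSeries (μ z : ℂ) : ℂ :=
  ∑' n : ℕ, (-1) ^ n * (z / 2) ^ (2 * n) / ((n.factorial : ℂ) * Gamma (μ + n + 1))

/-- The classical Bessel function `J_μ(z)`, on the principal branch. -/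
def besselJ (μ z : ℂ) : ℂ := (z / 2) ^ μ * besselSeries μ z

/-- `J_{ν,p}(z) = J_{ν+p}(z) J_{ν-p}(z̄)`, as a single-valued function on the punctured plane:
the power factors `(z/2)^(ν+p) (z̄/2)^(ν-p)`, on conjugate branches, multiply to
`|z/2|^(2ν) (z/|z|)^(2p)`. See `besselJC_eq`. -/
def besselJC (ν : ℂ) (p : ℤ) (z : ℂ) : ℂ :=
  ((‖z / 2‖ : ℝ) : ℂ) ^ (2 * ν) * (z / (‖z‖ : ℂ)) ^ (2 * p) *
    (besselSeries (ν + p) z * besselSeries (ν - p) (starRingEnd ℂ z))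

/-- `B_{ν,p}(z) = (J_{-ν,-p}(4πz) - J_{ν,p}(4πz)) / sin(πν)`. -/
def besselB (ν : ℂ) (p : ℤ) (z : ℂ) : ℂ :=
  1 / Complex.sin (Real.pi * ν) *
    (besselJC (-ν) (-p) (4 * Real.pi * z) - besselJC ν p (4 * Real.pi * z))

theorem besselJC_eq (ν : ℂ) (p : ℤ) {z : ℂ} (hz : z ≠ 0) (harg : z.arg ≠ Real.pi) :
    besselJC ν p z = besselJ (ν + p) z * besselJ (ν - p) (starRingEnd ℂ z) := by
  have hw : z / 2 ≠ 0 := div_ne_zero hz two_ne_zero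
  have hcw : starRingEnd ℂ (z / 2) ≠ 0 := by simpa using hz
  have hargw : (z / 2).arg ≠ Real.pi := by
    have : z / 2 = ((1 / 2 : ℝ) : ℂ) * z := by push_cast; ring
    rw [this, Complex.arg_real_mul _ (by norm_num)]
    exact harg
  have hn : ((‖z / 2‖ : ℝ) : ℂ) ≠ 0 := by simpa using hz
  have h1 : starRingEnd ℂ z / 2 = starRingEnd ℂ (z / 2) := by
    rw [map_div₀, Complex.conj_ofNat]
  have hdiv : z / (‖z‖ : ℂ) = (z / 2) / ((‖z / 2‖ : ℝ) : ℂ) := by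
    rw [norm_div]; push_cast; simp; field_simp
  have hmul : (z / 2) * starRingEnd ℂ (z / 2) = ((‖z / 2‖ : ℝ) : ℂ) ^ 2 := by
    rw [Complex.mul_conj, Complex.normSq_eq_norm_sq]; push_cast; rfl
  unfold besselJC besselJ
  rw [h1, hdiv]
  generalize hwdef : z / 2 = w at *
  have hpow : w ^ (ν + p) * (starRingEnd ℂ w) ^ (ν - p)
      = ((‖w‖ : ℝ) : ℂ) ^ (2 * ν) * (w / (‖w‖ : ℂ)) ^ (2 * p) := by
    rw [Complex.cpow_add _ _ hw, Complex.cpow_sub _ _ hcw, Complex.cpow_intCast,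
      Complex.cpow_intCast]
    have e1 : w ^ ν * (starRingEnd ℂ w) ^ ν = ((‖w‖ : ℝ) : ℂ) ^ (2 * ν) := by
      rw [Complex.cpow_def_of_ne_zero hw, Complex.cpow_def_of_ne_zero hcw,
        Complex.cpow_def_of_ne_zero hn, ← Complex.exp_add, Complex.log_conj _ hargw,
        ← add_mul, Complex.add_conj, Complex.log_re, ← Complex.ofReal_log (norm_nonneg _)]
      congr 1; push_cast; ring
    have e2 : w ^ p / (starRingEnd ℂ w) ^ p = (w / (‖w‖ : ℂ)) ^ (2 * p) := by
      rw [← div_zpow, zpow_mul]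
      congr 1
      rw [zpow_ofNat, div_pow, ← hmul]
      field_simp
    rw [← e1, ← e2]; ring
  rw [← hpow]; ring

/-! ### Wirtinger operators -/

/-- `∇ = z ∂/∂z`, where `∂/∂z = (∂/∂x - i ∂/∂y)/2`. -/
def nablaFun (ψ : ℂ → ℂ) (z : ℂ) : ℂ :=
  z * ((fderiv ℝ ψ z 1 - I * fderiv ℝ ψ z I) / 2)

/-- `∇̄ = z̄ ∂/∂z̄`, where `∂/∂z̄ = (∂/∂x + i ∂/∂y)/2`. -/
def nablaBarFun (ψ : ℂ → ℂ) (z : ℂ) : ℂ :=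
  starRingEnd ℂ z * ((fderiv ℝ ψ z 1 + I * fderiv ℝ ψ z I) / 2)

/-! ### The space of test functions -/

/-- The function `|z|^ν (z/|z|)^p` on the punctured plane. Functions on the punctured plane are
encoded as functions on `ℂ` with the value `0` at the origin. -/
def twist (ν : ℂ) (p : ℤ) (z : ℂ) : ℂ :=
  if z = 0 then 0 else (‖z‖ : ℂ) ^ ν * (z / (‖z‖ : ℂ)) ^ p

/-- `(φ₊, φ₋) ↦ |z|^ν (z/|z|)^p φ₊ + |z|^(-ν) (z/|z|)^(-p) φ₋`. -/
def sisMap (ν : ℂ) (p : ℤ) : (𝓢(ℂ, ℂ) × 𝓢(ℂ, ℂ)) →ₗ[ℂ] (ℂ → ℂ) where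
  toFun q := fun z => twist ν p z * q.1 z + twist (-ν) (-p) z * q.2 z
  map_add' a b := by ext z; simp; ring
  map_smul' c a := by ext z; simp; ring

/-- The space `S_sis^{ν,p}(ℂ^×)`, as a type of its own since it does not carry the topology of
pointwise convergence. -/
def Ssis (ν : ℂ) (p : ℤ) : Type := LinearMap.range (sisMap ν p)

variable {ν : ℂ} {p : ℤ}

instance : AddCommGroup (Ssis ν p) := inferInstanceAs (AddCommGroup (LinearMap.range (sisMap ν p)))

instance : Module ℂ (Ssis ν p) := inferInstanceAs (Module ℂ (LinearMap.range (sisMap ν p)))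

instance : CoeFun (Ssis ν p) (fun _ => ℂ → ℂ) := ⟨fun φ => φ.1⟩

/-- The linear surjection from `S(ℂ) × S(ℂ)`. -/
def sisProj (ν : ℂ) (p : ℤ) : (𝓢(ℂ, ℂ) × 𝓢(ℂ, ℂ)) →ₗ[ℂ] Ssis ν p :=
  LinearMap.rangeRestrict (sisMap ν p)

/-- The topology induced from that of `S(ℂ)`: the quotient topology for the surjection from
`S(ℂ) × S(ℂ)`. -/
instance : TopologicalSpace (Ssis ν p) := TopologicalSpace.coinduced (sisProj ν p) inferInstance

theorem Ssis.ext {φ ψ : Ssis ν p} (h : ∀ z, φ z = ψ z) : φ = ψ := Subtype.ext (funext h)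

theorem Ssis.add_apply (φ ψ : Ssis ν p) (z : ℂ) : (φ + ψ) z = φ z + ψ z := rfl

theorem Ssis.smul_apply (c : ℂ) (φ : Ssis ν p) (z : ℂ) : (c • φ) z = c * φ z := rfl

theorem sisProj_surjective : Function.Surjective (sisProj ν p) :=
  LinearMap.surjective_rangeRestrict _

/-- An operator `A` on functions that lifts to a continuous operator `D` on `S(ℂ) × S(ℂ)` acts
continuously on `S_sis^{ν,p}(ℂ^×)`. -/
def Ssis.lift (A : (ℂ → ℂ) → ℂ → ℂ)
    (D : (𝓢(ℂ, ℂ) × 𝓢(ℂ, ℂ)) →L[ℂ] (𝓢(ℂ, ℂ) × 𝓢(ℂ, ℂ)))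
    (h : ∀ q, A (sisMap ν p q) = sisMap ν p (D q)) : Ssis ν p →L[ℂ] Ssis ν p :=
  have key : ∀ q, A ((sisProj ν p q).1) = sisMap ν p (D q) := h
  { toFun := fun φ => ⟨A φ, by
      obtain ⟨q, rfl⟩ := sisProj_surjective φ
      exact ⟨D q, (key q).symm⟩⟩
    map_add' := fun φ ψ => by
      obtain ⟨q, rfl⟩ := sisProj_surjective φ
      obtain ⟨r, rfl⟩ := sisProj_surjective ψ
      apply Subtype.ext
      change A ((sisProj ν p q + sisProj ν p r).1)
        = A ((sisProj ν p q).1) + A ((sisProj ν p r).1)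
      rw [← map_add, key, key, key, map_add, map_add]
    map_smul' := fun c φ => by
      obtain ⟨q, rfl⟩ := sisProj_surjective φ
      apply Subtype.ext
      change A ((c • sisProj ν p q).1) = c • A ((sisProj ν p q).1)
      rw [← map_smul, key, key, map_smul, map_smul]
    cont := by
      refine continuous_coinduced_dom.2 ?_
      have : Continuous fun q => sisProj ν p (D q) := continuous_coinduced_rng.comp D.continuous
      refine this.congr fun q => ?_
      exact Subtype.ext (key q).symm }

theorem Ssis.lift_apply (A : (ℂ → ℂ) → ℂ → ℂ) (D) (h : ∀ q, A (sisMap ν p q) = sisMap ν p (D q))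
    (φ : Ssis ν p) (z : ℂ) : Ssis.lift A D h φ z = A φ z := rfl

theorem twist_fderiv (ν : ℂ) (p : ℤ) {z : ℂ} (hz : z ≠ 0) :
    DifferentiableAt ℝ (twist ν p) z ∧ ∀ v : ℂ, fderiv ℝ (twist ν p) z v = twist ν p z *
      ((ν + p) / 2 * (v / z) + (ν - p) / 2 * (starRingEnd ℂ v / starRingEnd ℂ z)) := by
  have hn : ‖z‖ ≠ 0 := norm_ne_zero_iff.2 hz
  have hnc : (‖z‖ : ℂ) ≠ 0 := by exact_mod_cast hn
  have hcz : starRingEnd ℂ z ≠ 0 := by simpa using hz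
  have hnorm : HasFDerivAt (fun w : ℂ => ‖w‖) (fderiv ℝ (fun w : ℂ => ‖w‖) z) z :=
    (differentiableAt_id.norm ℝ hz).hasFDerivAt
  have hnormv : ∀ v : ℂ, ((fderiv ℝ (fun w : ℂ => ‖w‖) z v : ℝ) : ℂ)
      = (‖z‖ : ℂ) * (v / z + starRingEnd ℂ v / starRingEnd ℂ z) / 2 := by
    intro v
    have h2 := (hnorm.pow 2).unique ((hasStrictFDerivAt_norm_sq z).hasFDerivAt)
    have h3 := congrArg (fun L : ℂ →L[ℝ] ℝ => ((L v : ℝ) : ℂ)) h2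
    have h4 : (v.re * z.re + v.im * z.im : ℂ)
        = (starRingEnd ℂ z * v + z * starRingEnd ℂ v) / 2 := by
      apply Complex.ext <;> simp <;> ring
    simp at h3
    have hmul : z * starRingEnd ℂ z = (‖z‖ : ℂ) ^ 2 := by
      rw [Complex.mul_conj, Complex.normSq_eq_norm_sq]; push_cast; rfl
    have h5 : (‖z‖ : ℂ) * ((fderiv ℝ (fun w : ℂ => ‖w‖) z v : ℝ) : ℂ)
        = (starRingEnd ℂ z * v + z * starRingEnd ℂ v) / 2 := by
      linear_combination h3 / 2 + h4
    apply mul_left_cancel₀ hnc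
    rw [h5]
    field_simp
    rw [← hmul]
    field_simp
  have hnormC : HasFDerivAt (fun w : ℂ => (‖w‖ : ℂ))
      (Complex.ofRealCLM.comp (fderiv ℝ (fun w : ℂ => ‖w‖) z)) z :=
    Complex.ofRealCLM.hasFDerivAt.comp z hnorm
  have hslit : (‖z‖ : ℂ) ∈ Complex.slitPlane := by
    left; simpa using hz
  have chain : ∀ (F : ℂ → ℂ) (c : ℂ) (g : ℂ → ℂ) (g₁ : ℂ →L[ℝ] ℂ), HasDerivAt F c (g z) →
      HasFDerivAt g g₁ z → HasFDerivAt (fun w => F (g w)) (c • g₁) z := by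
    intro F c g g₁ hF hg
    have h := HasFDerivAt.comp z (hF.hasFDerivAt.restrictScalars ℝ) hg
    refine h.congr_fderiv ?_
    ext v
    simp [mul_comm]
  have hpowD := chain (fun x => x ^ ν) _ _ _
    (Complex.hasStrictDerivAt_cpow_const (c := ν) hslit).hasDerivAt hnormC
  have hinvD := chain (fun x => x⁻¹) _ _ _ (hasDerivAt_inv hnc) hnormC
  have hunitD := (hasFDerivAt_id (𝕜 := ℝ) z).mul hinvD
  have hu0 : z * (‖z‖ : ℂ)⁻¹ ≠ 0 := mul_ne_zero hz (inv_ne_zero hnc)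
  have hzpowD := chain (fun x => x ^ p) _ _ _
    (hasDerivAt_zpow p (z * (‖z‖ : ℂ)⁻¹) (Or.inl hu0)) hunitD
  have htot := hpowD.mul hzpowD
  have heq : twist ν p =ᶠ[nhds z]
      fun w : ℂ => (‖w‖ : ℂ) ^ ν * (w * (‖w‖ : ℂ)⁻¹) ^ p := by
    filter_upwards [isOpen_ne.mem_nhds hz] with w hw
    simp only [twist, if_neg hw, div_eq_mul_inv]
  have hfin := htot.congr_of_eventuallyEq heq
  refine ⟨hfin.differentiableAt, fun v => ?_⟩
  rw [hfin.fderiv]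
  have hc : (‖z‖ : ℂ) ^ (ν - 1) = (‖z‖ : ℂ) ^ ν / (‖z‖ : ℂ) := by
    rw [Complex.cpow_sub _ _ hnc, Complex.cpow_one]
  have hp : (z * (‖z‖ : ℂ)⁻¹) ^ (p - 1) = (z * (‖z‖ : ℂ)⁻¹) ^ p / (z * (‖z‖ : ℂ)⁻¹) := by
    rw [zpow_sub_one₀ hu0, div_eq_mul_inv]
  simp [twist, hz, hc, hp, hnormv, div_eq_mul_inv]
  field_simp
  ring

/-- Product rule for `|z|^ν (z/|z|)^p` times a Schwartz function. -/
theorem twist_mul_fderiv (ν : ℂ) (p : ℤ) (f : 𝓢(ℂ, ℂ)) {z : ℂ} (hz : z ≠ 0) :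
    DifferentiableAt ℝ (fun w => twist ν p w * f w) z ∧
    ∀ v : ℂ, fderiv ℝ (fun w => twist ν p w * f w) z v = twist ν p z *
      (((ν + p) / 2 * (v / z) + (ν - p) / 2 * (starRingEnd ℂ v / starRingEnd ℂ z)) * f z +
        fderiv ℝ f z v) := by
  obtain ⟨hd, hv⟩ := twist_fderiv ν p hz
  refine ⟨hd.mul f.differentiableAt, fun v => ?_⟩
  rw [fderiv_fun_mul hd f.differentiableAt]
  simp only [add_apply, smul_apply, smul_eq_mul, hv]
  ring

theorem sisMap_fderiv (ν : ℂ) (p : ℤ) (q : 𝓢(ℂ, ℂ) × 𝓢(ℂ, ℂ)) {z : ℂ} (hz : z ≠ 0) (v : ℂ) :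
    fderiv ℝ (sisMap ν p q) z v =
      twist ν p z * (((ν + p) / 2 * (v / z) +
        (ν - p) / 2 * (starRingEnd ℂ v / starRingEnd ℂ z)) * q.1 z + fderiv ℝ q.1 z v) +
      twist (-ν) (-p) z * ((-((ν + p) / 2) * (v / z) -
        (ν - p) / 2 * (starRingEnd ℂ v / starRingEnd ℂ z)) * q.2 z + fderiv ℝ q.2 z v) := by
  obtain ⟨hd₁, hv₁⟩ := twist_mul_fderiv ν p q.1 hz
  obtain ⟨hd₂, hv₂⟩ := twist_mul_fderiv (-ν) (-p) q.2 hz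
  have : sisMap ν p q = fun w => twist ν p w * q.1 w + twist (-ν) (-p) w * q.2 w := rfl
  rw [this, fderiv_fun_add hd₁ hd₂, add_apply, hv₁, hv₂]
  push_cast
  ring

theorem temperate_id : Function.HasTemperateGrowth (fun z : ℂ => z) :=
  Function.HasTemperateGrowth.id'

theorem temperate_conj : Function.HasTemperateGrowth (fun z : ℂ => starRingEnd ℂ z) :=
  Complex.conjCLE.toContinuousLinearMap.hasTemperateGrowth

/-- The operator `z ∂/∂z` on Schwartz functions. -/
def schwartzNabla : 𝓢(ℂ, ℂ) →L[ℂ] 𝓢(ℂ, ℂ) :=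
  (SchwartzMap.smulLeftCLM ℂ (fun z : ℂ => z)).comp
    ((1 / 2 : ℂ) • (LineDeriv.lineDerivOpCLM ℂ 𝓢(ℂ, ℂ) (1 : ℂ) -
      I • LineDeriv.lineDerivOpCLM ℂ 𝓢(ℂ, ℂ) I))

/-- The operator `z̄ ∂/∂z̄` on Schwartz functions. -/
def schwartzNablaBar : 𝓢(ℂ, ℂ) →L[ℂ] 𝓢(ℂ, ℂ) :=
  (SchwartzMap.smulLeftCLM ℂ (fun z : ℂ => starRingEnd ℂ z)).comp
    ((1 / 2 : ℂ) • (LineDeriv.lineDerivOpCLM ℂ 𝓢(ℂ, ℂ) (1 : ℂ) +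
      I • LineDeriv.lineDerivOpCLM ℂ 𝓢(ℂ, ℂ) I))

theorem schwartzNabla_apply (f : 𝓢(ℂ, ℂ)) (z : ℂ) : schwartzNabla f z = nablaFun f z := by
  simp [schwartzNabla, nablaFun, SchwartzMap.smulLeftCLM_apply_apply temperate_id,
    SchwartzMap.lineDerivOp_apply_eq_fderiv]
  ring

theorem schwartzNablaBar_apply (f : 𝓢(ℂ, ℂ)) (z : ℂ) :
    schwartzNablaBar f z = nablaBarFun f z := by
  simp [schwartzNablaBar, nablaBarFun, SchwartzMap.smulLeftCLM_apply_apply temperate_conj,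
    SchwartzMap.lineDerivOp_apply_eq_fderiv]
  ring

/-- The lift of `∇` to `S(ℂ) × S(ℂ)`. -/
def nablaLift (ν : ℂ) (p : ℤ) : (𝓢(ℂ, ℂ) × 𝓢(ℂ, ℂ)) →L[ℂ] (𝓢(ℂ, ℂ) × 𝓢(ℂ, ℂ)) :=
  (((ν + p) / 2) • ContinuousLinearMap.id ℂ _ + schwartzNabla).prodMap
    ((-((ν + p) / 2)) • ContinuousLinearMap.id ℂ _ + schwartzNabla)

/-- The lift of `∇̄` to `S(ℂ) × S(ℂ)`. -/
def nablaBarLift (ν : ℂ) (p : ℤ) : (𝓢(ℂ, ℂ) × 𝓢(ℂ, ℂ)) →L[ℂ] (𝓢(ℂ, ℂ) × 𝓢(ℂ, ℂ)) :=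
  (((ν - p) / 2) • ContinuousLinearMap.id ℂ _ + schwartzNablaBar).prodMap
    ((-((ν - p) / 2)) • ContinuousLinearMap.id ℂ _ + schwartzNablaBar)

theorem nablaFun_sisMap (q : 𝓢(ℂ, ℂ) × 𝓢(ℂ, ℂ)) :
    nablaFun (sisMap ν p q) = sisMap ν p (nablaLift ν p q) := by
  ext z
  have hR : sisMap ν p (nablaLift ν p q) z =
      twist ν p z * ((ν + p) / 2 * q.1 z + nablaFun q.1 z) +
        twist (-ν) (-p) z * (-((ν + p) / 2) * q.2 z + nablaFun q.2 z) := by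
    rw [← schwartzNabla_apply, ← schwartzNabla_apply]; rfl
  rw [hR]
  by_cases hz : z = 0
  · simp [nablaFun, hz, twist]
  · have hcz : starRingEnd ℂ z ≠ 0 := by simpa using hz
    simp only [nablaFun, sisMap_fderiv ν p q hz, map_one, Complex.conj_I]
    field_simp
    ring_nf
    simp only [Complex.I_sq]
    ring

theorem nablaBarFun_sisMap (q : 𝓢(ℂ, ℂ) × 𝓢(ℂ, ℂ)) :
    nablaBarFun (sisMap ν p q) = sisMap ν p (nablaBarLift ν p q) := by
  ext z
  have hR : sisMap ν p (nablaBarLift ν p q) z =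
      twist ν p z * ((ν - p) / 2 * q.1 z + nablaBarFun q.1 z) +
        twist (-ν) (-p) z * (-((ν - p) / 2) * q.2 z + nablaBarFun q.2 z) := by
    rw [← schwartzNablaBar_apply, ← schwartzNablaBar_apply]; rfl
  rw [hR]
  by_cases hz : z = 0
  · simp [nablaBarFun, hz, twist]
  · have hcz : starRingEnd ℂ z ≠ 0 := by simpa using hz
    simp only [nablaBarFun, sisMap_fderiv ν p q hz, map_one, Complex.conj_I]
    field_simp
    ring_nf
    simp only [Complex.I_sq]
    ring

theorem smul_sisMap {g : ℂ → ℂ} (hg : g.HasTemperateGrowth) (q : 𝓢(ℂ, ℂ) × 𝓢(ℂ, ℂ)) :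
    (fun z => g z * sisMap ν p q z) =
      sisMap ν p (((SchwartzMap.smulLeftCLM ℂ g).prodMap (SchwartzMap.smulLeftCLM ℂ g)) q) := by
  ext z
  simp [sisMap, SchwartzMap.smulLeftCLM_apply_apply hg]
  ring

/-- `∇` on `S_sis^{ν,p}(ℂ^×)`. -/
def Ssis.nabla : Ssis ν p →L[ℂ] Ssis ν p := Ssis.lift nablaFun (nablaLift ν p) nablaFun_sisMap

/-- `∇̄` on `S_sis^{ν,p}(ℂ^×)`. -/
def Ssis.nablaBar : Ssis ν p →L[ℂ] Ssis ν p :=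
  Ssis.lift nablaBarFun (nablaBarLift ν p) nablaBarFun_sisMap

/-- Multiplication by `z` on `S_sis^{ν,p}(ℂ^×)`. -/
def Ssis.mulZ : Ssis ν p →L[ℂ] Ssis ν p :=
  Ssis.lift (fun ψ z => z * ψ z) _ (smul_sisMap temperate_id)

/-- Multiplication by `z̄` on `S_sis^{ν,p}(ℂ^×)`. -/
def Ssis.mulZBar : Ssis ν p →L[ℂ] Ssis ν p :=
  Ssis.lift (fun ψ z => starRingEnd ℂ z * ψ z) _ (smul_sisMap temperate_conj)

theorem Ssis.nabla_apply (φ : Ssis ν p) (z : ℂ) : Ssis.nabla φ z = nablaFun φ z := rfl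

theorem Ssis.nablaBar_apply (φ : Ssis ν p) (z : ℂ) : Ssis.nablaBar φ z = nablaBarFun φ z := rfl

theorem Ssis.mulZ_apply (φ : Ssis ν p) (z : ℂ) : Ssis.mulZ φ z = z * φ z := rfl

theorem Ssis.mulZBar_apply (φ : Ssis ν p) (z : ℂ) :
    Ssis.mulZBar φ z = starRingEnd ℂ z * φ z := rfl

/-! ### The space of distributions -/

/-- `T_sis^{ν,p}(ℂ^×)`: the continuous linear functionals on `S_sis^{ν,p}(ℂ^×)`. -/
abbrev Tsis (ν : ℂ) (p : ℤ) : Type := Ssis ν p →L[ℂ] ℂ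

/-- `⟨∇f, φ⟩ = -⟨f, ∇φ + φ⟩`. -/
def Tsis.nabla (f : Tsis ν p) : Tsis ν p := -(f.comp Ssis.nabla + f)

/-- `⟨∇̄f, φ⟩ = -⟨f, ∇̄φ + φ⟩`. -/
def Tsis.nablaBar (f : Tsis ν p) : Tsis ν p := -(f.comp Ssis.nablaBar + f)

/-- `⟨zf, φ⟩ = ⟨f, zφ⟩`. -/
def Tsis.mulZ (f : Tsis ν p) : Tsis ν p := f.comp Ssis.mulZ

/-- `⟨z̄f, φ⟩ = ⟨f, z̄φ⟩`. -/
def Tsis.mulZBar (f : Tsis ν p) : Tsis ν p := f.comp Ssis.mulZBar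

theorem Tsis.nabla_apply (f : Tsis ν p) (φ : Ssis ν p) :
    f.nabla φ = -f (Ssis.nabla φ + φ) := by
  rw [map_add]; rfl

theorem Tsis.nablaBar_apply (f : Tsis ν p) (φ : Ssis ν p) :
    f.nablaBar φ = -f (Ssis.nablaBar φ + φ) := by
  rw [map_add]; rfl

/-! ### The Hankel transform -/

/-- The integrand `φ(z) B_{ν,p}(√(uz))` (the choice of the root is immaterial, `B_{ν,p}` being
even). -/
def hankelIntegrand (ν : ℂ) (p : ℤ) (φ : ℂ → ℂ) (u z : ℂ) : ℂ :=
  φ z * besselB ν p ((u * z) ^ (1 / 2 : ℂ))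

/-- `2π² ∬ φ(z) B_{ν,p}(√(uz)) i dz ∧ dz̄`, where `i dz ∧ dz̄` is twice the Lebesgue measure. -/
def hankelIntegral (ν : ℂ) (p : ℤ) (φ : ℂ → ℂ) (u : ℂ) : ℂ :=
  2 * (Real.pi : ℂ) ^ 2 * (2 * ∫ z : ℂ, hankelIntegrand ν p φ u z)

/-- `H` is the Hankel transform on `S_sis^{ν,p}(ℂ^×)`: a continuous operator on this space that is
given at all `u ≠ 0` by the absolutely convergent Hankel integral. There is at most one. -/
def IsHankelTransform (ν : ℂ) (p : ℤ) (H : Ssis ν p →L[ℂ] Ssis ν p) : Prop :=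
  ∀ (φ : Ssis ν p) (u : ℂ), u ≠ 0 →
    MeasureTheory.Integrable (hankelIntegrand ν p φ u) ∧ H φ u = hankelIntegral ν p φ u

theorem Ssis.apply_zero (φ : Ssis ν p) : φ 0 = 0 := by
  obtain ⟨q, rfl⟩ := sisProj_surjective φ
  change twist ν p 0 * q.1 0 + twist (-ν) (-p) 0 * q.2 0 = 0
  simp [twist]

theorem IsHankelTransform.unique {H K : Ssis ν p →L[ℂ] Ssis ν p}
    (hH : IsHankelTransform ν p H) (hK : IsHankelTransform ν p K) : H = K := by
  refine ContinuousLinearMap.ext fun φ => Ssis.ext fun u => ?_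
  by_cases hu : u = 0
  · rw [hu, Ssis.apply_zero, Ssis.apply_zero]
  · rw [(hH φ u hu).2, (hK φ u hu).2]

/-- The distributional Hankel transform: `⟨Hf, φ⟩ = ⟨f, Hφ⟩`. -/
def Tsis.hankel (H : Ssis ν p →L[ℂ] Ssis ν p) (f : Tsis ν p) : Tsis ν p := f.comp H

end Hankel

end

noncomputable section

namespace Hankel

open Complex

/-! ### The entire function `a ↦ ∑ (-a)^n / (n! Γ(μ+n+1))` -/

/-! With the kernel K(w) = B_{ν,p}(√w), the transform is a multiplicative convolution: Hφ(u) = 4π² ∫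
φ(z) K(uz) dz against Lebesgue measure. Since K depends only on the product, u∂/∂u and z∂/∂z agree
on K(uz), and integration by parts in z gives ∇Hφ = -H(∇φ + φ), and likewise for ∇̄. Bessel's
equation 4∇²K = (ν+p)²K - 16π²wK, transposed in the same way, gives 4H((∇+1)²φ) = (ν+p)²Hφ - 16π²u
H(zφ); conjugation of the variable, which turns p into -p, gives its barred form. The identities for
distributions are the transposes of these (`IsHankelTransform.nabla_apply`,
`IsHankelTransform.nabla_sq_apply` and the barred versions).

The real work is the existence of H as a continuous operator on the test space. It rests on
`exists_isBesselKernel`: K(w) = |w|^ν (w/|w|)^p b₁(w) + |w|^(-ν) (w/|w|)^(-p) b₂(w) with b₁, b₂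
smooth and all their derivatives of polynomial growth. Near the origin this is the power series. At
infinity each of the two products of J-functions may grow exponentially, but their difference is a
combination of H⁽¹⁾(x)H⁽¹⁾(x̄) and H⁽²⁾(x)H⁽²⁾(x̄), in which the exponentials at x and x̄ cancel
(`norm_cylJ_mul_sub_le`). The bound for H⁽¹⁾ combines a crude energy estimate along rays, exact
decay on the positive imaginary axis through the Macdonald integral and its connection formula, and
Phragmén–Lindelöf in the first quadrant (`norm_cylH_le_quadrant`). Derivatives cost nothing more,
because the products `besselProd` with shifted indices form a family closed under Wirtinger
derivatives.

Given such a kernel, the integral of a twisted Schwartz function is a sum of the two powers of u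
times smooth functions of polynomial growth (`IsBesselKernel.integral_eq`); |Re ν| < 1 makes the
weights integrable at the origin. Away from the origin it decays rapidly, since Bessel's equation
lets each factor u be traded for a differential operator on the Schwartz function
(`IsBesselKernel.pow_mul_norm_integral_le`). A cutoff glues the two descriptions into operators on
Schwartz functions (`IsBesselKernel.exists_lift`), with seminorm bounds at each stage, so continuity
for the quotient topology follows. -/

/-- The entire function `∑ (-a)^n / (n! Γ(μ+n+1))`, so that
`besselSeries μ z = besselEntire μ (z ^ 2 / 4)`. -/
def besselEntire (μ a : ℂ) : ℂ :=
  ∑' n : ℕ, (-a) ^ n / ((n.factorial : ℂ) * Gamma (μ + n + 1))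

theorem besselSeries_eq (μ z : ℂ) : besselSeries μ z = besselEntire μ (z ^ 2 / 4) := by
  unfold besselSeries besselEntire
  congr 1
  ext n
  have : (-(z ^ 2 / 4)) ^ n = (-1) ^ n * (z / 2) ^ (2 * n) := by
    rw [pow_mul, ← mul_pow]; congr 1; ring
  rw [this]

/-- Stated for the reciprocal, the functional equation survives at the poles, where Γ takes the
value 0 by convention. This is why the facts below need no restriction on μ. -/
theorem inv_Gamma_succ (s : ℂ) : (Gamma s)⁻¹ = s * (Gamma (s + 1))⁻¹ :=
  one_div_Gamma_eq_self_mul_one_div_Gamma_add_one s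

theorem summable_besselEntire_norm (μ a : ℂ) :
    Summable fun n : ℕ => ‖(-a) ^ n / ((n.factorial : ℂ) * Gamma (μ + n + 1))‖ := by
  refine summable_of_ratio_norm_eventually_le (r := 1 / 2) (by norm_num) ?_
  -- Beyond this index ‖μ + n + 1‖ exceeds 2‖a‖, so the ratio of consecutive terms is at most 1/2.
  obtain ⟨N, hN⟩ := exists_nat_ge (‖μ‖ + 2 * ‖a‖)
  filter_upwards [Filter.eventually_ge_atTop N] with n hn
  have hn' : (N : ℝ) ≤ n := by exact_mod_cast hn
  have hlow : 2 * ‖a‖ + 1 ≤ ‖μ + n + 1‖ := by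
    have h1 : ‖((n : ℂ) + 1)‖ ≤ ‖μ + n + 1‖ + ‖μ‖ := by
      have : (n : ℂ) + 1 = (μ + n + 1) - μ := by ring
      rw [this]; exact norm_sub_le _ _
    have h2 : ‖((n : ℂ) + 1)‖ = n + 1 := by
      have : (n : ℂ) + 1 = ((n + 1 : ℕ) : ℂ) := by push_cast; rfl
      rw [this, norm_natCast]; push_cast; rfl
    linarith
  have hG : (Gamma (μ + n + 1))⁻¹ = (μ + n + 1) * (Gamma (μ + (n + 1 : ℕ) + 1))⁻¹ := by
    rw [inv_Gamma_succ (μ + n + 1)]; push_cast; ring_nf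
  have hG' : ‖Gamma (μ + n + 1)‖⁻¹ = ‖μ + n + 1‖ * ‖Gamma (μ + (n + 1 : ℕ) + 1)‖⁻¹ := by
    rw [← norm_inv, hG, norm_mul, norm_inv]
  have h3 : ((n : ℝ) + 1)⁻¹ ≤ 1 := inv_le_one_of_one_le₀ (by linarith [n.cast_nonneg (α := ℝ)])
  simp only [norm_norm, norm_div, norm_mul, norm_pow, norm_neg, Complex.norm_natCast, Real.norm_natCast,
    Nat.factorial_succ]
  rw [Nat.cast_mul]
  simp only [div_eq_mul_inv, mul_inv]
  rw [hG', Nat.cast_succ, pow_succ]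
  set X := ‖a‖ ^ n * ((n.factorial : ℝ)⁻¹ * ‖Gamma (μ + (n + 1 : ℕ) + 1)‖⁻¹)
  have hX : 0 ≤ X := by positivity
  calc _ = (‖a‖ * ((n : ℝ) + 1)⁻¹) * X := by simp only [X]; push_cast; ring
    _ ≤ (1 / 2 * ‖μ + n + 1‖) * X := by
        apply mul_le_mul_of_nonneg_right _ hX
        calc _ ≤ ‖a‖ * 1 := by gcongr
          _ ≤ _ := by linarith
    _ = _ := by simp only [X]; push_cast; ring

/-- Termwise differentiation: the derivative of the n-th term is minus the (n-1)-st term of order μ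
+ 1, dominated on a ball by its value at the radius. -/
theorem hasDerivAt_besselEntire (μ a : ℂ) :
    HasDerivAt (besselEntire μ) (-besselEntire (μ + 1) a) a := by
  set R : ℝ := ‖a‖ + 1
  have hR : 0 ≤ R := by positivity
  have hterm : ∀ (n : ℕ) (y : ℂ), (n : ℂ) * (-y) ^ (n - 1) * (-1) /
      ((n.factorial : ℂ) * Gamma (μ + n + 1)) = if n = 0 then 0 else
      -((-y) ^ (n - 1) / (((n - 1).factorial : ℂ) * Gamma (μ + 1 + (n - 1 : ℕ) + 1))) := by
    intro n y
    rcases n with _ | n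
    · simp
    · have h : ((n : ℂ) + 1) ≠ 0 := by exact_mod_cast Nat.succ_ne_zero n
      simp only [Nat.add_sub_cancel, Nat.factorial_succ, Nat.succ_ne_zero, if_false]
      push_cast
      rw [show μ + (n + 1 : ℂ) + 1 = μ + 1 + n + 1 by ring]
      simp only [div_eq_mul_inv, mul_inv]
      field_simp
  have hs := summable_besselEntire_norm (μ + 1) R
  have key := hasDerivAt_tsum_of_isPreconnected (𝕜 := ℂ)
    (u := fun n : ℕ => if n = 0 then 0 else
      ‖(-(R : ℂ)) ^ (n - 1) / (((n - 1).factorial : ℂ) * Gamma (μ + 1 + (n - 1 : ℕ) + 1))‖)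
    (g := fun (n : ℕ) (y : ℂ) => (-y) ^ n / ((n.factorial : ℂ) * Gamma (μ + n + 1)))
    (g' := fun (n : ℕ) (y : ℂ) => (n : ℂ) * (-y) ^ (n - 1) * (-1) /
      ((n.factorial : ℂ) * Gamma (μ + n + 1)))
    (t := Metric.ball 0 R) (y₀ := a) (y := a) ?_ Metric.isOpen_ball
    (convex_ball 0 R).isPreconnected ?_ ?_ ?_ ?_ ?_
  · have h2 : ∑' n : ℕ, (n : ℂ) * (-a) ^ (n - 1) * (-1) /
        ((n.factorial : ℂ) * Gamma (μ + n + 1)) = -besselEntire (μ + 1) a := by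
      have hsum : Summable fun n : ℕ => (n : ℂ) * (-a) ^ (n - 1) * (-1) /
          ((n.factorial : ℂ) * Gamma (μ + n + 1)) := by
        rw [← summable_nat_add_iff 1]
        simp only [hterm]
        exact (summable_besselEntire_norm (μ + 1) a).of_norm.neg
      rw [hsum.tsum_eq_zero_add]
      simp only [hterm]
      simp [besselEntire, tsum_neg]
    rw [h2] at key
    exact key
  · rw [← summable_nat_add_iff 1]
    simpa using hs
  · intro n y _
    have h1 : HasDerivAt (fun y : ℂ => (-y) ^ n) ((n : ℂ) * (-y) ^ (n - 1) * (-1)) y :=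
      (hasDerivAt_neg y).pow n
    exact h1.div_const _
  · intro n y hy
    rw [hterm]
    split_ifs with h
    · simp
    · have hyR : ‖y‖ ≤ R := by simpa using (Metric.mem_ball.1 hy).le
      rw [norm_neg, norm_div, norm_div, norm_pow, norm_pow, norm_neg, norm_neg, norm_real,
        Real.norm_of_nonneg hR]
      gcongr
  · simp [R]
  · exact (summable_besselEntire_norm μ a).of_norm
  · simp [R]

theorem differentiable_besselEntire (μ : ℂ) : Differentiable ℂ (besselEntire μ) :=
  fun a => (hasDerivAt_besselEntire μ a).differentiableAt

theorem continuous_besselEntire (μ : ℂ) : Continuous (besselEntire μ) :=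
  (differentiable_besselEntire μ).continuous

theorem besselEntire_zero (μ : ℂ) : besselEntire μ 0 = (Gamma (μ + 1))⁻¹ := by
  unfold besselEntire
  rw [tsum_eq_single 0 (fun n hn => by simp [hn])]
  simp

/-- The three-term recurrence. -/
theorem besselEntire_sub_one (μ a : ℂ) :
    besselEntire (μ - 1) a = μ * besselEntire μ a - a * besselEntire (μ + 1) a := by
  have h0 := (summable_besselEntire_norm (μ - 1) a).of_norm
  have h1 := (summable_besselEntire_norm μ a).of_norm
  have h2 := (summable_besselEntire_norm (μ + 1) a).of_norm
  have e0 : besselEntire (μ - 1) a = (Gamma μ)⁻¹ + ∑' n : ℕ,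
      (-a) ^ (n + 1) / (((n + 1).factorial : ℂ) * Gamma (μ - 1 + (n + 1 : ℕ) + 1)) := by
    unfold besselEntire; rw [h0.tsum_eq_zero_add]; simp
  have e1 : besselEntire μ a = (Gamma (μ + 1))⁻¹ + ∑' n : ℕ,
      (-a) ^ (n + 1) / (((n + 1).factorial : ℂ) * Gamma (μ + (n + 1 : ℕ) + 1)) := by
    unfold besselEntire; rw [h1.tsum_eq_zero_add]; simp
  have h1' := (summable_nat_add_iff 1).2 h1
  rw [e0, e1, mul_add, ← inv_Gamma_succ, ← tsum_mul_left, add_sub_assoc]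
  congr 1
  unfold besselEntire
  rw [← tsum_mul_left, ← (h1'.mul_left μ).tsum_sub (h2.mul_left a)]
  congr 1
  ext n
  have hn : ((n : ℂ) + 1) ≠ 0 := by exact_mod_cast Nat.succ_ne_zero n
  have hf : (n.factorial : ℂ) ≠ 0 := by exact_mod_cast n.factorial_ne_zero
  have hG := inv_Gamma_succ (μ + n + 1)
  rw [Nat.factorial_succ]
  push_cast
  rw [show μ - 1 + (n + 1 : ℂ) + 1 = μ + n + 1 by ring,
    show μ + (n + 1 : ℂ) + 1 = μ + n + 1 + 1 by ring,
    show μ + 1 + (n : ℂ) + 1 = μ + n + 1 + 1 by ring]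
  simp only [div_eq_mul_inv, mul_inv]
  rw [hG]
  field_simp
  ring

theorem besselEntire_conj (μ a : ℂ) :
    besselEntire (starRingEnd ℂ μ) (starRingEnd ℂ a) = starRingEnd ℂ (besselEntire μ a) := by
  unfold besselEntire
  rw [conj_tsum]
  congr 1
  ext n
  simp [← Gamma_conj]

/-! ### The Macdonald integral -/

/-- The integrand of `macdonald`. -/
def macdonaldIntegrand (s : ℂ) (a : ℝ) (x : ℝ) : ℂ :=
  cexp (s * x - Real.exp x - a * Real.exp (-x))

/-- `∫ exp(s x - e^x - a e^(-x)) dx = 2 a^(s/2) K_s(2√a)`. -/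
def macdonald (s : ℂ) (a : ℝ) : ℂ := ∫ x : ℝ, macdonaldIntegrand s a x

theorem norm_macdonaldIntegrand (s : ℂ) (a x : ℝ) :
    ‖macdonaldIntegrand s a x‖ = Real.exp (s.re * x - Real.exp x - a * Real.exp (-x)) := by
  rw [macdonaldIntegrand, norm_exp]
  congr 1
  rw [← Complex.ofReal_mul]
  simp only [sub_re, ofReal_re, mul_re, ofReal_im, mul_zero, sub_zero]

theorem continuous_macdonaldIntegrand (s : ℂ) (a : ℝ) : Continuous (macdonaldIntegrand s a) := by
  unfold macdonaldIntegrand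
  fun_prop

/-- At a = 0 the substitution t = e^x turns Euler's integral for Γ(s) into the Macdonald integral.
-/
theorem macdonaldIntegrand_zero (s : ℂ) (x : ℝ) :
    macdonaldIntegrand s 0 x =
      |Real.exp x| • (Real.exp (-Real.exp x) * (Real.exp x : ℂ) ^ (s - 1)) := by
  have h : (Real.exp x : ℂ) ≠ 0 := by exact_mod_cast (Real.exp_pos x).ne'
  rw [abs_of_pos (Real.exp_pos x), Complex.cpow_sub _ _ h, Complex.cpow_one,
    Complex.cpow_def_of_ne_zero h, ← Complex.ofReal_log (Real.exp_pos x).le, Real.log_exp,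
    macdonaldIntegrand, real_smul, Complex.ofReal_exp (-Real.exp x)]
  field_simp
  rw [← Complex.exp_add]
  congr 1
  push_cast
  ring

theorem range_exp_image : Real.exp '' Set.univ = Set.Ioi 0 := by
  rw [Set.image_univ, Real.range_exp]

theorem integrable_macdonaldIntegrand_zero {s : ℂ} (hs : 0 < s.re) :
    MeasureTheory.Integrable (macdonaldIntegrand s 0) := by
  have h := GammaIntegral_convergent hs
  rw [← range_exp_image, MeasureTheory.integrableOn_image_iff_integrableOn_abs_deriv_smul
    MeasurableSet.univ (fun x _ => (Real.hasDerivAt_exp x).hasDerivWithinAt)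
    Real.exp_injective.injOn] at h
  rw [← MeasureTheory.integrableOn_univ]
  refine h.congr_fun (fun x _ => ?_) MeasurableSet.univ
  exact (macdonaldIntegrand_zero s x).symm

theorem macdonald_zero {s : ℂ} (hs : 0 < s.re) : macdonald s 0 = Gamma s := by
  rw [Gamma_eq_integral hs, GammaIntegral, ← range_exp_image,
    MeasureTheory.integral_image_eq_integral_abs_deriv_smul
    MeasurableSet.univ (fun x _ => (Real.hasDerivAt_exp x).hasDerivWithinAt)
    Real.exp_injective.injOn, MeasureTheory.setIntegral_univ, macdonald]
  congr 1
  ext x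
  exact macdonaldIntegrand_zero s x

/-- For a > 0 no condition on s is needed: keeping one term of the exponential series, e^(-a e^(-x))
≤ (k!/a^k) e^(kx), which moves s to s + k with positive real part and reduces to a = 0. -/
theorem integrable_macdonaldIntegrand (s : ℂ) {a : ℝ} (ha : 0 < a) :
    MeasureTheory.Integrable (macdonaldIntegrand s a) := by
  obtain ⟨k, hk⟩ := exists_nat_gt (-s.re)
  have hs : 0 < (s + k).re := by simp; linarith
  refine ((integrable_macdonaldIntegrand_zero hs).norm.const_mul (k.factorial / a ^ k)).mono'
    (continuous_macdonaldIntegrand s a).aestronglyMeasurable (Filter.Eventually.of_forall ?_)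
  intro x
  rw [norm_macdonaldIntegrand, norm_macdonaldIntegrand]
  have h1 := Real.pow_div_factorial_le_exp (a * Real.exp (-x)) (by positivity) k
  have h2 : Real.exp (-(a * Real.exp (-x))) ≤ k.factorial / a ^ k * Real.exp (k * x) := by
    rw [Real.exp_neg]
    have h3 : (k.factorial / a ^ k * Real.exp (k * x)) =
        ((a * Real.exp (-x)) ^ k / k.factorial)⁻¹ := by
      rw [mul_pow, ← Real.exp_nat_mul, show (k : ℝ) * x = -(k * -x) by ring, Real.exp_neg]
      field_simp
    rw [h3]
    exact inv_anti₀ (by positivity) h1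
  calc _ = Real.exp (s.re * x - Real.exp x) * Real.exp (-(a * Real.exp (-x))) := by
        rw [← Real.exp_add]; congr 1
    _ ≤ Real.exp (s.re * x - Real.exp x) * (k.factorial / a ^ k * Real.exp (k * x)) := by gcongr
    _ = k.factorial / a ^ k * (Real.exp (s.re * x - Real.exp x) * Real.exp (k * x)) := by ring
    _ = _ := by rw [← Real.exp_add]; congr 2; simp; ring

theorem hasDerivAt_macdonald (s : ℂ) {a : ℝ} (ha : 0 < a) :
    HasDerivAt (macdonald s) (-macdonald (s - 1) a) a := by
  have hd : ∀ x b : ℝ, HasDerivAt (fun b : ℝ => macdonaldIntegrand s b x)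
      (-macdonaldIntegrand (s - 1) b x) b := by
    intro x b
    have h1 : HasDerivAt (fun b : ℝ => s * x - Real.exp x - b * Real.exp (-x) : ℝ → ℂ)
        (-(Real.exp (-x) : ℂ)) b := by
      have := ((hasDerivAt_id b).ofReal_comp.mul_const (Real.exp (-x) : ℂ)).const_sub
        (s * x - Real.exp x)
      simpa using this
    have h2 := h1.cexp
    refine h2.congr_deriv ?_
    rw [macdonaldIntegrand, mul_neg, Complex.ofReal_exp (-x), ← Complex.exp_add]
    congr 2
    push_cast
    ring
  have h := hasDerivAt_integral_of_dominated_loc_of_deriv_le (𝕜 := ℝ) (μ := MeasureTheory.volume)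
    (F := fun (b x : ℝ) => macdonaldIntegrand s b x)
    (F' := fun (b x : ℝ) => -macdonaldIntegrand (s - 1) b x) (x₀ := a)
    (bound := fun x => ‖macdonaldIntegrand (s - 1) (a / 2) x‖)
    (s := Set.Ioi (a / 2)) (Ioi_mem_nhds (by linarith))
    (Filter.Eventually.of_forall fun b =>
      (continuous_macdonaldIntegrand s b).aestronglyMeasurable)
    (integrable_macdonaldIntegrand s ha)
    (continuous_macdonaldIntegrand (s - 1) a).neg.aestronglyMeasurable
    (Filter.Eventually.of_forall fun x b hb => by
      rw [norm_neg, norm_macdonaldIntegrand, norm_macdonaldIntegrand]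
      have : a / 2 ≤ b := le_of_lt hb
      gcongr)
    (integrable_macdonaldIntegrand (s - 1) (by linarith)).norm
    (Filter.Eventually.of_forall fun x b _ => hd x b)
  have h2 := h.2
  rw [MeasureTheory.integral_neg] at h2
  exact h2

/-- The left side is the integral over the line of the derivative of the integrand. -/
theorem macdonald_recurrence (s : ℂ) {a : ℝ} (ha : 0 < a) :
    s * macdonald s a - macdonald (s + 1) a + a * macdonald (s - 1) a = 0 := by
  have h0 := integrable_macdonaldIntegrand s ha
  have h1 := integrable_macdonaldIntegrand (s + 1) ha
  have h2 := integrable_macdonaldIntegrand (s - 1) ha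
  have hd : ∀ x : ℝ, HasDerivAt (macdonaldIntegrand s a)
      (s * macdonaldIntegrand s a x - macdonaldIntegrand (s + 1) a x +
        a * macdonaldIntegrand (s - 1) a x) x := by
    intro x
    have e1 : HasDerivAt (fun x : ℝ => (Real.exp x : ℂ)) (Real.exp x : ℂ) x :=
      (Real.hasDerivAt_exp x).ofReal_comp
    have e2 : HasDerivAt (fun x : ℝ => (Real.exp (-x) : ℂ)) ((Real.exp (-x) * -1 : ℝ) : ℂ) x :=
      ((Real.hasDerivAt_exp (-x)).comp x (hasDerivAt_neg x)).ofReal_comp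
    have e3 := (((hasDerivAt_id x).ofReal_comp.const_mul s).sub e1).sub (e2.const_mul (a : ℂ))
    refine e3.cexp.congr_deriv ?_
    have f1 : macdonaldIntegrand (s + 1) a x = macdonaldIntegrand s a x * (Real.exp x : ℂ) := by
      rw [macdonaldIntegrand, macdonaldIntegrand]
      conv_rhs => rw [Complex.ofReal_exp x, ← Complex.exp_add]
      congr 1
      push_cast
      ring
    have f2 : macdonaldIntegrand (s - 1) a x =
        macdonaldIntegrand s a x * (Real.exp (-x) : ℂ) := by
      rw [macdonaldIntegrand, macdonaldIntegrand]
      conv_rhs => rw [Complex.ofReal_exp (-x), ← Complex.exp_add]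
      congr 1
      push_cast
      ring
    rw [f1, f2, macdonaldIntegrand]
    simp only [id_eq, Pi.sub_apply]
    push_cast
    ring
  have h3 := MeasureTheory.integral_eq_zero_of_hasDerivAt_of_integrable hd
    (((h0.const_mul s).sub h1).add (h2.const_mul (a : ℂ))) h0
  have h4 := MeasureTheory.integral_add ((h0.const_mul s).sub h1) (h2.const_mul (a : ℂ))
  have h5 := MeasureTheory.integral_sub (h0.const_mul s) h1
  simp only [Pi.sub_apply] at h4
  rw [h4, h5, MeasureTheory.integral_const_mul, MeasureTheory.integral_const_mul] at h3
  exact h3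

/-- The reflection x ↦ log a - x exchanges e^x and a e^(-x). -/
theorem macdonald_neg (s : ℂ) {a : ℝ} (ha : 0 < a) :
    macdonald (-s) a = (a : ℂ) ^ (-s) * macdonald s a := by
  rw [macdonald, macdonald, ← MeasureTheory.integral_sub_left_eq_self _ _ (Real.log a),
    ← MeasureTheory.integral_const_mul]
  congr 1
  ext x
  have ha' : (a : ℂ) ≠ 0 := by exact_mod_cast ha.ne'
  rw [macdonaldIntegrand, macdonaldIntegrand, Complex.cpow_def_of_ne_zero ha', ← Complex.exp_add,
    ← Complex.ofReal_log ha.le]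
  congr 1
  have e1 : Real.exp (Real.log a - x) = a * Real.exp (-x) := by
    rw [sub_eq_add_neg, Real.exp_add, Real.exp_log ha]
  have e2 : a * Real.exp (-(Real.log a - x)) = Real.exp x := by
    rw [neg_sub, Real.exp_sub, Real.exp_log ha]; field_simp
  have e2' : (a : ℂ) * Real.exp (-(Real.log a - x)) = Real.exp x := by exact_mod_cast e2
  rw [e1, e2']
  push_cast
  ring

/-- Dominated convergence, the integrand at a = 0 being the bound. The limit fixes the constant in
the Wronskian identity below. -/
theorem tendsto_macdonald {s : ℂ} (hs : 0 < s.re) :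
    Filter.Tendsto (macdonald s) (nhdsWithin 0 (Set.Ioi 0)) (nhds (Gamma s)) := by
  rw [← macdonald_zero hs]
  refine MeasureTheory.tendsto_integral_filter_of_dominated_convergence
    (fun x => ‖macdonaldIntegrand s 0 x‖)
    (Filter.Eventually.of_forall fun b =>
      (continuous_macdonaldIntegrand s b).aestronglyMeasurable) ?_
    (integrable_macdonaldIntegrand_zero hs).norm (Filter.Eventually.of_forall fun x => ?_)
  · filter_upwards [self_mem_nhdsWithin] with b hb
    refine Filter.Eventually.of_forall fun x => ?_
    rw [norm_macdonaldIntegrand, norm_macdonaldIntegrand]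
    have : 0 ≤ b := le_of_lt hb
    gcongr
  · have : Continuous fun b : ℝ => macdonaldIntegrand s b x := by
      unfold macdonaldIntegrand; fun_prop
    exact this.continuousAt.mono_left nhdsWithin_le_nhds

/-- Decay of the Macdonald integral. -/
theorem norm_macdonald_sq_le (s : ℂ) : ∃ C, ∀ y : ℝ, 1 ≤ y →
    ‖macdonald s (y ^ 2)‖ ≤ C * y ^ s.re * Real.exp (-2 * y) := by
  refine ⟨Real.exp 2 * ∫ x, ‖macdonaldIntegrand s 1 x‖, fun y hy => ?_⟩
  have hy0 : 0 < y := by linarith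
  -- Translation by log y makes the exponent symmetric, -y(e^x + e^(-x)). As y ≥ 1 and e^x + e^(-x)
  -- ≥ 2, it is at most 2 - 2y - (e^x + e^(-x)), which leaves the integrand at a = 1 and accounts
  -- for the factor e².
  rw [macdonald, ← MeasureTheory.integral_add_right_eq_self _ (Real.log y)]
  calc _ ≤ ∫ x, y ^ s.re * Real.exp (2 - 2 * y) * ‖macdonaldIntegrand s 1 x‖ := by
        refine MeasureTheory.norm_integral_le_of_norm_le
          ((integrable_macdonaldIntegrand s one_pos).norm.const_mul _)
          (Filter.Eventually.of_forall fun x => ?_)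
        rw [norm_macdonaldIntegrand, norm_macdonaldIntegrand, Real.rpow_def_of_pos hy0,
          ← Real.exp_add, ← Real.exp_add]
        apply Real.exp_le_exp.2
        have e1 : Real.exp (x + Real.log y) = y * Real.exp x := by
          rw [Real.exp_add, Real.exp_log hy0, mul_comm]
        have e2 : y ^ 2 * Real.exp (-(x + Real.log y)) = y * Real.exp (-x) := by
          rw [neg_add, Real.exp_add, Real.exp_neg (Real.log y), Real.exp_log hy0]; field_simp
        rw [e1, e2]
        have e3 : 2 ≤ Real.exp x + Real.exp (-x) := by
          have := Real.one_le_cosh x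
          rw [Real.cosh_eq] at this; linarith
        nlinarith
    _ = _ := by
        rw [MeasureTheory.integral_const_mul, sub_eq_add_neg, Real.exp_add, neg_mul]; ring

/-! ### The connection formula -/

/-- The modified companion `∑ a^n / (n! Γ(μ+n+1))` of `besselEntire`. -/
def besselEntireI (μ a : ℂ) : ℂ := besselEntire μ (-a)

theorem hasDerivAt_besselEntireI (μ a : ℂ) :
    HasDerivAt (besselEntireI μ) (besselEntireI (μ + 1) a) a := by
  have h := (hasDerivAt_besselEntire μ (-a)).comp a (hasDerivAt_neg a)
  refine h.congr_deriv ?_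
  simp [besselEntireI]

theorem besselEntireI_sub_one (μ a : ℂ) :
    besselEntireI (μ - 1) a = μ * besselEntireI μ a + a * besselEntireI (μ + 1) a := by
  simp only [besselEntireI, besselEntire_sub_one μ (-a)]
  ring

/-- This is the Wronskian of I and K. Its derivative vanishes by the two recurrences, and as a → 0+
it tends to Γ(μ+1)/Γ(μ+1); Re μ > 0 ensures that K of order μ has a finite limit there. -/
theorem besselEntireI_macdonald_aux {μ : ℂ} (hμ : 0 < μ.re) {a : ℝ} (ha : 0 < a) :
    besselEntireI μ a * macdonald (μ + 1) a +
      a * besselEntireI (μ + 1) a * macdonald μ a = 1 := by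
  set W : ℝ → ℂ := fun a => besselEntireI μ a * macdonald (μ + 1) a +
    a * besselEntireI (μ + 1) a * macdonald μ a
  have hW : ∀ b ∈ Set.Ioi (0 : ℝ), HasDerivAt W 0 b := by
    intro b hb
    have h1 := (hasDerivAt_besselEntireI μ b).comp_ofReal
    have h2 := (hasDerivAt_besselEntireI (μ + 1) b).comp_ofReal
    have h3 := hasDerivAt_macdonald μ hb
    have h4 := hasDerivAt_macdonald (μ + 1) hb
    have h5 : HasDerivAt (fun b : ℝ => (b : ℂ)) 1 b := (hasDerivAt_id b).ofReal_comp
    refine ((h1.mul h4).add ((h5.mul h2).mul h3)).congr_deriv ?_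
    have r1 := macdonald_recurrence μ hb
    have r2 := besselEntireI_sub_one (μ + 1) b
    rw [add_sub_cancel_right] at r2 ⊢
    simp only [Pi.mul_apply]
    linear_combination macdonald μ b * r2 * (-1) - besselEntireI (μ + 1) b * r1
  have hconst : ∀ b ∈ Set.Ioi (0 : ℝ), W b = W a := by
    intro b hb
    exact (convex_Ioi (0 : ℝ)).is_const_of_fderivWithin_eq_zero (𝕜 := ℝ)
      (fun c hc => (hW c hc).differentiableAt.differentiableWithinAt)
      (fun c hc => by
        rw [fderivWithin_of_isOpen isOpen_Ioi hc]
        ext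
        simp [(hW c hc).deriv]) hb ha
  have hlim : Filter.Tendsto W (nhdsWithin 0 (Set.Ioi 0)) (nhds
      (besselEntireI μ 0 * Gamma (μ + 1) + 0 * besselEntireI (μ + 1) 0 * Gamma μ)) := by
    have hμ1 : 0 < (μ + 1).re := by simp; linarith
    have hc : ∀ μ : ℂ, Filter.Tendsto (fun b : ℝ => besselEntireI μ b) (nhdsWithin 0 (Set.Ioi 0))
        (nhds (besselEntireI μ 0)) := by
      intro μ
      have : Continuous fun b : ℝ => besselEntireI μ b := by
        unfold besselEntireI
        exact (continuous_besselEntire μ).comp (continuous_ofReal.neg)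
      have h := (this.tendsto 0).mono_left (nhdsWithin_le_nhds (s := Set.Ioi 0))
      simpa using h
    have hid : Filter.Tendsto (fun b : ℝ => (b : ℂ)) (nhdsWithin 0 (Set.Ioi 0)) (nhds 0) := by
      have h := (continuous_ofReal.tendsto 0).mono_left (nhdsWithin_le_nhds (s := Set.Ioi 0))
      simpa using h
    exact ((hc μ).mul (tendsto_macdonald hμ1)).add
      ((hid.mul (hc (μ + 1))).mul (tendsto_macdonald hμ))
  have hlim2 : Filter.Tendsto W (nhdsWithin 0 (Set.Ioi 0)) (nhds (W a)) :=
    tendsto_const_nhds.congr' (by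
      filter_upwards [self_mem_nhdsWithin] with b hb using (hconst b hb).symm)
  have := tendsto_nhds_unique hlim2 hlim
  change W a = 1
  rw [this, besselEntireI, neg_zero, besselEntire_zero, zero_mul, zero_mul, add_zero]
  refine inv_mul_cancel₀ (Gamma_ne_zero_of_re_pos ?_)
  simp; linarith

/-- The recurrences show that the Wronskian does not change when μ is replaced by μ + 1, so it can
be moved to Re μ > 0. -/
theorem besselEntireI_macdonald (μ : ℂ) {a : ℝ} (ha : 0 < a) :
    besselEntireI μ a * macdonald (μ + 1) a +
      a * besselEntireI (μ + 1) a * macdonald μ a = 1 := by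
  obtain ⟨n, hn⟩ := exists_nat_gt (-μ.re)
  induction n generalizing μ with
  | zero => exact besselEntireI_macdonald_aux (by simpa using hn) ha
  | succ n ih =>
    have h := ih (μ + 1) (by push_cast at hn; simp; linarith)
    have r1 := macdonald_recurrence (μ + 1) ha
    have r2 := besselEntireI_sub_one (μ + 1) a
    rw [add_sub_cancel_right] at r1 r2
    linear_combination h + macdonald (μ + 1) a * r2 + besselEntireI (μ + 1) a * r1

/-- The connection formula between the Macdonald integral and the modified Bessel series, with an
unspecified constant. -/
theorem besselEntireI_neg_sub (μ : ℂ) : ∃ w : ℂ, ∀ a : ℝ, 0 < a →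
    besselEntireI (-μ) a - (a : ℂ) ^ μ * besselEntireI μ a = w * macdonald μ a := by
  -- The Wronskian of the two I-functions, an entire function with zero derivative. It appears as
  -- the coefficient when `macdonald (μ + 1)` is eliminated between the I–K Wronskian identities for
  -- μ and for -μ - 1.
  set w : ℂ → ℂ := fun a => a * besselEntireI (μ + 1) a * besselEntireI (-μ) a -
    besselEntireI μ a * besselEntireI (-μ - 1) a
  have hw : ∀ a, HasDerivAt w 0 a := by
    intro a
    have h1 := hasDerivAt_besselEntireI (μ + 1) a
    have h2 := hasDerivAt_besselEntireI (-μ) a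
    have h3 := hasDerivAt_besselEntireI μ a
    have h4 := hasDerivAt_besselEntireI (-μ - 1) a
    refine ((((hasDerivAt_id a).mul h1).mul h2).sub (h3.mul h4)).congr_deriv ?_
    have r1 := besselEntireI_sub_one (μ + 1) a
    have r2 := besselEntireI_sub_one (-μ) a
    rw [add_sub_cancel_right] at r1
    rw [sub_add_cancel]
    simp only [id_eq, Pi.mul_apply]
    linear_combination (-besselEntireI (-μ) a) * r1 - besselEntireI (μ + 1) a * r2
  refine ⟨w 0, fun a ha => ?_⟩
  have hw0 : w 0 = w a := is_const_of_deriv_eq_zero (fun b => (hw b).differentiableAt)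
    (fun b => (hw b).deriv) _ _
  have ha' : (a : ℂ) ≠ 0 := by exact_mod_cast ha.ne'
  have e1 := besselEntireI_macdonald μ ha
  have e2 := besselEntireI_macdonald (-μ - 1) ha
  have s1 := macdonald_neg μ ha
  have s2 := macdonald_neg (μ + 1) ha
  rw [sub_add_cancel, s1, show -μ - 1 = -(μ + 1) by ring, s2,
    show -(μ + 1) = -μ - 1 by ring, Complex.cpow_sub _ _ ha', Complex.cpow_one] at e2
  have hp : (a : ℂ) ^ μ * (a : ℂ) ^ (-μ) = 1 := by
    rw [← Complex.cpow_add _ _ ha', add_neg_cancel, Complex.cpow_zero]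
  have e3 : besselEntireI (-μ - 1) a * macdonald μ a +
      besselEntireI (-μ) a * macdonald (μ + 1) a = (a : ℂ) ^ μ := by
    have : (a : ℂ) * ((a : ℂ) ^ (-μ) / a) = (a : ℂ) ^ (-μ) := by field_simp
    linear_combination (a : ℂ) ^ μ * e2 - (besselEntireI (-μ - 1) a * macdonald μ a +
      besselEntireI (-μ) a * macdonald (μ + 1) a) * hp -
      (a : ℂ) ^ μ * besselEntireI (-μ) a * macdonald (μ + 1) a * this
  rw [hw0]
  simp only [w]
  linear_combination (-besselEntireI (-μ) a) * e1 + besselEntireI μ a * e3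

/-! ### Growth of Bessel functions in the right half-plane -/

/-- The function `J_μ(2x) = x^μ ∑ (-x²)^n / (n! Γ(μ+n+1))`. -/
def cylJ (μ x : ℂ) : ℂ := x ^ μ * besselEntire μ (x ^ 2)

theorem hasDerivAt_besselEntire_sq (μ x : ℂ) :
    HasDerivAt (fun x => besselEntire μ (x ^ 2)) (-(2 * x) * besselEntire (μ + 1) (x ^ 2)) x := by
  have h := (hasDerivAt_besselEntire μ (x ^ 2)).comp x (hasDerivAt_pow 2 x)
  refine h.congr_deriv ?_
  simp; ring

theorem hasDerivAt_cylJ (μ : ℂ) {x : ℂ} (hx : x ∈ slitPlane) :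
    HasDerivAt (cylJ μ) (μ / x * cylJ μ x - 2 * cylJ (μ + 1) x) x := by
  have hx0 := slitPlane_ne_zero hx
  have h := (hasStrictDerivAt_cpow_const (c := μ) hx).hasDerivAt.mul
    (hasDerivAt_besselEntire_sq μ x)
  refine h.congr_deriv ?_
  simp only [cylJ]
  rw [Complex.cpow_sub _ _ hx0, Complex.cpow_add _ _ hx0, Complex.cpow_one]
  field_simp
  ring

theorem cylJ_sub_one (μ : ℂ) {x : ℂ} (hx : x ≠ 0) :
    cylJ (μ - 1) x = μ / x * cylJ μ x - cylJ (μ + 1) x := by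
  simp only [cylJ]
  rw [besselEntire_sub_one, Complex.cpow_sub _ _ hx, Complex.cpow_add _ _ hx, Complex.cpow_one]
  field_simp

theorem continuousOn_cylJ (μ : ℂ) : ContinuousOn (cylJ μ) slitPlane :=
  fun _ hx => (hasDerivAt_cylJ μ hx).continuousAt.continuousWithinAt

theorem mem_slitPlane_of_re_nonneg {x : ℂ} (h : 0 ≤ x.re) (hx : x ≠ 0) : x ∈ slitPlane := by
  rw [mem_slitPlane_iff]
  by_contra hc
  push Not at hc
  exact hx (Complex.ext (le_antisymm hc.1 h) hc.2)

/-- The coupling terms 2ωB and -2ωA are skew for real ω, so in the derivative of ‖A‖² + ‖B‖² only Im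
ω survives from them; the diagonal terms contribute O(1/r). -/
theorem inner_bessel_system_le (A B ω μ : ℂ) (r : ℝ) (hr : 0 < r) :
    2 * inner ℝ A (2 * ω * B - μ / r * A) + 2 * inner ℝ B ((μ - 1) / r * B - 2 * ω * A) ≤
      (4 * |ω.im| + 2 * (‖μ‖ + ‖μ - 1‖) / r) * (‖A‖ ^ 2 + ‖B‖ ^ 2) := by
  have h1 : inner ℝ A (2 * ω * B) - inner ℝ B (2 * ω * A) ≤ 2 * |ω.im| * (‖A‖ ^ 2 + ‖B‖ ^ 2) := by
    have e1 : inner ℝ A (2 * ω * B) - inner ℝ B (2 * ω * A) =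
        -4 * ω.im * (starRingEnd ℂ A * B).im := by
      simp [Complex.inner]; ring
    have e2 : |(starRingEnd ℂ A * B).im| ≤ ‖A‖ * ‖B‖ := by
      refine (abs_im_le_norm _).trans ?_
      simp
    rw [e1]
    calc -4 * ω.im * (starRingEnd ℂ A * B).im
        ≤ |-4 * ω.im * (starRingEnd ℂ A * B).im| := le_abs_self _
      _ = 4 * |ω.im| * |(starRingEnd ℂ A * B).im| := by rw [abs_mul, abs_mul]; norm_num
      _ ≤ 4 * |ω.im| * (‖A‖ * ‖B‖) := by gcongr
      _ ≤ _ := by nlinarith [sq_nonneg (‖A‖ - ‖B‖), abs_nonneg ω.im,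
          mul_nonneg (abs_nonneg ω.im) (sq_nonneg (‖A‖ - ‖B‖))]
  have h2 : -inner ℝ A (μ / r * A) ≤ ‖μ‖ / r * ‖A‖ ^ 2 := by
    have := abs_real_inner_le_norm A (μ / r * A)
    rw [norm_mul, norm_div, norm_real, Real.norm_of_nonneg hr.le] at this
    have h := neg_abs_le (inner ℝ A (μ / r * A))
    linarith
  have h3 : inner ℝ B ((μ - 1) / r * B) ≤ ‖μ - 1‖ / r * ‖B‖ ^ 2 := by
    have := abs_real_inner_le_norm B ((μ - 1) / r * B)
    rw [norm_mul, norm_div, norm_real, Real.norm_of_nonneg hr.le] at this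
    have h := le_abs_self (inner ℝ B ((μ - 1) / r * B))
    linarith
  rw [inner_sub_right, inner_sub_right]
  have h4 : 0 ≤ ‖μ‖ / r * ‖B‖ ^ 2 := by positivity
  have h5 : 0 ≤ ‖μ - 1‖ / r * ‖A‖ ^ 2 := by positivity
  have : (4 * |ω.im| + 2 * (‖μ‖ + ‖μ - 1‖) / r) * (‖A‖ ^ 2 + ‖B‖ ^ 2) =
    2 * (2 * |ω.im| * (‖A‖ ^ 2 + ‖B‖ ^ 2)) + 2 * (‖μ‖ / r * ‖A‖ ^ 2) + 2 * (‖μ‖ / r * ‖B‖ ^ 2) +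
      2 * (‖μ - 1‖ / r * ‖A‖ ^ 2) + 2 * (‖μ - 1‖ / r * ‖B‖ ^ 2) := by ring
  linarith

/-- Energy estimate for the Bessel system along a ray. -/
theorem cylJ_energy_le (μ : ℂ) {ω : ℂ} (hω : ω ∈ slitPlane) {r : ℝ} (hr : 1 ≤ r) :
    ‖cylJ μ (r * ω)‖ ^ 2 + ‖cylJ (μ - 1) (r * ω)‖ ^ 2 ≤
      (‖cylJ μ ω‖ ^ 2 + ‖cylJ (μ - 1) ω‖ ^ 2) *
        Real.exp (4 * |ω.im| * (r - 1) + 2 * (‖μ‖ + ‖μ - 1‖) * Real.log r) := by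
  have hω0 := slitPlane_ne_zero hω
  have hmem : ∀ s : ℝ, 0 < s → (s : ℂ) * ω ∈ slitPlane := by
    intro s hs
    rw [mem_slitPlane_iff] at hω ⊢
    simp only [mul_re, ofReal_re, ofReal_im, zero_mul, sub_zero, mul_im, add_zero]
    rcases hω with h | h
    · exact Or.inl (mul_pos hs h)
    · exact Or.inr (mul_ne_zero hs.ne' h)
  set c := 4 * |ω.im|
  set K := 2 * (‖μ‖ + ‖μ - 1‖)
  set E : ℝ → ℝ := fun s => ‖cylJ μ (s * ω)‖ ^ 2 + ‖cylJ (μ - 1) (s * ω)‖ ^ 2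
  have hA : ∀ s : ℝ, 0 < s → HasDerivAt (fun s : ℝ => cylJ μ (s * ω))
      (2 * ω * cylJ (μ - 1) (s * ω) - μ / s * cylJ μ (s * ω)) s := by
    intro s hs
    have hl : HasDerivAt (fun s : ℝ => (s : ℂ) * ω) ω s := by
      simpa using (hasDerivAt_id s).ofReal_comp.mul_const ω
    have h := (hasDerivAt_cylJ μ (hmem s hs)).comp s hl
    refine h.congr_deriv ?_
    have hs' : (s : ℂ) ≠ 0 := by exact_mod_cast hs.ne'
    rw [cylJ_sub_one μ (slitPlane_ne_zero (hmem s hs))]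
    field_simp
    ring
  have hB : ∀ s : ℝ, 0 < s → HasDerivAt (fun s : ℝ => cylJ (μ - 1) (s * ω))
      ((μ - 1) / s * cylJ (μ - 1) (s * ω) - 2 * ω * cylJ μ (s * ω)) s := by
    intro s hs
    have hl : HasDerivAt (fun s : ℝ => (s : ℂ) * ω) ω s := by
      simpa using (hasDerivAt_id s).ofReal_comp.mul_const ω
    have h := (hasDerivAt_cylJ (μ - 1) (hmem s hs)).comp s hl
    refine h.congr_deriv ?_
    have hs' : (s : ℂ) ≠ 0 := by exact_mod_cast hs.ne'
    rw [sub_add_cancel]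
    field_simp
  have hφ : ∀ s : ℝ, 0 < s → ∃ E', HasDerivAt E E' s ∧ E' ≤ (c + K / s) * E s := by
    intro s hs
    exact ⟨_, (hA s hs).norm_sq.add (hB s hs).norm_sq, inner_bessel_system_le _ _ ω μ s hs⟩
  -- Grönwall: E' ≤ (c + K/s)E says that E divided by e^(cs) s^K is nonincreasing.
  have hanti : AntitoneOn (fun s => E s * Real.exp (-(c * s + K * Real.log s))) (Set.Ici 1) := by
    have hder : ∀ s : ℝ, 0 < s → ∃ D ≤ 0,
        HasDerivAt (fun s => E s * Real.exp (-(c * s + K * Real.log s))) D s := by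
      intro s hs
      obtain ⟨E', hE', hle⟩ := hφ s hs
      have h1 : HasDerivAt (fun s => -(c * s + K * Real.log s)) (-(c * 1 + K * s⁻¹)) s :=
        (((hasDerivAt_id s).const_mul c).add ((Real.hasDerivAt_log hs.ne').const_mul K)).neg
      refine ⟨_, ?_, hE'.mul h1.exp⟩
      have hp := Real.exp_pos (-(c * s + K * Real.log s))
      have : (E' - (c + K / s) * E s) * Real.exp (-(c * s + K * Real.log s)) ≤ 0 :=
        mul_nonpos_of_nonpos_of_nonneg (by linarith) hp.le
      refine le_of_eq_of_le ?_ this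
      rw [div_eq_mul_inv]
      ring
    refine antitoneOn_of_deriv_nonpos (convex_Ici 1) (fun s hs => ?_) (fun s hs => ?_)
      (fun s hs => ?_)
    · obtain ⟨D, _, hD⟩ := hder s (lt_of_lt_of_le one_pos hs)
      exact hD.continuousAt.continuousWithinAt
    · rw [interior_Ici] at hs
      obtain ⟨D, _, hD⟩ := hder s (lt_trans one_pos hs)
      exact hD.differentiableAt.differentiableWithinAt
    · rw [interior_Ici] at hs
      obtain ⟨D, hD0, hD⟩ := hder s (lt_trans one_pos hs)
      rw [hD.deriv]
      exact hD0
  have h := hanti (Set.mem_Ici.2 le_rfl) (Set.mem_Ici.2 hr) hr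
  simp only [Real.log_one, mul_zero, add_zero, mul_one] at h
  have hE1 : E 1 = ‖cylJ μ ω‖ ^ 2 + ‖cylJ (μ - 1) ω‖ ^ 2 := by simp [E]
  change E r ≤ _
  rw [← hE1]
  calc E r = E r * Real.exp (-(c * r + K * Real.log r)) * Real.exp (c * r + K * Real.log r) := by
        rw [mul_assoc, ← Real.exp_add, neg_add_cancel, Real.exp_zero, mul_one]
    _ ≤ E 1 * Real.exp (-c) * Real.exp (c * r + K * Real.log r) := by gcongr
    _ = _ := by rw [mul_assoc, ← Real.exp_add]; congr 2; ring

/-- Every such x lies on a ray from the closed unit half-circle, a compact subset of the slit plane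
on which the initial energy is bounded. Along the ray r|Im ω| = |Im x|, so the energy is at most a
constant times r^(2N) e^(4|Im x|). -/
theorem norm_cylJ_le (μ : ℂ) : ∃ C : ℝ, 0 ≤ C ∧ ∃ N : ℕ, ∀ x : ℂ, 0 ≤ x.re → 1 ≤ ‖x‖ →
    ‖cylJ μ x‖ ≤ C * ‖x‖ ^ N * Real.exp (2 * |x.im|) := by
  set S : Set ℂ := Metric.sphere 0 1 ∩ {x | 0 ≤ x.re}
  have hS : IsCompact S := (isCompact_sphere 0 1).inter_right
    (isClosed_le continuous_const continuous_re)
  have hSs : S ⊆ slitPlane := fun x hx => mem_slitPlane_of_re_nonneg hx.2 (by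
    rintro rfl; simpa using hx.1)
  obtain ⟨C1, hC1⟩ := hS.exists_bound_of_continuousOn ((continuousOn_cylJ μ).mono hSs)
  obtain ⟨C2, hC2⟩ := hS.exists_bound_of_continuousOn ((continuousOn_cylJ (μ - 1)).mono hSs)
  obtain ⟨N, hN⟩ := exists_nat_ge (‖μ‖ + ‖μ - 1‖)
  refine ⟨|C1| + |C2|, by positivity, N, fun x hx hx1 => ?_⟩
  have hx0 : 0 < ‖x‖ := by linarith
  have hxc : (‖x‖ : ℂ) ≠ 0 := by exact_mod_cast hx0.ne'
  set ω : ℂ := x / ‖x‖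
  have hxω : (‖x‖ : ℂ) * ω = x := by simp only [ω]; field_simp
  have hωS : ω ∈ S := by
    refine ⟨?_, ?_⟩
    · simp [ω, hx0.ne']
    · simp only [ω, Set.mem_ofPred_eq, div_ofReal_re]; positivity
  have him : ‖x‖ * |ω.im| = |x.im| := by
    simp only [ω, div_ofReal_im, abs_div, abs_of_pos hx0]; field_simp
  have h := cylJ_energy_le μ (hSs hωS) hx1
  rw [hxω] at h
  have hE : Real.exp (4 * |ω.im| * (‖x‖ - 1) + 2 * (‖μ‖ + ‖μ - 1‖) * Real.log ‖x‖) ≤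
      (‖x‖ ^ N * Real.exp (2 * |x.im|)) ^ 2 := by
    rw [← Real.exp_log (pow_pos hx0 N), ← Real.exp_add, ← Real.exp_nat_mul, Real.log_pow]
    apply Real.exp_le_exp.2
    have hl := Real.log_nonneg hx1
    have h1 : (‖μ‖ + ‖μ - 1‖) * Real.log ‖x‖ ≤ N * Real.log ‖x‖ := by gcongr
    have h2 := abs_nonneg ω.im
    rw [← him]
    push_cast
    nlinarith
  have h1 := hC1 ω hωS
  have h2 := hC2 ω hωS
  have h3 : ‖cylJ μ ω‖ ^ 2 + ‖cylJ (μ - 1) ω‖ ^ 2 ≤ (|C1| + |C2|) ^ 2 := by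
    have h1' : ‖cylJ μ ω‖ ^ 2 ≤ |C1| ^ 2 := by gcongr; exact h1.trans (le_abs_self _)
    have h2' : ‖cylJ (μ - 1) ω‖ ^ 2 ≤ |C2| ^ 2 := by gcongr; exact h2.trans (le_abs_self _)
    nlinarith [mul_nonneg (abs_nonneg C1) (abs_nonneg C2)]
  refine le_of_sq_le_sq ?_ (by positivity)
  calc ‖cylJ μ x‖ ^ 2 ≤ ‖cylJ μ x‖ ^ 2 + ‖cylJ (μ - 1) x‖ ^ 2 := by
        linarith [sq_nonneg ‖cylJ (μ - 1) x‖]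
    _ ≤ (|C1| + |C2|) ^ 2 * (‖x‖ ^ N * Real.exp (2 * |x.im|)) ^ 2 := by
        refine h.trans ?_
        gcongr
    _ = _ := by ring

/-! ### Hankel functions -/

/-- A multiple of the Hankel function `H^{(1)}_μ(2x)`. -/
def cylH (μ x : ℂ) : ℂ := cylJ (-μ) x - cexp (-(I * Real.pi * μ)) * cylJ μ x

theorem norm_cylH_le_aux (μ : ℂ) : ∃ C : ℝ, 0 ≤ C ∧ ∃ N : ℕ, ∀ x : ℂ, 0 ≤ x.re → 1 ≤ ‖x‖ →
    ‖cylH μ x‖ ≤ C * ‖x‖ ^ N * Real.exp (2 * |x.im|) := by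
  obtain ⟨C1, hC1, N1, h1⟩ := norm_cylJ_le (-μ)
  obtain ⟨C2, hC2, N2, h2⟩ := norm_cylJ_le μ
  set e := ‖cexp (-(I * Real.pi * μ))‖
  refine ⟨C1 + e * C2, by positivity, N1 + N2, fun x hx hx1 => ?_⟩
  have p1 : ‖x‖ ^ N1 ≤ ‖x‖ ^ (N1 + N2) := pow_le_pow_right₀ hx1 (by omega)
  have p2 : ‖x‖ ^ N2 ≤ ‖x‖ ^ (N1 + N2) := pow_le_pow_right₀ hx1 (by omega)
  calc ‖cylH μ x‖ ≤ ‖cylJ (-μ) x‖ + e * ‖cylJ μ x‖ := by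
        refine (norm_sub_le _ _).trans ?_
        rw [norm_mul]
    _ ≤ C1 * ‖x‖ ^ (N1 + N2) * Real.exp (2 * |x.im|) +
        e * (C2 * ‖x‖ ^ (N1 + N2) * Real.exp (2 * |x.im|)) := by
        gcongr
        · exact (h1 x hx hx1).trans (by gcongr)
        · exact (h2 x hx hx1).trans (by gcongr)
    _ = _ := by ring

theorem ofReal_mul_I_cpow (μ : ℂ) {y : ℝ} (hy : 0 < y) :
    ((y : ℂ) * I) ^ μ = (y : ℂ) ^ μ * cexp (I * Real.pi / 2 * μ) := by
  have hy' : (y : ℂ) ≠ 0 := by exact_mod_cast hy.ne'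
  rw [Complex.cpow_def_of_ne_zero (mul_ne_zero hy' I_ne_zero), Complex.cpow_def_of_ne_zero hy',
    Complex.log_ofReal_mul hy I_ne_zero, Complex.log_I, ← Complex.exp_add,
    Complex.ofReal_log hy.le]
  congr 1
  ring

/-- At x = iy the series become the modified ones, and the constant e^(-iπμ) in `cylH` is exactly
the one for which the connection formula leaves a multiple of y^(-μ) times the Macdonald integral at
y². The powers of y then cancel. -/
theorem norm_cylH_mul_I_le (μ : ℂ) : ∃ C : ℝ, ∀ y : ℝ, 1 ≤ y →
    ‖cylH μ (y * I)‖ ≤ C * Real.exp (-2 * y) := by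
  obtain ⟨w, hw⟩ := besselEntireI_neg_sub μ
  obtain ⟨C, hC⟩ := norm_macdonald_sq_le μ
  refine ⟨‖cexp (-(I * Real.pi / 2 * μ))‖ * ‖w‖ * C, fun y hy => ?_⟩
  have hy0 : 0 < y := by linarith
  have hy' : (y : ℂ) ≠ 0 := by exact_mod_cast hy0.ne'
  have h1 := hw (y ^ 2) (by positivity)
  have e0 : ((y : ℂ) * I) ^ 2 = -((y ^ 2 : ℝ) : ℂ) := by rw [mul_pow, I_sq]; push_cast; ring
  have e1 : (((y ^ 2 : ℝ) : ℂ)) ^ μ = (y : ℂ) ^ μ * (y : ℂ) ^ μ := by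
    rw [sq, Complex.ofReal_mul, Complex.mul_cpow_ofReal_nonneg hy0.le hy0.le]
  have e2 : cexp (-(I * Real.pi * μ)) * cexp (I * Real.pi / 2 * μ) =
      cexp (-(I * Real.pi / 2 * μ)) := by
    rw [← Complex.exp_add]; congr 1; ring
  have e3 : (y : ℂ) ^ (-μ) * (y : ℂ) ^ μ = 1 := by
    rw [← Complex.cpow_add _ _ hy', neg_add_cancel, Complex.cpow_zero]
  have key : cylH μ (y * I) =
      cexp (-(I * Real.pi / 2 * μ)) * w * ((y : ℂ) ^ (-μ) * macdonald μ (y ^ 2)) := by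
    simp only [cylH, cylJ]
    rw [e0, ofReal_mul_I_cpow _ hy0, ofReal_mul_I_cpow _ hy0, mul_neg]
    rw [e1] at h1
    simp only [besselEntireI] at h1
    linear_combination cexp (-(I * Real.pi / 2 * μ)) * (y : ℂ) ^ (-μ) * h1 -
      (y : ℂ) ^ μ * besselEntire μ (-((y ^ 2 : ℝ) : ℂ)) * e2 +
      cexp (-(I * Real.pi / 2 * μ)) * (y : ℂ) ^ μ * besselEntire μ (-((y ^ 2 : ℝ) : ℂ)) * e3
  rw [key, norm_mul, norm_mul, norm_mul, Complex.norm_cpow_eq_rpow_re_of_pos hy0, neg_re]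
  calc _ ≤ ‖cexp (-(I * Real.pi / 2 * μ))‖ * ‖w‖ *
        (y ^ (-μ.re) * (C * y ^ μ.re * Real.exp (-2 * y))) := by
        gcongr
        exact hC y hy
    _ = _ := by
        have : y ^ (-μ.re) * y ^ μ.re = 1 := by
          rw [← Real.rpow_add hy0, neg_add_cancel, Real.rpow_zero]
        linear_combination ‖cexp (-(I * Real.pi / 2 * μ))‖ * ‖w‖ * C * Real.exp (-2 * y) * this

theorem norm_cexp_neg_two_I_mul (x : ℂ) : ‖cexp (-2 * I * x)‖ = Real.exp (2 * x.im) := by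
  rw [Complex.norm_exp]; congr 1; simp

/-- The Hankel function is bounded in the first quadrant after removing its exponential factor and
dividing by a power. -/
theorem norm_cylH_le_quadrant (μ : ℂ) : ∃ C : ℝ, 0 ≤ C ∧ ∃ N : ℕ, ∀ x : ℂ, 0 ≤ x.re → 0 ≤ x.im →
    1 ≤ ‖x‖ → ‖cylH μ x‖ ≤ C * ‖x‖ ^ N * Real.exp (-2 * x.im) := by
  obtain ⟨C1, hC1, N1, h1⟩ := norm_cylH_le_aux μ
  obtain ⟨C2, h2⟩ := norm_cylH_mul_I_le μ
  -- The factor x^K makes both powers x^(K±μ) continuous at 0, so f below is continuous on the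
  -- closed quadrant. Division by (x+1)^N, whose base has no zero there, compensates for x^K and for
  -- the polynomial factor of the crude bound, so that f is bounded on both axes.
  obtain ⟨K, hK⟩ := exists_nat_gt |μ.re|
  obtain ⟨hKl, hKr⟩ := abs_lt.1 hK
  set N := K + N1
  set f : ℂ → ℂ := fun x => (x ^ ((K : ℂ) + -μ) * besselEntire (-μ) (x ^ 2) -
    cexp (-(I * Real.pi * μ)) * (x ^ ((K : ℂ) + μ) * besselEntire μ (x ^ 2))) *
    cexp (-2 * I * x) / (x + 1) ^ N with hf
  have hfx : ∀ x, x ≠ 0 → f x = x ^ K * cylH μ x * cexp (-2 * I * x) / (x + 1) ^ N := by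
    intro x hx
    simp only [hf, cylH, cylJ]
    rw [Complex.cpow_add _ _ hx, Complex.cpow_add _ _ hx, Complex.cpow_natCast]
    ring
  have hne : ∀ x : ℂ, 0 ≤ x.re → x + 1 ≠ 0 := by
    intro x hx h
    have := congrArg re h
    simp at this
    linarith
  have hge : ∀ x : ℂ, 0 ≤ x.re → 1 ≤ ‖x + 1‖ ∧ ‖x‖ ≤ ‖x + 1‖ := by
    intro x hx
    constructor
    · refine le_trans ?_ ((le_abs_self _).trans (abs_re_le_norm (x + 1)))
      simp; exact hx
    · refine le_of_sq_le_sq ?_ (norm_nonneg _)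
      rw [← normSq_eq_norm_sq, ← normSq_eq_norm_sq, normSq_apply, normSq_apply]
      simp
      nlinarith
  have hpow : ∀ (c : ℂ), 0 < c.re → ∀ x : ℂ, 0 ≤ x.re → ContinuousAt (fun x => x ^ c) x := by
    intro c hc x hx
    by_cases h0 : x = 0
    · subst h0
      exact (continuousAt_cpow_zero_of_re_pos hc).comp
        (f := fun x : ℂ => (x, c)) (by fun_prop)
    · exact continuousAt_cpow_const (mem_slitPlane_of_re_nonneg hx h0)
  have hcont : ∀ x : ℂ, 0 ≤ x.re → ContinuousAt f x := by
    intro x hx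
    have c1 := hpow ((K : ℂ) + -μ) (by simp; linarith) x hx
    have c2 := hpow ((K : ℂ) + μ) (by simp; linarith) x hx
    have b1 : ContinuousAt (fun x : ℂ => besselEntire (-μ) (x ^ 2)) x :=
      ((continuous_besselEntire (-μ)).comp (continuous_pow 2)).continuousAt
    have b2 : ContinuousAt (fun x : ℂ => besselEntire μ (x ^ 2)) x :=
      ((continuous_besselEntire μ).comp (continuous_pow 2)).continuousAt
    refine ContinuousAt.div ((ContinuousAt.sub (c1.mul b1) (continuousAt_const.mul
      (c2.mul b2))).mul (by fun_prop)) (by fun_prop) (pow_ne_zero _ (hne x hx))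
  -- a bound away from the origin
  have hbig : ∀ x : ℂ, 0 ≤ x.re → 1 ≤ ‖x‖ →
      ‖f x‖ ≤ ‖x‖ ^ K * ‖cylH μ x‖ * Real.exp (2 * x.im) / ‖x‖ ^ N := by
    intro x hx hx1
    rw [hfx x (by rintro rfl; norm_num at hx1), norm_div, norm_mul, norm_mul, norm_pow, norm_pow,
      norm_cexp_neg_two_I_mul]
    gcongr
    exact (hge x hx).2
  have hcomp : IsCompact (Metric.closedBall (0 : ℂ) 1 ∩ {x | 0 ≤ x.re}) :=
    (isCompact_closedBall 0 1).inter_right (isClosed_le continuous_const continuous_re)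
  obtain ⟨C3, hC3⟩ := hcomp.exists_bound_of_continuousOn
    (f := f) (fun x hx => (hcont x hx.2).continuousWithinAt)
  set C := C1 + |C2| + |C3|
  have hsplit : ∀ x : ℂ, ‖x‖ ≤ 1 → 0 ≤ x.re → ‖f x‖ ≤ C := by
    intro x hx1 hx
    have := hC3 x ⟨by simpa using hx1, hx⟩
    have := le_abs_self C3
    have := abs_nonneg C2
    simp only [C]; linarith
  have hPL : ∀ z : ℂ, 0 ≤ z.re → 0 ≤ z.im → ‖f z‖ ≤ C := by
    intro z hz1 hz2
    -- Order 1 is below the critical order 2 of a quadrant. The crude bound times e^(2 Im x) grows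
    -- at most like e^(4‖x‖), so 5 is enough.
    refine PhragmenLindelof.quadrant_I (f := f) ?_ ⟨1, by norm_num, 5, ?_⟩ ?_ ?_ hz1 hz2
    · refine ⟨fun x hx => ?_, fun x hx => ?_⟩
      · obtain ⟨hx1, hx2⟩ := hx
        have hs : x ∈ slitPlane := Or.inl hx1
        have d1 := ((hasDerivAt_besselEntire_sq (-μ) x)).differentiableAt
        have d2 := ((hasDerivAt_besselEntire_sq μ x)).differentiableAt
        have p1 := (hasStrictDerivAt_cpow_const (c := (K : ℂ) + -μ) hs).hasDerivAt.differentiableAt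
        have p2 := (hasStrictDerivAt_cpow_const (c := (K : ℂ) + μ) hs).hasDerivAt.differentiableAt
        refine DifferentiableAt.differentiableWithinAt ?_
        refine DifferentiableAt.div (((p1.mul d1).sub ((p2.mul d2).const_mul _)).mul
          (by fun_prop)) (by fun_prop) (pow_ne_zero _ (hne x (le_of_lt hx1)))
      · rw [closure_reProdIm, closure_Ioi] at hx
        exact (hcont x hx.1).continuousWithinAt
    · refine Asymptotics.IsBigO.of_bound C1 ?_
      have hev : ∀ᶠ x : ℂ in Bornology.cobounded ℂ, 1 ≤ ‖x‖ :=
        tendsto_norm_cobounded_atTop.eventually_ge_atTop 1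
      filter_upwards [hev.filter_mono inf_le_left,
        Filter.mem_inf_of_right (Filter.mem_principal_self _)] with x hx1 hx
      have hre : 0 ≤ x.re := le_of_lt hx.1
      have him : 0 ≤ x.im := le_of_lt hx.2
      have hx0 : 0 < ‖x‖ := by linarith
      refine (hbig x hre hx1).trans ?_
      rw [Real.rpow_one, Real.norm_of_nonneg (Real.exp_pos _).le]
      calc _ ≤ ‖x‖ ^ K * (C1 * ‖x‖ ^ N1 * Real.exp (2 * |x.im|)) * Real.exp (2 * x.im) /
            ‖x‖ ^ N := by gcongr; exact h1 x hre hx1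
        _ = C1 * (Real.exp (2 * |x.im|) * Real.exp (2 * x.im)) := by
            simp only [N, pow_add]; field_simp
        _ ≤ _ := by
            rw [← Real.exp_add]
            gcongr
            have := abs_im_le_norm x
            have := le_abs_self x.im
            linarith
    · intro x hx
      rcases le_total x 1 with hx1 | hx1
      · exact hsplit x (by simpa [abs_of_nonneg hx] using hx1) (by simpa using hx)
      · have hn : ‖(x : ℂ)‖ = x := by simp [abs_of_nonneg hx]
        refine (hbig x (by simpa using hx) (by rw [hn]; exact hx1)).trans ?_
        have h := h1 x (by simpa using hx) (by rw [hn]; exact hx1)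
        rw [hn] at h ⊢
        simp only [ofReal_im, abs_zero, mul_zero, Real.exp_zero, mul_one] at h ⊢
        have hx0 : 0 < x := by linarith
        calc _ ≤ x ^ K * (C1 * x ^ N1) / x ^ N := by gcongr
          _ = C1 := by simp only [N, pow_add]; field_simp
          _ ≤ C := by simp only [C]; linarith [abs_nonneg C2, abs_nonneg C3]
    · intro y hy
      have hn : ‖(y : ℂ) * I‖ = y := by simp [abs_of_nonneg hy]
      rcases le_total y 1 with hy1 | hy1
      · exact hsplit _ (by rw [hn]; exact hy1) (by simp)
      · refine (hbig _ (by simp) (by rw [hn]; exact hy1)).trans ?_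
        have h := h2 y hy1
        rw [hn]
        have him : ((y : ℂ) * I).im = y := by simp
        rw [him]
        have hy0 : 0 < y := by linarith
        have hKN : y ^ K ≤ y ^ N := pow_le_pow_right₀ hy1 (by simp [N])
        have he : Real.exp (-2 * y) * Real.exp (2 * y) = 1 := by
          rw [← Real.exp_add]; simp
        calc _ ≤ y ^ N * (|C2| * Real.exp (-2 * y)) * Real.exp (2 * y) / y ^ N := by
              gcongr
              exact h.trans (by gcongr; exact le_abs_self _)
          _ = |C2| * (Real.exp (-2 * y) * Real.exp (2 * y)) := by field_simp
          _ ≤ C := by rw [he]; simp only [C]; linarith [abs_nonneg C3]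
  refine ⟨C * 2 ^ N, by positivity, N, fun x hx hx' hx1 => ?_⟩
  have hx0 : 0 < ‖x‖ := by linarith
  have h := hPL x hx hx'
  rw [hfx x (norm_pos_iff.1 hx0), norm_div, norm_mul, norm_mul, norm_pow, norm_pow,
    norm_cexp_neg_two_I_mul, div_le_iff₀ (by have := (hge x hx).1; positivity)] at h
  have h3 : ‖x + 1‖ ≤ 2 * ‖x‖ := by
    refine (norm_add_le _ _).trans ?_
    rw [norm_one]; linarith
  have h4 : ‖cylH μ x‖ * Real.exp (2 * x.im) ≤ C * (2 * ‖x‖) ^ N := by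
    calc ‖cylH μ x‖ * Real.exp (2 * x.im) ≤ ‖x‖ ^ K * (‖cylH μ x‖ * Real.exp (2 * x.im)) :=
          le_mul_of_one_le_left (by positivity) (one_le_pow₀ hx1)
      _ ≤ C * ‖x + 1‖ ^ N := by rw [← mul_assoc]; exact h
      _ ≤ _ := by gcongr
  have he : Real.exp (2 * x.im) * Real.exp (-2 * x.im) = 1 := by rw [← Real.exp_add]; simp
  calc ‖cylH μ x‖ = ‖cylH μ x‖ * Real.exp (2 * x.im) * Real.exp (-2 * x.im) := by
        rw [mul_assoc, he, mul_one]
    _ ≤ C * (2 * ‖x‖) ^ N * Real.exp (-2 * x.im) := by gcongr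
    _ = _ := by rw [mul_pow]; ring

/-- In the fourth quadrant |Im x| = -Im x, and the crude bound is already of the required form. -/
theorem norm_cylH_le (μ : ℂ) : ∃ C : ℝ, 0 ≤ C ∧ ∃ N : ℕ, ∀ x : ℂ, 0 ≤ x.re →
    1 ≤ ‖x‖ → ‖cylH μ x‖ ≤ C * ‖x‖ ^ N * Real.exp (-2 * x.im) := by
  obtain ⟨C1, hC1, N1, h1⟩ := norm_cylH_le_aux μ
  obtain ⟨C2, hC2, N2, h2⟩ := norm_cylH_le_quadrant μ
  refine ⟨C1 + C2, by positivity, N1 + N2, fun x hx hx1 => ?_⟩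
  have p1 : ‖x‖ ^ N1 ≤ ‖x‖ ^ (N1 + N2) := pow_le_pow_right₀ hx1 (by omega)
  have p2 : ‖x‖ ^ N2 ≤ ‖x‖ ^ (N1 + N2) := pow_le_pow_right₀ hx1 (by omega)
  rcases le_total 0 x.im with him | him
  · refine (h2 x hx him hx1).trans ?_
    gcongr
    linarith
  · refine (h1 x hx hx1).trans ?_
    rw [abs_of_nonpos him, mul_neg, ← neg_mul]
    gcongr
    linarith

/-! ### The functions `twist` -/

theorem twist_of_ne (ν : ℂ) (p : ℤ) {z : ℂ} (hz : z ≠ 0) :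
    twist ν p z = (‖z‖ : ℂ) ^ ν * (z / (‖z‖ : ℂ)) ^ p := if_neg hz

theorem ofReal_norm_ne_zero {z : ℂ} (hz : z ≠ 0) : (‖z‖ : ℂ) ≠ 0 := by simpa using hz

theorem twist_at_zero (ν : ℂ) (p : ℤ) : twist ν p 0 = 0 := if_pos rfl

theorem twist_mul (ν : ℂ) (p : ℤ) (z w : ℂ) : twist ν p (z * w) = twist ν p z * twist ν p w := by
  by_cases hz : z = 0
  · simp [hz, twist_at_zero]
  by_cases hw : w = 0
  · simp [hw, twist_at_zero]
  rw [twist_of_ne _ _ hz, twist_of_ne _ _ hw, twist_of_ne _ _ (mul_ne_zero hz hw), norm_mul,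
    Complex.ofReal_mul, Complex.mul_cpow_ofReal_nonneg (norm_nonneg _) (norm_nonneg _),
    mul_div_mul_comm, mul_zpow]
  ring

theorem twist_add (ν μ : ℂ) (p q : ℤ) {z : ℂ} (hz : z ≠ 0) :
    twist (ν + μ) (p + q) z = twist ν p z * twist μ q z := by
  have hn := ofReal_norm_ne_zero hz
  rw [twist_of_ne _ _ hz, twist_of_ne _ _ hz, twist_of_ne _ _ hz, Complex.cpow_add _ _ hn,
    zpow_add₀ (div_ne_zero hz hn)]
  ring

theorem twist_zero_zero {z : ℂ} (hz : z ≠ 0) : twist 0 0 z = 1 := by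
  rw [twist_of_ne _ _ hz]; simp

theorem twist_one_one (z : ℂ) : twist 1 1 z = z := by
  by_cases hz : z = 0
  · rw [hz, twist_at_zero]
  have hn := ofReal_norm_ne_zero hz
  rw [twist_of_ne _ _ hz, Complex.cpow_one, zpow_one]
  field_simp

theorem twist_one_neg_one (z : ℂ) : twist 1 (-1) z = starRingEnd ℂ z := by
  by_cases hz : z = 0
  · rw [hz, twist_at_zero, map_zero]
  have hn := ofReal_norm_ne_zero hz
  rw [twist_of_ne _ _ hz, Complex.cpow_one, zpow_neg_one, inv_div, ← mul_div_assoc, ← sq,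
    ← Complex.ofReal_pow, ← normSq_eq_norm_sq, ← Complex.mul_conj]
  field_simp

theorem norm_twist (ν : ℂ) (p : ℤ) {z : ℂ} (hz : z ≠ 0) : ‖twist ν p z‖ = ‖z‖ ^ ν.re := by
  rw [twist_of_ne _ _ hz, norm_mul, Complex.norm_cpow_eq_rpow_re_of_pos (norm_pos_iff.2 hz),
    norm_zpow, norm_div, norm_real, norm_norm, div_self (norm_ne_zero_iff.2 hz), one_zpow, mul_one]

theorem twist_neg_mul (ν : ℂ) (p : ℤ) {z : ℂ} (hz : z ≠ 0) :
    twist ν p z * twist (-ν) (-p) z = 1 := by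
  rw [← twist_add _ _ _ _ hz, add_neg_cancel, add_neg_cancel, twist_zero_zero hz]

theorem twist_conj (ν : ℂ) (p : ℤ) (z : ℂ) : twist ν p (starRingEnd ℂ z) = twist ν (-p) z := by
  by_cases hz : z = 0
  · simp [hz, twist_at_zero]
  have hn := ofReal_norm_ne_zero hz
  have hcz : starRingEnd ℂ z ≠ 0 := by simpa using hz
  rw [twist_of_ne _ _ hz, twist_of_ne _ _ hcz, norm_conj, zpow_neg, ← inv_zpow, inv_div]
  congr 2
  rw [div_eq_div_iff hn hz, mul_comm, Complex.mul_conj, normSq_eq_norm_sq]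
  push_cast; ring

theorem twist_eq_exp (ν : ℂ) (p : ℤ) {z : ℂ} (hz : z ≠ 0) :
    twist ν p z = cexp (ν * Real.log ‖z‖ + p * (z.arg * I)) := by
  have hn := ofReal_norm_ne_zero hz
  have h1 : z / ‖z‖ = cexp (z.arg * I) := by
    conv_lhs => rw [← norm_mul_exp_arg_mul_I z]
    rw [norm_mul, norm_real, norm_norm, norm_exp_ofReal_mul_I, mul_one]
    field_simp
  rw [twist_of_ne _ _ hz, h1, ← Complex.exp_int_mul, Complex.exp_add,
    Complex.cpow_def_of_ne_zero hn, ← Complex.ofReal_log (norm_nonneg _), mul_comm ν]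

/-- Off the cut log x̄ is the conjugate of log x, so the phases of the ν-th powers cancel and only
the integer multiple (m - n) of arg x remains: the product is single-valued. -/
theorem cpow_mul_conj_cpow (ν : ℂ) (m n : ℤ) {x : ℂ} (hx : x ∈ slitPlane) :
    x ^ (ν + m) * (starRingEnd ℂ x) ^ (ν + n) = twist (2 * ν + m + n) (m - n) x := by
  have hx0 := slitPlane_ne_zero hx
  have hcx : starRingEnd ℂ x ≠ 0 := by simpa using hx0
  rw [twist_eq_exp _ _ hx0, Complex.cpow_def_of_ne_zero hx0, Complex.cpow_def_of_ne_zero hcx,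
    Complex.log_conj _ (slitPlane_arg_ne_pi hx), ← Complex.exp_add]
  congr 1
  have h1 : Complex.log x = Real.log ‖x‖ + x.arg * I := rfl
  rw [h1]
  simp
  ring

/-! ### Polynomial bounds for products of Bessel functions -/

theorem conj_mem_slitPlane {x : ℂ} (hx : x ∈ slitPlane) : starRingEnd ℂ x ∈ slitPlane := by
  rw [mem_slitPlane_iff] at hx ⊢
  simpa using hx

theorem cylJ_conj (μ : ℂ) {x : ℂ} (hx : x ∈ slitPlane) :
    cylJ (starRingEnd ℂ μ) (starRingEnd ℂ x) = starRingEnd ℂ (cylJ μ x) := by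
  have hx0 := slitPlane_ne_zero hx
  have hcx : starRingEnd ℂ x ≠ 0 := by simpa using hx0
  simp only [cylJ, map_mul]
  rw [← map_pow, besselEntire_conj, Complex.cpow_def_of_ne_zero hx0,
    Complex.cpow_def_of_ne_zero hcx, Complex.log_conj _ (slitPlane_arg_ne_pi hx), ← map_mul,
    Complex.exp_conj]

/-- A multiple of the Hankel function `H^{(2)}_μ(2x)`. -/
def cylH' (μ x : ℂ) : ℂ := cylJ (-μ) x - cexp (I * Real.pi * μ) * cylJ μ x

/-- Conjugation exchanges the two Hankel functions, so that the second inherits its bound from the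
first. -/
theorem cylH'_eq (μ : ℂ) {x : ℂ} (hx : x ∈ slitPlane) :
    cylH' μ x = starRingEnd ℂ (cylH (starRingEnd ℂ μ) (starRingEnd ℂ x)) := by
  have h1 := cylJ_conj (starRingEnd ℂ μ) (conj_mem_slitPlane hx)
  have h2 := cylJ_conj (-starRingEnd ℂ μ) (conj_mem_slitPlane hx)
  simp only [conj_conj, map_neg] at h1 h2
  rw [cylH', cylH, map_sub, map_mul, ← h1, ← h2, ← Complex.exp_conj]
  simp

theorem norm_cylH'_le (μ : ℂ) : ∃ C : ℝ, 0 ≤ C ∧ ∃ N : ℕ, ∀ x : ℂ, 0 ≤ x.re →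
    1 ≤ ‖x‖ → ‖cylH' μ x‖ ≤ C * ‖x‖ ^ N * Real.exp (2 * x.im) := by
  obtain ⟨C, hC, N, h⟩ := norm_cylH_le (starRingEnd ℂ μ)
  refine ⟨C, hC, N, fun x hx hx1 => ?_⟩
  have hs := mem_slitPlane_of_re_nonneg hx (by rintro rfl; norm_num at hx1)
  have := h (starRingEnd ℂ x) (by simpa using hx) (by simpa using hx1)
  rw [cylH'_eq μ hs, norm_conj]
  simpa using this

/-- Products of functions bounded by `e^{∓2 Im x}` at `x` and at `x̄`. -/
theorem norm_mul_conj_le {F G : ℂ → ℂ} {s : ℝ}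
    (hF : ∃ C : ℝ, 0 ≤ C ∧ ∃ N : ℕ, ∀ x : ℂ, 0 ≤ x.re → 1 ≤ ‖x‖ →
      ‖F x‖ ≤ C * ‖x‖ ^ N * Real.exp (s * x.im))
    (hG : ∃ C : ℝ, 0 ≤ C ∧ ∃ N : ℕ, ∀ x : ℂ, 0 ≤ x.re → 1 ≤ ‖x‖ →
      ‖G x‖ ≤ C * ‖x‖ ^ N * Real.exp (s * x.im)) :
    ∃ C : ℝ, 0 ≤ C ∧ ∃ N : ℕ, ∀ x : ℂ, 0 ≤ x.re → 1 ≤ ‖x‖ →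
      ‖F x * G (starRingEnd ℂ x)‖ ≤ C * ‖x‖ ^ N := by
  obtain ⟨C1, h1, N1, hF⟩ := hF
  obtain ⟨C2, h2, N2, hG⟩ := hG
  refine ⟨C1 * C2, by positivity, N1 + N2, fun x hx hx1 => ?_⟩
  have a := hF x hx hx1
  have b := hG (starRingEnd ℂ x) (by simpa using hx) (by simpa using hx1)
  rw [norm_conj, conj_im] at b
  have he : Real.exp (s * x.im) * Real.exp (s * -x.im) = 1 := by
    rw [← Real.exp_add]; simp
  rw [norm_mul]
  calc _ ≤ (C1 * ‖x‖ ^ N1 * Real.exp (s * x.im)) * (C2 * ‖x‖ ^ N2 * Real.exp (s * -x.im)) := by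
        gcongr
    _ = C1 * C2 * ‖x‖ ^ (N1 + N2) * (Real.exp (s * x.im) * Real.exp (s * -x.im)) := by ring
    _ = _ := by rw [he, mul_one]

/-- This is sin(πμ) ≠ 0, needed to solve for the J-functions in terms of the two Hankel functions.
-/
theorem exp_I_pi_mul_ne (μ : ℂ) (hμ : ∀ n : ℤ, μ ≠ n) :
    cexp (I * Real.pi * μ) - cexp (-(I * Real.pi * μ)) ≠ 0 := by
  intro h
  rw [sub_eq_zero, Complex.exp_eq_exp_iff_exists_int] at h
  obtain ⟨n, hn⟩ := h
  apply hμ n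
  have hpi : (Real.pi : ℂ) ≠ 0 := by exact_mod_cast Real.pi_ne_zero
  have h2 : (2 * Real.pi * I) * (μ - n) = 0 := by linear_combination hn
  rcases mul_eq_zero.1 h2 with h3 | h3
  · exact absurd h3 (by simp)
  · exact sub_eq_zero.1 h3

/-- The difference of products in which the exponentially growing terms cancel. -/
theorem norm_cylJ_mul_sub_le (ν : ℂ) (hν : ∀ n : ℤ, ν ≠ n) (m n : ℤ) :
    ∃ C : ℝ, 0 ≤ C ∧ ∃ N : ℕ, ∀ x : ℂ, 0 ≤ x.re → 1 ≤ ‖x‖ →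
      ‖cylJ (-(ν + m)) x * cylJ (-(ν + n)) (starRingEnd ℂ x) -
        (-1) ^ (m + n) * (cylJ (ν + m) x * cylJ (ν + n) (starRingEnd ℂ x))‖ ≤ C * ‖x‖ ^ N := by
  obtain ⟨C1, hC1, N1, h1⟩ := norm_mul_conj_le (norm_cylH_le (ν + m)) (norm_cylH_le (ν + n))
  obtain ⟨C2, hC2, N2, h2⟩ := norm_mul_conj_le (norm_cylH'_le (ν + m)) (norm_cylH'_le (ν + n))
  have hnon : ∀ k : ℤ, ∀ l : ℤ, ν + k ≠ l := by
    intro k l h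
    exact hν (l - k) (by push_cast; linear_combination h)
  set e := cexp (I * Real.pi * (ν + m))
  set e' := cexp (I * Real.pi * (ν + n))
  set f := cexp (-(I * Real.pi * (ν + m)))
  set f' := cexp (-(I * Real.pi * (ν + n)))
  have hd : e - f ≠ 0 := exp_I_pi_mul_ne _ (hnon m)
  have hd' : e' - f' ≠ 0 := exp_I_pi_mul_ne _ (hnon n)
  have hexp : ∀ k : ℤ, cexp (I * Real.pi * k) = (-1) ^ k := by
    intro k
    rw [show I * Real.pi * k = k * (Real.pi * I) by ring, Complex.exp_int_mul, Complex.exp_pi_mul_I]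
  have hpar : ((-1 : ℂ)) ^ (m - n) = (-1) ^ (m + n) := by
    rw [show m - n = m + n - 2 * n by ring, zpow_sub₀ (by norm_num), zpow_mul]
    norm_num
  have hpar' : ((-1 : ℂ)) ^ (n - m) = (-1) ^ (m + n) := by
    rw [show n - m = n + m - 2 * m by ring, zpow_sub₀ (by norm_num), zpow_mul, add_comm]
    norm_num
  have h3 : e * f' = (-1) ^ (m + n) := by
    rw [← hpar, ← hexp]; simp only [e, f']; rw [← Complex.exp_add]; congr 1; push_cast; ring
  have h4 : e' * f = (-1) ^ (m + n) := by
    rw [← hpar', ← hexp]; simp only [e', f]; rw [← Complex.exp_add]; congr 1; push_cast; ring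
  set ε : ℂ := (-1) ^ (m + n)
  set D := (e - f) * (e' - f')
  have hD : D ≠ 0 := mul_ne_zero hd hd'
  refine ⟨‖e * e' - ε‖ / ‖D‖ * C1 + ‖f * f' - ε‖ / ‖D‖ * C2, by positivity, N1 + N2,
    fun x hx hx1 => ?_⟩
  -- Solving for J in terms of `cylH` and `cylH'`, the mixed products acquire the coefficients ε - e
  -- f' and ε - e' f, both zero for the sign ε = (-1)^(m+n). Only the products of like Hankel
  -- functions remain, whose exponentials cancel between x and x̄.
  have key : cylJ (-(ν + m)) x * cylJ (-(ν + n)) (starRingEnd ℂ x) -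
        ε * (cylJ (ν + m) x * cylJ (ν + n) (starRingEnd ℂ x)) =
      (e * e' - ε) / D * (cylH (ν + m) x * cylH (ν + n) (starRingEnd ℂ x)) +
      (f * f' - ε) / D * (cylH' (ν + m) x * cylH' (ν + n) (starRingEnd ℂ x)) := by
    rw [div_mul_eq_mul_div, div_mul_eq_mul_div, ← add_div, eq_div_iff hD]
    simp only [cylH, cylH', D]
    change _ * ((e - f) * (e' - f')) = (e * e' - ε) * ((_ - f * _) * (_ - f' * _)) +
      (f * f' - ε) * ((_ - e * _) * (_ - e' * _))
    generalize cylJ (-(ν + m)) x = s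
    generalize cylJ (-(ν + n)) (starRingEnd ℂ x) = s'
    generalize cylJ (ν + m) x = t
    generalize cylJ (ν + n) (starRingEnd ℂ x) = t'
    linear_combination (-s * s' + s * t' * e' + t * s' * f - t * t' * e' * f) * h3 +
      (-s * s' + s * t' * f' + t * s' * e - t * t' * e * f') * h4
  have p1 : ‖x‖ ^ N1 ≤ ‖x‖ ^ (N1 + N2) := pow_le_pow_right₀ hx1 (by omega)
  have p2 : ‖x‖ ^ N2 ≤ ‖x‖ ^ (N1 + N2) := pow_le_pow_right₀ hx1 (by omega)
  rw [key]
  refine (norm_add_le _ _).trans ?_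
  rw [norm_mul, norm_mul _ (cylH' _ _ * _), norm_div, norm_div]
  calc _ ≤ ‖e * e' - ε‖ / ‖D‖ * (C1 * ‖x‖ ^ (N1 + N2)) +
        ‖f * f' - ε‖ / ‖D‖ * (C2 * ‖x‖ ^ (N1 + N2)) := by
        gcongr
        · exact (h1 x hx hx1).trans (by gcongr)
        · exact (h2 x hx hx1).trans (by gcongr)
    _ = _ := by ring

/-- The products of Bessel functions that arise from the Bessel kernel by differentiation. -/
def besselProd (ν : ℂ) (m n : ℤ) (w : ℂ) : ℂ :=
  besselEntire (-(ν + m)) w * besselEntire (-(ν + n)) (starRingEnd ℂ w) -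
    (-1) ^ (m + n) * (twist (2 * ν + m + n) (m - n) w *
      (besselEntire (ν + m) w * besselEntire (ν + n) (starRingEnd ℂ w)))

theorem besselEntire_sq_eq (μ : ℂ) {x : ℂ} (hx : x ≠ 0) :
    besselEntire μ (x ^ 2) = x ^ (-μ) * cylJ μ x := by
  rw [cylJ, ← mul_assoc, ← Complex.cpow_add _ _ hx, neg_add_cancel, Complex.cpow_zero, one_mul]

theorem besselProd_sq (ν : ℂ) (m n : ℤ) {x : ℂ} (hx : x ∈ slitPlane) :
    besselProd ν m n (x ^ 2) = twist (2 * ν + m + n) (m - n) x *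
      (cylJ (-(ν + m)) x * cylJ (-(ν + n)) (starRingEnd ℂ x) -
        (-1) ^ (m + n) * (cylJ (ν + m) x * cylJ (ν + n) (starRingEnd ℂ x))) := by
  have hx0 := slitPlane_ne_zero hx
  have hcx : starRingEnd ℂ x ≠ 0 := by simpa using hx0
  have h := cpow_mul_conj_cpow ν m n hx
  have e1 : x ^ (-(ν + m)) * x ^ (ν + m) = 1 := by
    rw [← Complex.cpow_add _ _ hx0, neg_add_cancel, Complex.cpow_zero]
  have e2 : (starRingEnd ℂ x) ^ (-(ν + n)) * (starRingEnd ℂ x) ^ (ν + n) = 1 := by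
    rw [← Complex.cpow_add _ _ hcx, neg_add_cancel, Complex.cpow_zero]
  rw [besselProd, map_pow, besselEntire_sq_eq _ hx0, besselEntire_sq_eq _ hcx,
    besselEntire_sq_eq _ hx0, besselEntire_sq_eq _ hcx, neg_neg, neg_neg, sq, twist_mul, ← h]
  generalize x ^ (-(ν + m)) = a at *
  generalize x ^ (ν + m) = b at *
  generalize (starRingEnd ℂ x) ^ (-(ν + n)) = c at *
  generalize (starRingEnd ℂ x) ^ (ν + n) = d at *
  linear_combination (-(-1) ^ (m + n) * b * d * cylJ (ν + m) x * cylJ (ν + n) (starRingEnd ℂ x)) *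
    (c * d * e1 + e2)

/-- Write w = x² with the principal root, which has Re x ≥ 0, and apply the half-plane bound at x;
the power in front is itself polynomially bounded for ‖x‖ ≥ 1. -/
theorem norm_besselProd_le (ν : ℂ) (hν : ∀ n : ℤ, ν ≠ n) (m n : ℤ) :
    ∃ C : ℝ, 0 ≤ C ∧ ∃ N : ℕ, ∀ w : ℂ, 1 ≤ ‖w‖ → ‖besselProd ν m n w‖ ≤ C * ‖w‖ ^ N := by
  obtain ⟨C, hC, N, h⟩ := norm_cylJ_mul_sub_le ν hν m n
  obtain ⟨K, hK⟩ := exists_nat_ge (2 * ν + m + n).re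
  refine ⟨C, hC, K + N, fun w hw => ?_⟩
  have hw0 : w ≠ 0 := by rintro rfl; norm_num at hw
  set x : ℂ := w ^ (1 / 2 : ℂ)
  have hxw : x ^ 2 = w := by
    simp only [x]
    rw [← Complex.cpow_nat_mul]
    norm_num
  have hx0 : x ≠ 0 := by intro h; rw [h] at hxw; exact hw0 (by rw [← hxw]; ring)
  have hxre : 0 ≤ x.re := by
    have : x = Real.exp (Real.log ‖w‖ / 2) * cexp ((w.arg / 2 : ℝ) * I) := by
      simp only [x]
      rw [Complex.cpow_def_of_ne_zero hw0, Complex.ofReal_exp, ← Complex.exp_add]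
      congr 1
      have h1 : Complex.log w = Real.log ‖w‖ + w.arg * I := rfl
      rw [h1]; push_cast; ring
    rw [this, re_ofReal_mul, exp_ofReal_mul_I_re]
    refine mul_nonneg (Real.exp_pos _).le (Real.cos_nonneg_of_mem_Icc ⟨?_, ?_⟩)
    · linarith [neg_pi_lt_arg w]
    · linarith [arg_le_pi w]
  have hnx : ‖x‖ ^ 2 = ‖w‖ := by rw [← norm_pow, hxw]
  have hx1 : 1 ≤ ‖x‖ := by
    by_contra hc
    push Not at hc
    have := norm_nonneg x
    nlinarith
  have hxw' : ‖x‖ ≤ ‖w‖ := by nlinarith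
  have hs := mem_slitPlane_of_re_nonneg hxre hx0
  rw [← hxw, besselProd_sq ν m n hs, norm_mul, norm_twist _ _ hx0, hxw]
  have h1 : ‖x‖ ^ (2 * ν + m + n).re ≤ ‖w‖ ^ K := by
    calc _ ≤ ‖x‖ ^ (K : ℝ) := Real.rpow_le_rpow_of_exponent_le hx1 hK
      _ = ‖x‖ ^ K := Real.rpow_natCast _ _
      _ ≤ _ := by gcongr
  calc _ ≤ ‖w‖ ^ K * (C * ‖x‖ ^ N) := by gcongr; exact h x hxre hx1
    _ ≤ ‖w‖ ^ K * (C * ‖w‖ ^ N) := by gcongr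
    _ = _ := by ring

/-! ### Wirtinger derivatives -/

/-- The Wirtinger derivative `∂/∂z`. -/
def dz (f : ℂ → ℂ) (z : ℂ) : ℂ := (fderiv ℝ f z 1 - I * fderiv ℝ f z I) / 2

/-- The Wirtinger derivative `∂/∂z̄`. -/
def dzbar (f : ℂ → ℂ) (z : ℂ) : ℂ := (fderiv ℝ f z 1 + I * fderiv ℝ f z I) / 2

theorem nablaFun_eq (f : ℂ → ℂ) (z : ℂ) : nablaFun f z = z * dz f z := rfl

theorem nablaBarFun_eq (f : ℂ → ℂ) (z : ℂ) : nablaBarFun f z = starRingEnd ℂ z * dzbar f z := rfl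

/-- The map `a ↦ (v ↦ a v)`. -/
def wirtLeft : ℂ →L[ℝ] ℂ →L[ℝ] ℂ := ContinuousLinearMap.mul ℝ ℂ

/-- The map `b ↦ (v ↦ b v̄)`. -/
def wirtRight : ℂ →L[ℝ] ℂ →L[ℝ] ℂ :=
  (ContinuousLinearMap.compL ℝ ℂ ℂ ℂ).flip conjCLE.toContinuousLinearMap ∘L
    ContinuousLinearMap.mul ℝ ℂ

theorem norm_wirtLeft_le : ‖wirtLeft‖ ≤ 1 := ContinuousLinearMap.opNorm_mul_le ℝ ℂ

theorem wirtRight_apply (b v : ℂ) : wirtRight b v = b * starRingEnd ℂ v := rfl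

theorem norm_wirtRight_le : ‖wirtRight‖ ≤ 1 := by
  refine ContinuousLinearMap.opNorm_le_bound _ zero_le_one fun b => ?_
  refine ContinuousLinearMap.opNorm_le_bound _ (by positivity) fun v => ?_
  rw [wirtRight_apply, norm_mul, norm_conj, one_mul]

/-- The real-linear map `v ↦ a v + b v̄`. -/
def wirt (a b : ℂ) : ℂ →L[ℝ] ℂ := wirtLeft a + wirtRight b

theorem wirt_apply (a b v : ℂ) : wirt a b v = a * v + b * starRingEnd ℂ v := rfl

/-- `f` is real-differentiable at `z`, with Wirtinger derivatives `a` and `b`. -/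
def HasWirt (f : ℂ → ℂ) (a b z : ℂ) : Prop := HasFDerivAt f (wirt a b) z

theorem HasWirt.congr_deriv {f : ℂ → ℂ} {a b a' b' z : ℂ} (h : HasWirt f a b z) (ha : a = a')
    (hb : b = b') : HasWirt f a' b' z := ha ▸ hb ▸ h

theorem HasWirt.add {f g : ℂ → ℂ} {a b a' b' z : ℂ} (hf : HasWirt f a b z)
    (hg : HasWirt g a' b' z) : HasWirt (fun z => f z + g z) (a + a') (b + b') z := by
  refine (HasFDerivAt.add hf hg).congr_fderiv ?_
  ext v
  simp only [add_apply, wirt_apply]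
  ring

theorem HasWirt.mul {f g : ℂ → ℂ} {a b a' b' z : ℂ} (hf : HasWirt f a b z)
    (hg : HasWirt g a' b' z) :
    HasWirt (fun z => f z * g z) (a * g z + f z * a') (b * g z + f z * b') z := by
  refine (HasFDerivAt.mul hf hg).congr_fderiv ?_
  ext v
  simp only [add_apply, wirt_apply, smul_apply, smul_eq_mul]
  ring

theorem hasWirt_const (c z : ℂ) : HasWirt (fun _ => c) 0 0 z := by
  refine (hasFDerivAt_const c z).congr_fderiv ?_
  ext v
  simp [wirt_apply]

theorem HasWirt.const_mul {f : ℂ → ℂ} {a b z : ℂ} (hf : HasWirt f a b z) (c : ℂ) :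
    HasWirt (fun z => c * f z) (c * a) (c * b) z :=
  ((hasWirt_const c z).mul hf).congr_deriv (by ring) (by ring)

theorem hasWirt_id (z : ℂ) : HasWirt (fun z => z) 1 0 z := by
  refine (hasFDerivAt_id (𝕜 := ℝ) z).congr_fderiv ?_
  ext v
  simp [wirt_apply]

theorem HasDerivAt.hasWirt {f : ℂ → ℂ} {a z : ℂ} (hf : HasDerivAt f a z) : HasWirt f a 0 z := by
  refine (hf.hasFDerivAt.restrictScalars ℝ).congr_fderiv ?_
  ext v
  simp [wirt_apply, mul_comm]

theorem HasWirt.comp_conj {f : ℂ → ℂ} {a b z : ℂ} (hf : HasWirt f a b (starRingEnd ℂ z)) :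
    HasWirt (fun z => f (starRingEnd ℂ z)) b a z := by
  refine (HasFDerivAt.comp z hf conjCLE.hasFDerivAt).congr_fderiv ?_
  ext v
  simp [wirt_apply]
  ring

theorem HasWirt.comp_mul_left {f : ℂ → ℂ} {a b u z : ℂ} (hf : HasWirt f a b (u * z)) :
    HasWirt (fun z => f (u * z)) (u * a) (starRingEnd ℂ u * b) z := by
  refine (HasFDerivAt.comp z hf ((hasWirt_id z).const_mul u)).congr_fderiv ?_
  ext v
  simp [wirt_apply]
  ring

theorem _root_.DifferentiableAt.hasWirt {f : ℂ → ℂ} {z : ℂ} (hf : DifferentiableAt ℝ f z) :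
    HasWirt f (dz f z) (dzbar f z) z := by
  refine hf.hasFDerivAt.congr_fderiv ?_
  ext v
  have hv : fderiv ℝ f z v = v.re * fderiv ℝ f z 1 + v.im * fderiv ℝ f z I := by
    have : v = v.re • (1 : ℂ) + v.im • I := by simp
    conv_lhs => rw [this, map_add, map_smul, map_smul]
    simp
  rw [hv, wirt_apply, dz, dzbar]
  conv_rhs => rw [← re_add_im v]
  simp only [map_add, map_mul, conj_ofReal, conj_I]
  linear_combination ((v.im : ℂ) * fderiv ℝ f z I) * I_sq

theorem HasWirt.differentiableAt {f : ℂ → ℂ} {a b z : ℂ} (hf : HasWirt f a b z) :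
    DifferentiableAt ℝ f z := HasFDerivAt.differentiableAt hf

theorem HasWirt.dz {f : ℂ → ℂ} {a b z : ℂ} (hf : HasWirt f a b z) : dz f z = a := by
  rw [Hankel.dz, HasFDerivAt.fderiv hf, wirt_apply, wirt_apply]
  simp only [map_one, conj_I]
  linear_combination ((b - a) / 2) * I_sq

theorem HasWirt.dzbar {f : ℂ → ℂ} {a b z : ℂ} (hf : HasWirt f a b z) : dzbar f z = b := by
  rw [Hankel.dzbar, HasFDerivAt.fderiv hf, wirt_apply, wirt_apply]
  simp only [map_one, conj_I]
  linear_combination ((a - b) / 2) * I_sq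

theorem HasWirt.congr_of_eventuallyEq {f g : ℂ → ℂ} {a b z : ℂ} (hf : HasWirt f a b z)
    (h : g =ᶠ[nhds z] f) : HasWirt g a b z := HasFDerivAt.congr_of_eventuallyEq hf h

theorem hasWirt_twist (ν : ℂ) (p : ℤ) {z : ℂ} (hz : z ≠ 0) :
    HasWirt (twist ν p) ((ν + p) / 2 * twist (ν - 1) (p - 1) z)
      ((ν - p) / 2 * twist (ν - 1) (p + 1) z) z := by
  obtain ⟨hd, hv⟩ := twist_fderiv ν p hz
  refine hd.hasFDerivAt.congr_fderiv ?_
  have hcz : starRingEnd ℂ z ≠ 0 := by simpa using hz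
  have e1 : twist ν p z = twist (ν - 1) (p - 1) z * z := by
    have := twist_add (ν - 1) 1 (p - 1) 1 hz
    rwa [sub_add_cancel, sub_add_cancel, twist_one_one] at this
  have e2 : twist ν p z = twist (ν - 1) (p + 1) z * starRingEnd ℂ z := by
    have := twist_add (ν - 1) 1 (p + 1) (-1) hz
    rwa [sub_add_cancel, add_neg_cancel_right, twist_one_neg_one] at this
  ext v
  rw [hv, wirt_apply]
  have e1' : twist (ν - 1) (p - 1) z = twist ν p z / z := by rw [e1]; field_simp
  have e2' : twist (ν - 1) (p + 1) z = twist ν p z / starRingEnd ℂ z := by rw [e2]; field_simp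
  rw [e1', e2']
  ring

/-! ### Smoothness and bounds by induction on Wirtinger derivatives -/

/-- The real derivative is the image of the two Wirtinger derivatives under linear maps of norm at
most 1, so regularity and bounds of order n for these give order n + 1 for f. -/
theorem contDiff_succ_of_hasWirt {f f₁ f₂ : ℂ → ℂ} {n : ℕ}
    (h : ∀ z, HasWirt f (f₁ z) (f₂ z) z) (h₁ : ContDiff ℝ n f₁) (h₂ : ContDiff ℝ n f₂) :
    ContDiff ℝ (n + 1 : ℕ) f ∧ ∀ z, ‖iteratedFDeriv ℝ (n + 1) f z‖ ≤
      ‖iteratedFDeriv ℝ n f₁ z‖ + ‖iteratedFDeriv ℝ n f₂ z‖ := by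
  have hfd : fderiv ℝ f = fun z => wirtLeft (f₁ z) + wirtRight (f₂ z) :=
    funext fun z => HasFDerivAt.fderiv (h z)
  have c₁ : ContDiff ℝ n fun z => wirtLeft (f₁ z) := wirtLeft.contDiff.comp h₁
  have c₂ : ContDiff ℝ n fun z => wirtRight (f₂ z) := wirtRight.contDiff.comp h₂
  refine ⟨?_, fun z => ?_⟩
  · rw [show ((n + 1 : ℕ) : WithTop ℕ∞) = (n : WithTop ℕ∞) + 1 by push_cast; rfl,
      contDiff_succ_iff_fderiv]
    refine ⟨fun z => (h z).differentiableAt, by simp, ?_⟩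
    rw [hfd]
    exact c₁.add c₂
  · rw [← norm_iteratedFDeriv_fderiv, hfd,
      show (fun z => wirtLeft (f₁ z) + wirtRight (f₂ z)) =
        (fun z => wirtLeft (f₁ z)) + (fun z => wirtRight (f₂ z)) from rfl,
      iteratedFDeriv_add_apply c₁.contDiffAt c₂.contDiffAt]
    refine (norm_add_le _ _).trans (add_le_add ?_ ?_)
    · refine (wirtLeft.norm_iteratedFDeriv_comp_left h₁.contDiffAt le_rfl).trans ?_
      exact mul_le_of_le_one_left (norm_nonneg _) norm_wirtLeft_le
    · refine (wirtRight.norm_iteratedFDeriv_comp_left h₂.contDiffAt le_rfl).trans ?_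
      exact mul_le_of_le_one_left (norm_nonneg _) norm_wirtRight_le

/-- If a family of functions is closed under Wirtinger derivatives, on a set outside of which a
family of multipliers vanishes, then pointwise bounds for the products extend to all derivatives. -/
theorem iteratedFDeriv_bound_of_family {J Q : Type*} {Θ : Set (ℂ → ℂ)} {U : Set ℂ}
    (hΘ : ∀ θ ∈ Θ, Differentiable ℝ θ ∧ dz θ ∈ Θ ∧ dzbar θ ∈ Θ)
    (hU : ∀ θ ∈ Θ, ∀ z ∉ U, θ =ᶠ[nhds z] fun _ => 0)
    {F : J → Q → ℂ → ℂ} {d d' : J → J} {D D' : J → Q → Q}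
    (hF : ∀ j q, ∀ z ∈ U, HasWirt (F j q) (F (d j) (D j q) z) (F (d' j) (D' j q) z) z)
    {P : (Q → ℂ → ℝ) → Prop}
    (hadd : ∀ f g, P f → P g → P fun q z => f q z + g q z)
    (hmono : ∀ f g, (∀ q z, f q z ≤ g q z) → P g → P f)
    (hD : ∀ j f, P f → P fun q => f (D j q)) (hD' : ∀ j f, P f → P fun q => f (D' j q))
    (h0 : ∀ θ ∈ Θ, ∀ j, P fun q z => ‖θ z * F j q z‖) (n : ℕ) :
    ∀ θ ∈ Θ, ∀ j, (∀ q, ContDiff ℝ n fun z => θ z * F j q z) ∧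
      P fun q z => ‖iteratedFDeriv ℝ n (fun z => θ z * F j q z) z‖ := by
  -- The product rule also holds off U: there θ vanishes near z, so both sides are zero whatever F
  -- does.
  have hW : ∀ θ ∈ Θ, ∀ j q z, HasWirt (fun z => θ z * F j q z)
      (dz θ z * F j q z + θ z * F (d j) (D j q) z)
      (dzbar θ z * F j q z + θ z * F (d' j) (D' j q) z) z := by
    intro θ hθ j q z
    have hθz := ((hΘ θ hθ).1 z).hasWirt
    by_cases hz : z ∈ U
    · exact hθz.mul (hF j q z hz)
    · have h1 := hU θ hθ z hz
      have h2 : HasWirt θ 0 0 z := (hasWirt_const 0 z).congr_of_eventuallyEq h1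
      have h3 : HasWirt (fun z => θ z * F j q z) 0 0 z := by
        refine (hasWirt_const 0 z).congr_of_eventuallyEq ?_
        filter_upwards [h1] with w hw
        rw [hw, zero_mul]
      refine h3.congr_deriv ?_ ?_
      · rw [h2.dz, h1.self_of_nhds]; simp
      · rw [h2.dzbar, h1.self_of_nhds]; simp
  induction n with
  | zero =>
    intro θ hθ j
    refine ⟨fun q => ?_, ?_⟩
    · exact contDiff_zero.2 (continuous_iff_continuousAt.2 fun z =>
        (hW θ hθ j q z).differentiableAt.continuousAt)
    · simpa using h0 θ hθ j
  | succ n ih =>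
    intro θ hθ j
    obtain ⟨_, hθ1, hθ2⟩ := hΘ θ hθ
    have a1 := ih _ hθ1 j
    have a2 := ih _ hθ (d j)
    have b1 := ih _ hθ2 j
    have b2 := ih _ hθ (d' j)
    have key := fun q => contDiff_succ_of_hasWirt (hW θ hθ j q)
      ((a1.1 q).add (a2.1 (D j q))) ((b1.1 q).add (b2.1 (D' j q)))
    refine ⟨fun q => (key q).1, ?_⟩
    refine hmono _ _ (fun q z => ?_) (hadd _ _ (hadd _ _ a1.2 (hD j _ a2.2))
      (hadd _ _ b1.2 (hD' j _ b2.2)))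
    refine ((key q).2 z).trans (add_le_add ?_ ?_)
    · refine le_trans (le_of_eq ?_) (norm_add_le _ _)
      rw [← iteratedFDeriv_add_apply (a1.1 q).contDiffAt (a2.1 (D j q)).contDiffAt]
      rfl
    · refine le_trans (le_of_eq ?_) (norm_add_le _ _)
      rw [← iteratedFDeriv_add_apply (b1.1 q).contDiffAt (b2.1 (D' j q)).contDiffAt]
      rfl

/-! ### Temperate functions and Schwartz functions -/

theorem _root_.Function.HasTemperateGrowth.differentiable {f : ℂ → ℂ}
    (hf : f.HasTemperateGrowth) : Differentiable ℝ f := hf.1.differentiable (by simp)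

theorem _root_.Function.HasTemperateGrowth.fderiv_apply {f : ℂ → ℂ} (hf : f.HasTemperateGrowth)
    (v : ℂ) : Function.HasTemperateGrowth fun z => fderiv ℝ f z v := by
  have hsm : ContDiff ℝ ((⊤ : ℕ∞) : WithTop ℕ∞) (fderiv ℝ f) := hf.1.fderiv_right (by simp)
  have h : (fderiv ℝ f).HasTemperateGrowth := by
    refine ⟨hsm, fun n => ?_⟩
    obtain ⟨k, C, h⟩ := hf.2 (n + 1)
    exact ⟨k, C, fun z => by rw [norm_iteratedFDeriv_fderiv]; exact h z⟩
  have h2 : Function.HasTemperateGrowth (ContinuousLinearMap.apply ℝ ℂ v) :=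
    ContinuousLinearMap.hasTemperateGrowth _
  exact h2.comp h

theorem _root_.Function.HasTemperateGrowth.dz {f : ℂ → ℂ} (hf : f.HasTemperateGrowth) :
    (dz f).HasTemperateGrowth := by
  have : Hankel.dz f = fun z => (1 / 2 : ℂ) * (fderiv ℝ f z 1 - I * fderiv ℝ f z I) := by
    ext z; rw [Hankel.dz]; ring
  rw [this]
  exact (Function.HasTemperateGrowth.const _).mul ((hf.fderiv_apply 1).sub
    ((Function.HasTemperateGrowth.const I).mul (hf.fderiv_apply I)))

theorem _root_.Function.HasTemperateGrowth.dzbar {f : ℂ → ℂ} (hf : f.HasTemperateGrowth) :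
    (dzbar f).HasTemperateGrowth := by
  have : Hankel.dzbar f = fun z => (1 / 2 : ℂ) * (fderiv ℝ f z 1 + I * fderiv ℝ f z I) := by
    ext z; rw [Hankel.dzbar]; ring
  rw [this]
  exact (Function.HasTemperateGrowth.const _).mul ((hf.fderiv_apply 1).add
    ((Function.HasTemperateGrowth.const I).mul (hf.fderiv_apply I)))

theorem _root_.Function.HasTemperateGrowth.bound {f : ℂ → ℂ} (hf : f.HasTemperateGrowth) :
    ∃ (k : ℕ) (C : ℝ), 0 ≤ C ∧ ∀ z, ‖f z‖ ≤ C * (1 + ‖z‖) ^ k := by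
  obtain ⟨k, C, hC, h⟩ := hf.norm_iteratedFDeriv_le_uniform 0
  exact ⟨k, C, hC, fun z => by simpa using h 0 le_rfl z⟩

theorem _root_.Function.HasTemperateGrowth.comp_mul_left {f : ℂ → ℂ} (hf : f.HasTemperateGrowth)
    (u : ℂ) : Function.HasTemperateGrowth fun z => f (u * z) :=
  hf.comp ((Function.HasTemperateGrowth.const u).mul temperate_id)

theorem _root_.Function.HasTemperateGrowth.comp_conj {f : ℂ → ℂ} (hf : f.HasTemperateGrowth) :
    Function.HasTemperateGrowth fun z => f (starRingEnd ℂ z) := hf.comp temperate_conj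

/-- The Wirtinger derivative `∂/∂z` on Schwartz functions. -/
def schwartzDz : 𝓢(ℂ, ℂ) →L[ℂ] 𝓢(ℂ, ℂ) :=
  (1 / 2 : ℂ) • (LineDeriv.lineDerivOpCLM ℂ 𝓢(ℂ, ℂ) (1 : ℂ) -
      I • LineDeriv.lineDerivOpCLM ℂ 𝓢(ℂ, ℂ) I)

/-- The Wirtinger derivative `∂/∂z̄` on Schwartz functions. -/
def schwartzDzbar : 𝓢(ℂ, ℂ) →L[ℂ] 𝓢(ℂ, ℂ) :=
  (1 / 2 : ℂ) • (LineDeriv.lineDerivOpCLM ℂ 𝓢(ℂ, ℂ) (1 : ℂ) +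
      I • LineDeriv.lineDerivOpCLM ℂ 𝓢(ℂ, ℂ) I)

theorem schwartzDz_apply (f : 𝓢(ℂ, ℂ)) (z : ℂ) : schwartzDz f z = dz f z := by
  simp [schwartzDz, dz, SchwartzMap.lineDerivOp_apply_eq_fderiv]
  ring

theorem schwartzDzbar_apply (f : 𝓢(ℂ, ℂ)) (z : ℂ) : schwartzDzbar f z = dzbar f z := by
  simp [schwartzDzbar, dzbar, SchwartzMap.lineDerivOp_apply_eq_fderiv]
  ring

theorem schwartzHasWirt (f : 𝓢(ℂ, ℂ)) (z : ℂ) :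
    HasWirt f (schwartzDz f z) (schwartzDzbar f z) z := by
  rw [schwartzDz_apply, schwartzDzbar_apply]
  exact f.differentiableAt.hasWirt

/-- A family of functions, indexed by Schwartz functions, decays rapidly, with bounds by seminorms
of the index. -/
def SchwartzBound (g : 𝓢(ℂ, ℂ) → ℂ → ℝ) : Prop :=
  ∀ k : ℕ, ∃ (s : Finset (ℕ × ℕ)) (C : ℝ), 0 ≤ C ∧ ∀ q z,
    ‖z‖ ^ k * g q z ≤ C * s.sup (schwartzSeminormFamily ℂ ℂ ℂ) q

theorem seminorm_sup_mono {s t : Finset (ℕ × ℕ)} (h : s ⊆ t) (q : 𝓢(ℂ, ℂ)) :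
    s.sup (schwartzSeminormFamily ℂ ℂ ℂ) q ≤ t.sup (schwartzSeminormFamily ℂ ℂ ℂ) q :=
  Finset.sup_mono (f := schwartzSeminormFamily ℂ ℂ ℂ) h q

theorem exists_seminorm_sup_le (D : 𝓢(ℂ, ℂ) →L[ℂ] 𝓢(ℂ, ℂ)) (s : Finset (ℕ × ℕ)) :
    ∃ (t : Finset (ℕ × ℕ)) (C : ℝ), 0 ≤ C ∧ ∀ q, s.sup (schwartzSeminormFamily ℂ ℂ ℂ) (D q) ≤
      C * t.sup (schwartzSeminormFamily ℂ ℂ ℂ) q := by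
  have hc : Continuous ((s.sup (schwartzSeminormFamily ℂ ℂ ℂ)).comp D.toLinearMap) := by
    have h1 : Continuous (fun q => s.sup (schwartzSeminormFamily ℂ ℂ ℂ) q) :=
      Seminorm.continuous_finsetSup
        (fun i _ => (schwartz_withSeminorms ℂ ℂ ℂ).continuous_seminorm i)
    exact h1.comp D.continuous
  obtain ⟨t, C, _, h⟩ := Seminorm.bound_of_continuous (schwartz_withSeminorms ℂ ℂ ℂ) _ hc
  exact ⟨t, C, C.2, fun q => h q⟩

theorem SchwartzBound.add {f g : 𝓢(ℂ, ℂ) → ℂ → ℝ} (hf : SchwartzBound f) (hg : SchwartzBound g) :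
    SchwartzBound fun q z => f q z + g q z := by
  intro k
  obtain ⟨s, C, hC, h⟩ := hf k
  obtain ⟨s', C', hC', h'⟩ := hg k
  refine ⟨s ∪ s', C + C', by positivity, fun q z => ?_⟩
  have a := (h q z).trans (mul_le_mul_of_nonneg_left
    (seminorm_sup_mono (Finset.subset_union_left (s₂ := s')) q) hC)
  have b := (h' q z).trans (mul_le_mul_of_nonneg_left
    (seminorm_sup_mono (Finset.subset_union_right (s₁ := s)) q) hC')
  rw [mul_add, add_mul]
  exact add_le_add a b

theorem SchwartzBound.mono {f g : 𝓢(ℂ, ℂ) → ℂ → ℝ} (h : ∀ q z, f q z ≤ g q z)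
    (hg : SchwartzBound g) : SchwartzBound f := by
  intro k
  obtain ⟨s, C, hC, h'⟩ := hg k
  exact ⟨s, C, hC, fun q z => (mul_le_mul_of_nonneg_left (h q z) (by positivity)).trans (h' q z)⟩

theorem SchwartzBound.comp {f : 𝓢(ℂ, ℂ) → ℂ → ℝ} (hf : SchwartzBound f)
    (D : 𝓢(ℂ, ℂ) →L[ℂ] 𝓢(ℂ, ℂ)) : SchwartzBound fun q => f (D q) := by
  intro k
  obtain ⟨s, C, hC, h⟩ := hf k
  obtain ⟨t, C', hC', h'⟩ := exists_seminorm_sup_le D s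
  refine ⟨t, C * C', by positivity, fun q z => (h (D q) z).trans ?_⟩
  rw [mul_assoc]
  exact mul_le_mul_of_nonneg_left (h' q) hC

/-- A continuous operator on Schwartz functions from bounds on all derivatives. -/
theorem exists_schwartzCLM (F : 𝓢(ℂ, ℂ) → ℂ → ℂ)
    (hadd : ∀ q r z, F (q + r) z = F q z + F r z) (hsmul : ∀ (c : ℂ) q z, F (c • q) z = c * F q z)
    (h : ∀ n : ℕ, (∀ q, ContDiff ℝ n (F q)) ∧
      SchwartzBound fun q z => ‖iteratedFDeriv ℝ n (F q) z‖) :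
    ∃ T : 𝓢(ℂ, ℂ) →L[ℂ] 𝓢(ℂ, ℂ), ∀ q z, T q z = F q z :=
  ⟨SchwartzMap.mkCLM F hadd hsmul (fun q => contDiff_infty.2 fun n => (h n).1 q)
    fun n => (h n.2).2 n.1, fun _ _ => rfl⟩

open MeasureTheory

/-! ### Integrals of twisted Schwartz functions -/

/-- In polar coordinates the weight is y^(σ+1), integrable at 0 exactly because σ > -2; l > σ + 2
handles infinity. -/
theorem exists_integrable_weight {σ : ℝ} (hσ : -2 < σ) :
    ∃ l : ℕ, Integrable fun z : ℂ => ‖z‖ ^ σ * ((1 + ‖z‖) ^ l)⁻¹ := by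
  obtain ⟨l, hl⟩ := exists_nat_gt (σ + 2)
  refine ⟨l, ?_⟩
  have h := integrable_fun_norm_addHaar (volume : Measure ℂ)
    (f := fun y : ℝ => y ^ σ * ((1 + y) ^ l)⁻¹)
  refine h.2 ?_
  rw [Complex.finrank_real_complex]
  have hmeas : Measurable fun y : ℝ => y ^ (2 - 1) • (y ^ σ * ((1 + y) ^ l)⁻¹) := by fun_prop
  rw [← Set.Ioc_union_Ioi_eq_Ioi zero_le_one]
  refine IntegrableOn.union ?_ ?_
  · have h1 : IntegrableOn (fun y : ℝ => y ^ (σ + 1)) (Set.Ioc 0 1) :=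
      (intervalIntegrable_iff_integrableOn_Ioc_of_le zero_le_one).1
        (intervalIntegral.intervalIntegrable_rpow' (by linarith))
    refine Integrable.mono' h1 hmeas.aestronglyMeasurable ?_
    filter_upwards [ae_restrict_mem measurableSet_Ioc] with y hy
    have hy0 : 0 < y := hy.1
    rw [Real.norm_of_nonneg (by positivity), Real.rpow_add hy0, Real.rpow_one, smul_eq_mul,
      Nat.add_one_sub_one, pow_one]
    have : ((1 + y) ^ l)⁻¹ ≤ 1 := inv_le_one_of_one_le₀ (one_le_pow₀ (by linarith))
    calc y * (y ^ σ * ((1 + y) ^ l)⁻¹) ≤ y * (y ^ σ * 1) := by gcongr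
      _ = _ := by ring
  · have h1 : IntegrableOn (fun y : ℝ => y ^ (σ + 1 - l)) (Set.Ioi 1) :=
      integrableOn_Ioi_rpow_of_lt (by linarith) one_pos
    refine Integrable.mono' h1 hmeas.aestronglyMeasurable ?_
    filter_upwards [ae_restrict_mem measurableSet_Ioi] with y hy
    have hy0 : 0 < y := lt_trans one_pos hy
    rw [Real.norm_of_nonneg (by positivity), Real.rpow_sub hy0, Real.rpow_add hy0, Real.rpow_one,
      Real.rpow_natCast, smul_eq_mul, Nat.add_one_sub_one, pow_one, div_eq_mul_inv]
    calc y * (y ^ σ * ((1 + y) ^ l)⁻¹) ≤ y * (y ^ σ * (y ^ l)⁻¹) := by gcongr; linarith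
      _ = _ := by ring

theorem aestronglyMeasurable_of_continuousAt {f : ℂ → ℂ} (h : ∀ z, z ≠ 0 → ContinuousAt f z) :
    AEStronglyMeasurable f volume := by
  have h1 : ContinuousOn f {0}ᶜ := fun z hz => (h z hz).continuousWithinAt
  have h2 := h1.aestronglyMeasurable (μ := volume) (measurableSet_singleton (0 : ℂ)).compl
  rwa [restrict_compl_singleton] at h2

theorem ae_ne_zero : ∀ᵐ z : ℂ, z ≠ 0 := by
  simp [ae_iff]

theorem continuousAt_twist (ν : ℂ) (p : ℤ) {z : ℂ} (hz : z ≠ 0) : ContinuousAt (twist ν p) z :=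
  (hasWirt_twist ν p hz).differentiableAt.continuousAt

/-- The integrands of twisted integrals are dominated by integrable functions. -/
theorem exists_twist_mul_le {lam : ℂ} (hl : -2 < lam.re) (m : ℤ) {b : ℂ → ℂ}
    (hb : b.HasTemperateGrowth) :
    ∃ (w : ℂ → ℝ) (k : ℕ) (s : Finset (ℕ × ℕ)), Integrable w ∧ (∀ z, 0 ≤ w z) ∧
      ∀ (q : 𝓢(ℂ, ℂ)) (u z : ℂ), z ≠ 0 → ‖twist lam m z * q z * b (u * z)‖ ≤
        (1 + ‖u‖) ^ k * s.sup (schwartzSeminormFamily ℂ ℂ ℂ) q * w z := by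
  obtain ⟨l, hw⟩ := exists_integrable_weight hl
  obtain ⟨k, C, hC, hbd⟩ := hb.bound
  refine ⟨fun z => (2 ^ (k + l) * C) * (‖z‖ ^ lam.re * ((1 + ‖z‖) ^ l)⁻¹), k,
    Finset.Iic (k + l, 0), hw.const_mul _, fun z => by positivity, fun q u z hz => ?_⟩
  have h1 : (1 + ‖z‖) ^ (k + l) * ‖q z‖ ≤ 2 ^ (k + l) *
      (Finset.Iic (k + l, 0)).sup (schwartzSeminormFamily ℂ ℂ ℂ) q := by
    have := SchwartzMap.one_add_le_sup_seminorm_apply (𝕜 := ℂ) (m := (k + l, 0)) le_rfl le_rfl q z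
    rwa [norm_iteratedFDeriv_zero] at this
  set N := (Finset.Iic (k + l, 0)).sup (schwartzSeminormFamily ℂ ℂ ℂ) q
  have h2 : ‖b (u * z)‖ ≤ C * ((1 + ‖u‖) ^ k * (1 + ‖z‖) ^ k) := by
    refine (hbd _).trans ?_
    rw [← mul_pow, norm_mul]
    gcongr
    nlinarith [norm_nonneg u, norm_nonneg z]
  have hz1 : 0 < (1 + ‖z‖) := by positivity
  rw [norm_mul, norm_mul, norm_twist _ _ hz]
  calc _ ≤ ‖z‖ ^ lam.re * ‖q z‖ * (C * ((1 + ‖u‖) ^ k * (1 + ‖z‖) ^ k)) := by gcongr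
    _ = (‖z‖ ^ lam.re * C * (1 + ‖u‖) ^ k * ((1 + ‖z‖) ^ l)⁻¹) *
        ((1 + ‖z‖) ^ (k + l) * ‖q z‖) := by
        rw [pow_add]; field_simp
    _ ≤ (‖z‖ ^ lam.re * C * (1 + ‖u‖) ^ k * ((1 + ‖z‖) ^ l)⁻¹) * (2 ^ (k + l) * N) := by gcongr
    _ = _ := by ring

theorem integrable_twist_mul_mul {lam : ℂ} (hl : -2 < lam.re) (m : ℤ) {b : ℂ → ℂ}
    (hb : b.HasTemperateGrowth) (q : 𝓢(ℂ, ℂ)) (u : ℂ) :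
    Integrable fun z => twist lam m z * q z * b (u * z) := by
  obtain ⟨w, k, s, hw, -, h⟩ := exists_twist_mul_le hl m hb
  refine (hw.const_mul _).mono' (aestronglyMeasurable_of_continuousAt fun z hz => ?_)
    (ae_ne_zero.mono fun z hz => h q u z hz)
  exact ((continuousAt_twist _ _ hz).mul q.continuous.continuousAt).mul
    (hb.comp_mul_left u).1.continuous.continuousAt

theorem integrable_twist_mul {lam : ℂ} (hl : -2 < lam.re) (m : ℤ) (q : 𝓢(ℂ, ℂ)) :
    Integrable fun z => twist lam m z * q z := by
  simpa using integrable_twist_mul_mul hl m (Function.HasTemperateGrowth.const (1 : ℂ)) q 0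

/-- The integral against `twist`, as a linear functional. -/
def twistIntegral {lam : ℂ} (hl : -2 < lam.re) (m : ℤ) : 𝓢(ℂ, ℂ) →ₗ[ℂ] ℂ where
  toFun q := ∫ z, twist lam m z * q z
  map_add' q r := by
    rw [← integral_add (integrable_twist_mul hl m q) (integrable_twist_mul hl m r)]
    simp [mul_add]
  map_smul' c q := by
    rw [RingHom.id_apply, smul_eq_mul, ← integral_const_mul]
    congr 1; ext z; simp; ring

/-! ### Integration by parts -/

/-- By Fubini, integrate along horizontal lines. Almost every line misses the origin, so a
singularity there does no harm as long as G and its derivative are integrable. -/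
theorem integral_fderiv_one_eq_zero {G : ℂ → ℂ} (hd : ∀ z, z ≠ 0 → DifferentiableAt ℝ G z)
    (hG : Integrable G) (hG' : Integrable fun z => fderiv ℝ G z 1) :
    ∫ z, fderiv ℝ G z 1 = 0 := by
  have e := volume_preserving_equiv_real_prod.symm
  have emb := measurableEquivRealProd.symm.measurableEmbedding
  rw [← e.integral_comp emb]
  have i0 := (e.integrable_comp_emb emb).2 hG
  have i1 := (e.integrable_comp_emb emb).2 hG'
  simp only [Function.comp_def, measurableEquivRealProd_symm_apply] at i0 i1 ⊢
  rw [Measure.volume_eq_prod] at i0 i1 ⊢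
  rw [integral_prod_symm _ i1]
  refine integral_eq_zero_of_ae ?_
  have hne : ∀ᵐ y : ℝ, y ≠ 0 := by simp [ae_iff]
  filter_upwards [i0.prod_left_ae, i1.prod_left_ae, hne] with y hy0 hy1 hy
  refine integral_eq_zero_of_hasDerivAt_of_integrable (fun x => ?_) hy1 hy0
  have hz : (⟨x, y⟩ : ℂ) ≠ 0 := fun h => hy (congrArg im h)
  have hl : HasDerivAt (fun x : ℝ => (⟨x, y⟩ : ℂ)) 1 x := by
    have h := (hasDerivAt_id x).ofReal_comp.add_const ((y : ℂ) * I)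
    refine (h.congr_of_eventuallyEq (Filter.Eventually.of_forall fun t => ?_)).congr_deriv
      (by simp)
    exact Complex.ext (by simp) (by simp)
  exact (hd _ hz).hasFDerivAt.comp_hasDerivAt x hl

theorem integral_fderiv_I_eq_zero {G : ℂ → ℂ} (hd : ∀ z, z ≠ 0 → DifferentiableAt ℝ G z)
    (hG : Integrable G) (hG' : Integrable fun z => fderiv ℝ G z I) :
    ∫ z, fderiv ℝ G z I = 0 := by
  have e := volume_preserving_equiv_real_prod.symm
  have emb := measurableEquivRealProd.symm.measurableEmbedding
  rw [← e.integral_comp emb]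
  have i0 := (e.integrable_comp_emb emb).2 hG
  have i1 := (e.integrable_comp_emb emb).2 hG'
  simp only [Function.comp_def, measurableEquivRealProd_symm_apply] at i0 i1 ⊢
  rw [Measure.volume_eq_prod] at i0 i1 ⊢
  rw [integral_prod _ i1]
  refine integral_eq_zero_of_ae ?_
  have hne : ∀ᵐ y : ℝ, y ≠ 0 := by simp [ae_iff]
  filter_upwards [i0.prod_right_ae, i1.prod_right_ae, hne] with x hy0 hy1 hx
  refine integral_eq_zero_of_hasDerivAt_of_integrable (fun y => ?_) hy1 hy0
  have hz : (⟨x, y⟩ : ℂ) ≠ 0 := fun h => hx (congrArg re h)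
  have hl : HasDerivAt (fun y : ℝ => (⟨x, y⟩ : ℂ)) I y := by
    have h := ((hasDerivAt_id y).ofReal_comp.mul_const I).const_add (x : ℂ)
    refine (h.congr_of_eventuallyEq (Filter.Eventually.of_forall fun t => ?_)).congr_deriv
      (by simp)
    exact Complex.ext (by simp) (by simp)
  exact (hd _ hz).hasFDerivAt.comp_hasDerivAt y hl

theorem hasWirt_twist_mul (lam : ℂ) (m : ℤ) (q : 𝓢(ℂ, ℂ)) {z : ℂ} (hz : z ≠ 0) :
    HasWirt (fun z => twist lam m z * q z)
      ((lam + m) / 2 * (twist (lam - 1) (m - 1) z * q z) + twist lam m z * schwartzDz q z)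
      ((lam - m) / 2 * (twist (lam - 1) (m + 1) z * q z) + twist lam m z * schwartzDzbar q z) z :=
  ((hasWirt_twist lam m hz).mul (schwartzHasWirt q z)).congr_deriv (by ring) (by ring)

/-- Differentiation lowers the exponent by one, so Re λ > -1 keeps the derivative integrable at the
origin. -/
theorem integral_dz_twist_mul {lam : ℂ} (hl : -1 < lam.re) (m : ℤ) (q : 𝓢(ℂ, ℂ)) :
    ∫ z, dz (fun z => twist lam m z * q z) z = 0 ∧
      ∫ z, dzbar (fun z => twist lam m z * q z) z = 0 := by
  set G : ℂ → ℂ := fun z => twist lam m z * q z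
  have hl2 : -2 < lam.re := by linarith
  have hl3 : -2 < (lam - 1).re := by simp; linarith
  have hW := fun z (hz : z ≠ 0) => hasWirt_twist_mul lam m q hz
  have hd : ∀ z, z ≠ 0 → DifferentiableAt ℝ G z := fun z hz => (hW z hz).differentiableAt
  have hG : Integrable G := integrable_twist_mul hl2 m q
  have hG' : ∀ v, Integrable fun z => fderiv ℝ G z v := by
    intro v
    have j1 := ((integrable_twist_mul hl3 (m - 1) q).const_mul ((lam + m) / 2)).add
      (integrable_twist_mul hl2 m (schwartzDz q))
    have j2 := ((integrable_twist_mul hl3 (m + 1) q).const_mul ((lam - m) / 2)).add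
      (integrable_twist_mul hl2 m (schwartzDzbar q))
    refine ((j1.mul_const v).add (j2.mul_const (starRingEnd ℂ v))).congr ?_
    filter_upwards [ae_ne_zero] with z hz
    rw [HasFDerivAt.fderiv (hW z hz), wirt_apply]
    rfl
  have h1 := integral_fderiv_one_eq_zero hd hG (hG' 1)
  have h2 := integral_fderiv_I_eq_zero hd hG (hG' I)
  constructor
  · simp only [dz]
    rw [integral_div, integral_sub (hG' 1) ((hG' I).const_mul I), integral_const_mul, h1, h2]
    simp
  · simp only [dzbar]
    rw [integral_div, integral_add (hG' 1) ((hG' I).const_mul I), integral_const_mul, h1, h2]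
    simp

theorem twist_mul_self (lam : ℂ) (m : ℤ) (z : ℂ) (hz : z ≠ 0) :
    twist (lam + 1) (m + 1) z = twist lam m z * z := by
  rw [twist_add _ _ _ _ hz, twist_one_one]

theorem twist_mul_conj (lam : ℂ) (m : ℤ) (z : ℂ) (hz : z ≠ 0) :
    twist (lam + 1) (m - 1) z = twist lam m z * starRingEnd ℂ z := by
  rw [sub_eq_add_neg, twist_add _ _ _ _ hz, twist_one_neg_one]

theorem schwartzNabla_eq (q : 𝓢(ℂ, ℂ)) (z : ℂ) : schwartzNabla q z = z * schwartzDz q z := by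
  rw [schwartzNabla_apply, schwartzDz_apply, nablaFun_eq]

theorem schwartzNablaBar_eq (q : 𝓢(ℂ, ℂ)) (z : ℂ) :
    schwartzNablaBar q z = starRingEnd ℂ z * schwartzDzbar q z := by
  rw [schwartzNablaBar_apply, schwartzDzbar_apply, nablaBarFun_eq]

/-- The integrand is ∂/∂z of z times the twisted function. The factor z raises the exponent by one,
which is why Re λ > -2 suffices here. -/
theorem twistIntegral_nabla {lam : ℂ} (hl : -2 < lam.re) (m : ℤ) (q : 𝓢(ℂ, ℂ)) :
    twistIntegral hl m (((lam + m) / 2 + 1) • q + schwartzNabla q) = 0 := by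
  have h := (integral_dz_twist_mul (lam := lam + 1) (by simp; linarith) (m + 1) q).1
  rw [← h]
  refine integral_congr_ae (ae_ne_zero.mono fun z hz => ?_)
  simp only
  rw [(hasWirt_twist_mul (lam + 1) (m + 1) q hz).dz, add_sub_cancel_right, add_sub_cancel_right,
    twist_mul_self _ _ _ hz, add_apply, smul_apply, schwartzNabla_eq]
  push_cast
  simp only [smul_eq_mul]
  ring

theorem twistIntegral_nablaBar {lam : ℂ} (hl : -2 < lam.re) (m : ℤ) (q : 𝓢(ℂ, ℂ)) :
    twistIntegral hl m (((lam - m) / 2 + 1) • q + schwartzNablaBar q) = 0 := by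
  have h := (integral_dz_twist_mul (lam := lam + 1) (by simp; linarith) (m - 1) q).2
  rw [← h]
  refine integral_congr_ae (ae_ne_zero.mono fun z hz => ?_)
  simp only
  rw [(hasWirt_twist_mul (lam + 1) (m - 1) q hz).dzbar, add_sub_cancel_right, sub_add_cancel,
    twist_mul_conj _ _ _ hz, add_apply, smul_apply, schwartzNablaBar_eq]
  push_cast
  simp only [smul_eq_mul]
  ring

theorem twistIntegral_zero_dz (h0 : -2 < (0 : ℂ).re) (q : 𝓢(ℂ, ℂ)) :
    twistIntegral h0 0 (schwartzDz q) = 0 := by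
  refine Eq.trans ?_ (integral_dz_twist_mul (lam := 0) (by simp) 0 q).1
  refine integral_congr_ae (ae_ne_zero.mono fun z hz => ?_)
  simp only
  rw [(hasWirt_twist_mul 0 0 q hz).dz]
  simp

/-! ### The twisted convolution operator -/

/-- The multiplicative convolution `∫ |z|^λ (z/|z|)^m q(z) b(uz) dz`. -/
def twistConv (lam : ℂ) (m : ℤ) (b : ℂ → ℂ) (q : 𝓢(ℂ, ℂ)) (u : ℂ) : ℂ :=
  ∫ z, twist lam m z * q z * b (u * z)

/-- Multiplication of a Schwartz function by `b(uz)`. -/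
def scaledMul (b : ℂ → ℂ) (u : ℂ) : 𝓢(ℂ, ℂ) →L[ℂ] 𝓢(ℂ, ℂ) :=
  SchwartzMap.smulLeftCLM ℂ fun z => b (u * z)

theorem scaledMul_apply {b : ℂ → ℂ} (hb : b.HasTemperateGrowth) (u : ℂ) (q : 𝓢(ℂ, ℂ)) (z : ℂ) :
    scaledMul b u q z = b (u * z) * q z := by
  rw [scaledMul, SchwartzMap.smulLeftCLM_apply_apply (hb.comp_mul_left u), smul_eq_mul]

theorem twistConv_eq {lam : ℂ} (hl : -2 < lam.re) (m : ℤ) {b : ℂ → ℂ} (hb : b.HasTemperateGrowth)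
    (q : 𝓢(ℂ, ℂ)) (u : ℂ) : twistConv lam m b q u = twistIntegral hl m (scaledMul b u q) := by
  change _ = ∫ z, twist lam m z * scaledMul b u q z
  refine integral_congr_ae (Filter.Eventually.of_forall fun z => ?_)
  simp only [scaledMul_apply hb]
  ring

theorem twistConv_add {lam : ℂ} (hl : -2 < lam.re) (m : ℤ) {b : ℂ → ℂ} (hb : b.HasTemperateGrowth)
    (q r : 𝓢(ℂ, ℂ)) (u : ℂ) :
    twistConv lam m b (q + r) u = twistConv lam m b q u + twistConv lam m b r u := by
  simp only [twistConv_eq hl m hb, map_add]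

theorem twistConv_smul {lam : ℂ} (hl : -2 < lam.re) (m : ℤ) {b : ℂ → ℂ} (hb : b.HasTemperateGrowth)
    (c : ℂ) (q : 𝓢(ℂ, ℂ)) (u : ℂ) :
    twistConv lam m b (c • q) u = c * twistConv lam m b q u := by
  simp only [twistConv_eq hl m hb, map_smul, smul_eq_mul]

/-- Multiplication by `z` on Schwartz functions. -/
def schwartzMulZ : 𝓢(ℂ, ℂ) →L[ℂ] 𝓢(ℂ, ℂ) := SchwartzMap.smulLeftCLM ℂ fun z : ℂ => z

/-- Multiplication by `z̄` on Schwartz functions. -/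
def schwartzMulZBar : 𝓢(ℂ, ℂ) →L[ℂ] 𝓢(ℂ, ℂ) :=
  SchwartzMap.smulLeftCLM ℂ fun z : ℂ => starRingEnd ℂ z

theorem schwartzMulZ_apply (q : 𝓢(ℂ, ℂ)) (z : ℂ) : schwartzMulZ q z = z * q z := by
  rw [schwartzMulZ, SchwartzMap.smulLeftCLM_apply_apply temperate_id, smul_eq_mul]

theorem schwartzMulZBar_apply (q : 𝓢(ℂ, ℂ)) (z : ℂ) :
    schwartzMulZBar q z = starRingEnd ℂ z * q z := by
  rw [schwartzMulZBar, SchwartzMap.smulLeftCLM_apply_apply temperate_conj, smul_eq_mul]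

theorem exists_twistConv_le {lam : ℂ} (hl : -2 < lam.re) (m : ℤ) {b : ℂ → ℂ}
    (hb : b.HasTemperateGrowth) : ∃ (k : ℕ) (s : Finset (ℕ × ℕ)) (C : ℝ), 0 ≤ C ∧ ∀ q u,
      ‖twistConv lam m b q u‖ ≤
        C * (1 + ‖u‖) ^ k * s.sup (schwartzSeminormFamily ℂ ℂ ℂ) q := by
  obtain ⟨w, k, s, hw, hw0, h⟩ := exists_twist_mul_le hl m hb
  refine ⟨k, s, ∫ z, w z, integral_nonneg hw0, fun q u => ?_⟩
  have := norm_integral_le_of_norm_le (hw.const_mul _) (ae_ne_zero.mono fun z hz => h q u z hz)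
  rw [integral_const_mul] at this
  refine this.trans (le_of_eq ?_)
  ring

/-- Differentiation under the integral: the derivative in u falls on b and the resulting factor z or
z̄ is absorbed into q. On the unit ball about u the dominating functions are uniform, as ‖v‖ ≤ ‖u‖ +
1. -/
theorem hasWirt_twistConv {lam : ℂ} (hl : -2 < lam.re) (m : ℤ) {b : ℂ → ℂ}
    (hb : b.HasTemperateGrowth) (q : 𝓢(ℂ, ℂ)) (u : ℂ) :
    HasWirt (twistConv lam m b q) (twistConv lam m (dz b) (schwartzMulZ q) u)
      (twistConv lam m (dzbar b) (schwartzMulZBar q) u) u := by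
  obtain ⟨w₁, k₁, s₁, hw₁, hw₁0, h₁⟩ := exists_twist_mul_le hl m hb.dz
  obtain ⟨w₂, k₂, s₂, hw₂, hw₂0, h₂⟩ := exists_twist_mul_le hl m hb.dzbar
  have i₁ := integrable_twist_mul_mul hl m hb.dz (schwartzMulZ q)
  have i₂ := integrable_twist_mul_mul hl m hb.dzbar (schwartzMulZBar q)
  have key := hasFDerivAt_integral_of_dominated_of_fderiv_le (𝕜 := ℝ) (μ := volume)
    (F := fun u z => twist lam m z * q z * b (u * z))
    (F' := fun u z => wirt (twist lam m z * schwartzMulZ q z * dz b (u * z))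
      (twist lam m z * schwartzMulZBar q z * dzbar b (u * z))) (x₀ := u)
    (bound := fun z => (1 + (‖u‖ + 1)) ^ k₁ *
      s₁.sup (schwartzSeminormFamily ℂ ℂ ℂ) (schwartzMulZ q) * w₁ z +
      (1 + (‖u‖ + 1)) ^ k₂ * s₂.sup (schwartzSeminormFamily ℂ ℂ ℂ) (schwartzMulZBar q) * w₂ z)
    (s := Metric.ball u 1) (Metric.ball_mem_nhds u one_pos)
    (Filter.Eventually.of_forall fun v =>
      (integrable_twist_mul_mul hl m hb q v).aestronglyMeasurable)
    (integrable_twist_mul_mul hl m hb q u)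
    ((wirtLeft.integrable_comp (i₁ u)).add
      (wirtRight.integrable_comp (i₂ u))).aestronglyMeasurable ?_
    ((hw₁.const_mul _).add (hw₂.const_mul _)) ?_
  · refine key.congr_fderiv ?_
    have := integral_add (wirtLeft.integrable_comp (i₁ u)) (wirtRight.integrable_comp (i₂ u))
    rw [wirtLeft.integral_comp_comm (i₁ u), wirtRight.integral_comp_comm (i₂ u)] at this
    exact this
  · filter_upwards [ae_ne_zero] with z hz v hv
    have hv' : ‖v‖ ≤ ‖u‖ + 1 := by
      have h := norm_add_le u (v - u)
      rw [add_sub_cancel] at h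
      rw [mem_ball_iff_norm] at hv
      linarith
    refine (norm_add_le _ _).trans (add_le_add ?_ ?_)
    · refine (wirtLeft.le_opNorm _).trans
        ((mul_le_of_le_one_left (norm_nonneg _) norm_wirtLeft_le).trans ?_)
      refine (h₁ (schwartzMulZ q) v z hz).trans ?_
      have := hw₁0 z
      gcongr
    · refine (wirtRight.le_opNorm _).trans
        ((mul_le_of_le_one_left (norm_nonneg _) norm_wirtRight_le).trans ?_)
      refine (h₂ (schwartzMulZBar q) v z hz).trans ?_
      have := hw₂0 z
      gcongr
  · refine Filter.Eventually.of_forall fun z v _ => ?_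
    have h1 : HasWirt (fun v => b (v * z)) (z * dz b (v * z))
        (starRingEnd ℂ z * dzbar b (v * z)) v := by
      have := ((hb.differentiable (z * v)).hasWirt).comp_mul_left
      simpa only [mul_comm z] using this
    refine (h1.const_mul (twist lam m z * q z)).congr_deriv ?_ ?_
    · rw [schwartzMulZ_apply]; ring
    · rw [schwartzMulZBar_apply]; ring

theorem hasWirt_scaledMul {b : ℂ → ℂ} (hb : b.HasTemperateGrowth) (u : ℂ) (q : 𝓢(ℂ, ℂ)) (z : ℂ) :
    HasWirt (scaledMul b u q) (u * dz b (u * z) * q z + b (u * z) * schwartzDz q z)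
      (starRingEnd ℂ u * dzbar b (u * z) * q z + b (u * z) * schwartzDzbar q z) z :=
  (((hb.differentiable (u * z)).hasWirt.comp_mul_left).mul
    (schwartzHasWirt q z)).congr_of_eventuallyEq
    (Filter.Eventually.of_forall fun z => scaledMul_apply hb u q z)

theorem schwartzDz_scaledMul {b : ℂ → ℂ} (hb : b.HasTemperateGrowth) (u : ℂ) (q : 𝓢(ℂ, ℂ)) :
    schwartzDz (scaledMul b u q) = u • scaledMul (dz b) u q + scaledMul b u (schwartzDz q) := by
  ext z
  rw [schwartzDz_apply, (hasWirt_scaledMul hb u q z).dz]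
  simp only [add_apply, smul_apply, scaledMul_apply hb, scaledMul_apply hb.dz, smul_eq_mul]
  ring

theorem schwartzDzbar_scaledMul {b : ℂ → ℂ} (hb : b.HasTemperateGrowth) (u : ℂ) (q : 𝓢(ℂ, ℂ)) :
    schwartzDzbar (scaledMul b u q) =
      starRingEnd ℂ u • scaledMul (dzbar b) u q + scaledMul b u (schwartzDzbar q) := by
  ext z
  rw [schwartzDzbar_apply, (hasWirt_scaledMul hb u q z).dzbar]
  simp only [add_apply, smul_apply, scaledMul_apply hb, scaledMul_apply hb.dzbar, smul_eq_mul]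
  ring

/-- `∇` of the convolution, by integration by parts. -/
theorem mul_twistConv_dz {lam : ℂ} (hl : -2 < lam.re) (m : ℤ) {b : ℂ → ℂ}
    (hb : b.HasTemperateGrowth) (q : 𝓢(ℂ, ℂ)) (u : ℂ) :
    u * twistConv lam m (dz b) (schwartzMulZ q) u =
      -twistConv lam m b (((lam + m) / 2 + 1) • q + schwartzNabla q) u := by
  rw [twistConv_eq hl m hb.dz, twistConv_eq hl m hb, ← smul_eq_mul, ← map_smul,
    eq_neg_iff_add_eq_zero, ← map_add, ← twistIntegral_nabla hl m (scaledMul b u q)]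
  congr 1
  ext z
  simp only [add_apply, smul_apply, schwartzNabla_eq, scaledMul_apply hb,
    scaledMul_apply hb.dz, schwartzMulZ_apply, smul_eq_mul,
    schwartzDz_scaledMul hb]
  ring

theorem mul_twistConv_dzbar {lam : ℂ} (hl : -2 < lam.re) (m : ℤ) {b : ℂ → ℂ}
    (hb : b.HasTemperateGrowth) (q : 𝓢(ℂ, ℂ)) (u : ℂ) :
    starRingEnd ℂ u * twistConv lam m (dzbar b) (schwartzMulZBar q) u =
      -twistConv lam m b (((lam - m) / 2 + 1) • q + schwartzNablaBar q) u := by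
  rw [twistConv_eq hl m hb.dzbar, twistConv_eq hl m hb, ← smul_eq_mul, ← map_smul,
    eq_neg_iff_add_eq_zero, ← map_add, ← twistIntegral_nablaBar hl m (scaledMul b u q)]
  congr 1
  ext z
  simp only [add_apply, smul_apply, schwartzNablaBar_eq,
    scaledMul_apply hb, scaledMul_apply hb.dzbar, schwartzMulZBar_apply, smul_eq_mul,
    schwartzDzbar_scaledMul hb]
  ring

/-! ### The second-order operator -/

/-- The operator `4 z ∂² + 4 c ∂` on functions. -/
def besselOpFun (c : ℂ) (f : ℂ → ℂ) (z : ℂ) : ℂ := 4 * z * dz (dz f) z + 4 * c * dz f z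

/-- The operator `4 z ∂² + 4 c ∂` on Schwartz functions. -/
def besselOp (c : ℂ) : 𝓢(ℂ, ℂ) →L[ℂ] 𝓢(ℂ, ℂ) :=
  (4 : ℂ) • (schwartzNabla ∘L schwartzDz) + (4 * c) • schwartzDz

theorem besselOp_apply (c : ℂ) (q : 𝓢(ℂ, ℂ)) (z : ℂ) :
    besselOp c q z = 4 * z * schwartzDz (schwartzDz q) z + 4 * c * schwartzDz q z := by
  simp [besselOp, schwartzNabla_eq]
  ring

theorem temperate_besselOpFun (c : ℂ) {b : ℂ → ℂ} (hb : b.HasTemperateGrowth) :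
    (besselOpFun c b).HasTemperateGrowth := by
  have h1 := hb.dz
  have h2 := h1.dz
  have h3 : Function.HasTemperateGrowth fun z : ℂ => z := temperate_id
  unfold besselOpFun
  exact (((Function.HasTemperateGrowth.const _).mul h3).mul h2).add
    ((Function.HasTemperateGrowth.const _).mul h1)

/-- With c = (λ+m)/2 + 1 the operator 4z∂² + 4c∂ is 4z^(1-c) ∂(z^c ∂), symmetric for the weight in
the integral. The function S in the proof is 4 times the Wronskian of b(uz) and q, and the two
integrands differ by its weighted divergence. -/
theorem twistConv_besselOp {lam : ℂ} (hl : -2 < lam.re) (m : ℤ) {b : ℂ → ℂ}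
    (hb : b.HasTemperateGrowth) (q : 𝓢(ℂ, ℂ)) (u : ℂ) :
    twistConv lam m b (besselOp ((lam + m) / 2 + 1) q) u =
      u * twistConv lam m (besselOpFun ((lam + m) / 2 + 1) b) q u := by
  set c := (lam + m) / 2 + 1 with hc
  have hL := temperate_besselOpFun c hb
  set S : 𝓢(ℂ, ℂ) := (4 * u) • scaledMul (dz b) u q - (4 : ℂ) • scaledMul b u (schwartzDz q)
  have h0 := twistIntegral_nabla hl m S
  rw [twistConv_eq hl m hb, twistConv_eq hl m hL, ← smul_eq_mul, ← map_smul, eq_comm,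
    ← sub_eq_zero, ← map_sub, ← h0]
  congr 1
  ext z
  simp only [S, ← hc, add_apply, sub_apply, smul_apply,
    schwartzNabla_eq, map_sub, map_smul, schwartzDz_scaledMul hb, schwartzDz_scaledMul hb.dz,
    scaledMul_apply hb, scaledMul_apply hb.dz, scaledMul_apply hb.dz.dz, scaledMul_apply hL,
    besselOp_apply, besselOpFun, smul_eq_mul]
  ring

/-- For the weight 1 the transpose replaces c by 2 - c; compared with the symmetric case there is an
additional total derivative, that of 4(1-c) b(uz) q. -/
theorem twistConv_zero_besselOp (h0 : -2 < (0 : ℂ).re) (c : ℂ) {b : ℂ → ℂ}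
    (hb : b.HasTemperateGrowth) (q : 𝓢(ℂ, ℂ)) (u : ℂ) :
    twistConv 0 0 b (besselOp c q) u = u * twistConv 0 0 (besselOpFun (2 - c) b) q u := by
  have hL := temperate_besselOpFun (2 - c) hb
  set S : 𝓢(ℂ, ℂ) := (4 * u) • scaledMul (dz b) u q - (4 : ℂ) • scaledMul b u (schwartzDz q)
  have h1 := twistIntegral_nabla h0 0 S
  have h2 := twistIntegral_zero_dz h0 ((4 * (1 - c)) • scaledMul b u q)
  have h3 : u • scaledMul (besselOpFun (2 - c) b) u q - scaledMul b u (besselOp c q) =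
      (((0 : ℂ) + (0 : ℤ)) / 2 + 1) • S + schwartzNabla S +
        schwartzDz ((4 * (1 - c)) • scaledMul b u q) := by
    ext z
    simp only [S, add_apply, sub_apply, smul_apply, schwartzNabla_eq, map_sub, map_smul,
      schwartzDz_scaledMul hb, schwartzDz_scaledMul hb.dz, scaledMul_apply hb,
      scaledMul_apply hb.dz, scaledMul_apply hb.dz.dz, scaledMul_apply hL, besselOp_apply,
      besselOpFun, smul_eq_mul]
    push_cast
    ring
  have h4 := congrArg (twistIntegral h0 0) h3
  rw [map_add, h1, h2, map_sub, map_smul, ← twistConv_eq h0 0 hb, ← twistConv_eq h0 0 hL,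
    smul_eq_mul, add_zero, sub_eq_zero] at h4
  exact h4.symm

/-! ### Integral operators with Bessel-type kernels -/

/-- A kernel `|w|^ν (w/|w|)^p b₁(w) + |w|^(-ν) (w/|w|)^(-p) b₂(w)`, with `b₁` and `b₂` of temperate
growth, that solves Bessel's equation in the holomorphic variable. -/
structure IsBesselKernel (ν : ℂ) (p : ℤ) (k b₁ b₂ : ℂ → ℂ) : Prop where
  temperate₁ : b₁.HasTemperateGrowth
  temperate₂ : b₂.HasTemperateGrowth
  eq : ∀ w, w ≠ 0 → k w = twist ν p w * b₁ w + twist (-ν) (-p) w * b₂ w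
  ode : ∀ w, w ≠ 0 → twist ν p w * besselOpFun (ν + p + 1) b₁ w +
    twist (-ν) (-p) w * besselOpFun (2 - (ν + p + 1)) b₂ w = -(16 * (Real.pi : ℂ) ^ 2) * k w

/-- This symmetry lets the second component of a test function be treated as the first. -/
theorem IsBesselKernel.swap {ν : ℂ} {p : ℤ} {k b₁ b₂ : ℂ → ℂ} (h : IsBesselKernel ν p k b₁ b₂) :
    IsBesselKernel (-ν) (-p) k b₂ b₁ where
  temperate₁ := h.temperate₂
  temperate₂ := h.temperate₁
  eq w hw := by rw [h.eq w hw, neg_neg, neg_neg, add_comm]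
  ode w hw := by
    rw [← h.ode w hw, neg_neg, neg_neg, add_comm,
      show 2 - (-ν + ((-p : ℤ) : ℂ) + 1) = ν + p + 1 by push_cast; ring,
      show -ν + ((-p : ℤ) : ℂ) + 1 = 2 - (ν + p + 1) by push_cast; ring]

/-- The integral `∫ |z|^ν (z/|z|)^p q(z) k(uz) dz`. -/
def kernelIntegral (ν : ℂ) (p : ℤ) (k : ℂ → ℂ) (q : 𝓢(ℂ, ℂ)) (u : ℂ) : ℂ :=
  ∫ z, twist ν p z * q z * k (u * z)

theorem twist_two_mul (ν : ℂ) (p : ℤ) {z : ℂ} (hz : z ≠ 0) :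
    twist (2 * ν) (2 * p) z = twist ν p z * twist ν p z := by
  rw [two_mul, two_mul, twist_add _ _ _ _ hz]

theorem re_two_mul_gt {ν : ℂ} (hν : |ν.re| < 1) : -2 < (2 * ν).re := by
  have := (abs_lt.1 hν).1
  simp; linarith

theorem re_zero_gt : -2 < (0 : ℂ).re := by simp

section

variable {ν : ℂ} {p : ℤ} {k b₁ b₂ : ℂ → ℂ}

/-- The powers are multiplicative, so their dependence on u comes out of the integral; together with
the power on q they leave the weights of exponent 2ν and 0 in z. -/
theorem IsBesselKernel.integrand_eq (h : IsBesselKernel ν p k b₁ b₂) (q : 𝓢(ℂ, ℂ)) {u z : ℂ}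
    (hu : u ≠ 0) (hz : z ≠ 0) : twist ν p z * q z * k (u * z) =
      twist ν p u * (twist (2 * ν) (2 * p) z * q z * b₁ (u * z)) +
        twist (-ν) (-p) u * (twist 0 0 z * q z * b₂ (u * z)) := by
  rw [h.eq _ (mul_ne_zero hu hz), twist_mul, twist_mul, twist_two_mul _ _ hz, twist_zero_zero hz]
  linear_combination (q z * twist (-ν) (-p) u * b₂ (u * z)) * twist_neg_mul ν p hz

theorem IsBesselKernel.integrable (h : IsBesselKernel ν p k b₁ b₂) (hν : |ν.re| < 1)
    (q : 𝓢(ℂ, ℂ)) {u : ℂ} (hu : u ≠ 0) :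
    Integrable fun z => twist ν p z * q z * k (u * z) := by
  refine (((integrable_twist_mul_mul (re_two_mul_gt hν) (2 * p) h.temperate₁ q u).const_mul
    (twist ν p u)).add ((integrable_twist_mul_mul re_zero_gt 0 h.temperate₂ q u).const_mul
    (twist (-ν) (-p) u))).congr ?_
  filter_upwards [ae_ne_zero] with z hz using (h.integrand_eq q hu hz).symm

theorem IsBesselKernel.integral_eq (h : IsBesselKernel ν p k b₁ b₂) (hν : |ν.re| < 1)
    (q : 𝓢(ℂ, ℂ)) {u : ℂ} (hu : u ≠ 0) : kernelIntegral ν p k q u =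
      twist ν p u * twistConv (2 * ν) (2 * p) b₁ q u +
        twist (-ν) (-p) u * twistConv 0 0 b₂ q u := by
  have i₁ := (integrable_twist_mul_mul (re_two_mul_gt hν) (2 * p) h.temperate₁ q u).const_mul
    (twist ν p u)
  have i₂ := (integrable_twist_mul_mul re_zero_gt 0 h.temperate₂ q u).const_mul
    (twist (-ν) (-p) u)
  rw [kernelIntegral, integral_congr_ae (ae_ne_zero.mono fun z hz => h.integrand_eq q hu hz),
    integral_add i₁ i₂, integral_const_mul, integral_const_mul]
  rfl

theorem IsBesselKernel.integral_add (h : IsBesselKernel ν p k b₁ b₂) (hν : |ν.re| < 1)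
    (q r : 𝓢(ℂ, ℂ)) {u : ℂ} (hu : u ≠ 0) : kernelIntegral ν p k (q + r) u =
      kernelIntegral ν p k q u + kernelIntegral ν p k r u := by
  simp only [h.integral_eq hν _ hu, twistConv_add (re_two_mul_gt hν) _ h.temperate₁,
    twistConv_add re_zero_gt _ h.temperate₂]
  ring

theorem IsBesselKernel.integral_smul (h : IsBesselKernel ν p k b₁ b₂) (hν : |ν.re| < 1)
    (c : ℂ) (q : 𝓢(ℂ, ℂ)) {u : ℂ} (hu : u ≠ 0) : kernelIntegral ν p k (c • q) u =
      c * kernelIntegral ν p k q u := by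
  simp only [h.integral_eq hν _ hu, twistConv_smul (re_two_mul_gt hν) _ h.temperate₁,
    twistConv_smul re_zero_gt _ h.temperate₂]
  ring

/-- The transpose of `∇`, acting on the Schwartz factor of `|z|^ν (z/|z|)^p q(z)`. -/
def eulerOp (ν : ℂ) (p : ℤ) : 𝓢(ℂ, ℂ) →L[ℂ] 𝓢(ℂ, ℂ) :=
  -(((ν + p) / 2 + 1) • ContinuousLinearMap.id ℂ _ + schwartzNabla)

/-- The transpose of `∇̄`, acting on the Schwartz factor of `|z|^ν (z/|z|)^p q(z)`. -/
def eulerBarOp (ν : ℂ) (p : ℤ) : 𝓢(ℂ, ℂ) →L[ℂ] 𝓢(ℂ, ℂ) :=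
  -(((ν - p) / 2 + 1) • ContinuousLinearMap.id ℂ _ + schwartzNablaBar)

theorem eulerOp_apply (q : 𝓢(ℂ, ℂ)) :
    eulerOp ν p q = (-1 : ℂ) • (((ν + p) / 2 + 1) • q + schwartzNabla q) := by
  simp [eulerOp, add_comm]

theorem eulerBarOp_apply (q : 𝓢(ℂ, ℂ)) :
    eulerBarOp ν p q = (-1 : ℂ) • (((ν - p) / 2 + 1) • q + schwartzNablaBar q) := by
  simp [eulerBarOp, add_comm]

/-- The kernel depends on uz alone, so u∂/∂u becomes, by parts in z, an operator on q; the twists in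
front are 1/u and 1/ū. -/
theorem IsBesselKernel.hasWirt (h : IsBesselKernel ν p k b₁ b₂) (hν : |ν.re| < 1)
    (q : 𝓢(ℂ, ℂ)) {u : ℂ} (hu : u ≠ 0) : HasWirt (kernelIntegral ν p k q)
      (twist (-1) (-1) u * kernelIntegral ν p k (eulerOp ν p q) u)
      (twist (-1) 1 u * kernelIntegral ν p k (eulerBarOp ν p q) u) u := by
  have g₁ := re_two_mul_gt hν
  have g₂ := re_zero_gt
  have t₁ := h.temperate₁
  have t₂ := h.temperate₂
  have hcu : starRingEnd ℂ u ≠ 0 := by simpa using hu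
  have h1 := ((hasWirt_twist ν p hu).mul (hasWirt_twistConv g₁ (2 * p) t₁ q u)).add
    ((hasWirt_twist (-ν) (-p) hu).mul (hasWirt_twistConv g₂ 0 t₂ q u))
  have h2 : kernelIntegral ν p k q =ᶠ[nhds u] fun u =>
      twist ν p u * twistConv (2 * ν) (2 * p) b₁ q u +
        twist (-ν) (-p) u * twistConv 0 0 b₂ q u := by
    filter_upwards [isOpen_ne.mem_nhds hu] with v hv using h.integral_eq hν q hv
  have m1 := twist_neg_mul 1 1 hu
  have m2 := twist_neg_mul 1 (-1) hu
  rw [twist_one_one] at m1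
  rw [twist_one_neg_one, neg_neg] at m2
  refine (h1.congr_of_eventuallyEq h2).congr_deriv ?_ ?_
  · have c1 := mul_twistConv_dz g₁ (2 * p) t₁ q u
    have c2 := mul_twistConv_dz g₂ 0 t₂ q u
    rw [h.integral_eq hν _ hu, eulerOp_apply, twistConv_smul g₁ _ t₁, twistConv_smul g₂ _ t₂,
      sub_eq_add_neg, sub_eq_add_neg, twist_add _ _ _ _ hu, sub_eq_add_neg, sub_eq_add_neg,
      twist_add _ _ _ _ hu]
    simp only [twistConv_add g₁ _ t₁, twistConv_smul g₁ _ t₁, twistConv_add g₂ _ t₂,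
      twistConv_smul g₂ _ t₂] at c1 c2 ⊢
    push_cast at c1 c2 ⊢
    linear_combination (-(twist ν p u * twistConv (2 * ν) (2 * p) (dz b₁) (schwartzMulZ q) u +
      twist (-ν) (-p) u * twistConv 0 0 (dz b₂) (schwartzMulZ q) u)) * m1 +
      twist (-1) (-1) u * twist ν p u * c1 + twist (-1) (-1) u * twist (-ν) (-p) u * c2
  · have c1 := mul_twistConv_dzbar g₁ (2 * p) t₁ q u
    have c2 := mul_twistConv_dzbar g₂ 0 t₂ q u
    rw [h.integral_eq hν _ hu, eulerBarOp_apply, twistConv_smul g₁ _ t₁, twistConv_smul g₂ _ t₂,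
      sub_eq_add_neg ν 1, twist_add _ _ _ _ hu, sub_eq_add_neg (-ν) 1, twist_add _ _ _ _ hu]
    simp only [twistConv_add g₁ _ t₁, twistConv_smul g₁ _ t₁, twistConv_add g₂ _ t₂,
      twistConv_smul g₂ _ t₂] at c1 c2 ⊢
    push_cast at c1 c2 ⊢
    linear_combination (-(twist ν p u * twistConv (2 * ν) (2 * p) (dzbar b₁) (schwartzMulZBar q) u +
      twist (-ν) (-p) u * twistConv 0 0 (dzbar b₂) (schwartzMulZBar q) u)) * m2 +
      twist (-1) 1 u * twist ν p u * c1 + twist (-1) 1 u * twist (-ν) (-p) u * c2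

/-- The adjoint form of Bessel's equation. -/
theorem IsBesselKernel.integral_besselOp (h : IsBesselKernel ν p k b₁ b₂) (hν : |ν.re| < 1)
    (q : 𝓢(ℂ, ℂ)) {u : ℂ} (hu : u ≠ 0) :
    kernelIntegral ν p k (besselOp (ν + p + 1) q) u =
      -(16 * (Real.pi : ℂ) ^ 2) * u * kernelIntegral ν p k q u := by
  have g₁ := re_two_mul_gt hν
  have g₂ := re_zero_gt
  have t₁ := temperate_besselOpFun (ν + p + 1) h.temperate₁
  have t₂ := temperate_besselOpFun (2 - (ν + p + 1)) h.temperate₂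
  have e₁ := twistConv_besselOp g₁ (2 * p) h.temperate₁ q u
  have e₂ := twistConv_zero_besselOp g₂ (ν + p + 1) h.temperate₂ q u
  rw [show (2 * ν + ((2 * p : ℤ) : ℂ)) / 2 + 1 = ν + p + 1 by push_cast; ring] at e₁
  have i₁ := (integrable_twist_mul_mul g₁ (2 * p) t₁ q u).const_mul (twist ν p u)
  have i₂ := (integrable_twist_mul_mul g₂ 0 t₂ q u).const_mul (twist (-ν) (-p) u)
  have key : twist ν p u * twistConv (2 * ν) (2 * p) (besselOpFun (ν + p + 1) b₁) q u +
      twist (-ν) (-p) u * twistConv 0 0 (besselOpFun (2 - (ν + p + 1)) b₂) q u =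
      -(16 * (Real.pi : ℂ) ^ 2) * kernelIntegral ν p k q u := by
    rw [twistConv, twistConv, kernelIntegral, ← integral_const_mul, ← integral_const_mul,
      ← integral_const_mul, ← MeasureTheory.integral_add i₁ i₂]
    refine integral_congr_ae (ae_ne_zero.mono fun z hz => ?_)
    have ho := h.ode (u * z) (mul_ne_zero hu hz)
    rw [twist_mul, twist_mul] at ho
    simp only
    rw [twist_two_mul _ _ hz, twist_zero_zero hz]
    linear_combination twist ν p z * q z * ho - q z * twist (-ν) (-p) u *
      besselOpFun (2 - (ν + p + 1)) b₂ (u * z) * twist_neg_mul ν p hz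
  rw [h.integral_eq hν _ hu, e₁, e₂]
  linear_combination u * key

/-! ### Growth and rapid decay of the kernel integral away from the origin. -/

theorem norm_twist_le_of_one_le (hν : |ν.re| < 1) {u : ℂ} (hu : 1 ≤ ‖u‖) :
    ‖twist ν p u‖ ≤ 1 + ‖u‖ := by
  rw [norm_twist _ _ (by rintro rfl; norm_num at hu)]
  calc ‖u‖ ^ ν.re ≤ ‖u‖ ^ (1 : ℝ) :=
        Real.rpow_le_rpow_of_exponent_le hu (abs_lt.1 hν).2.le
    _ ≤ _ := by rw [Real.rpow_one]; linarith

theorem IsBesselKernel.exists_norm_integral_le (h : IsBesselKernel ν p k b₁ b₂)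
    (hν : |ν.re| < 1) : ∃ (n : ℕ) (s : Finset (ℕ × ℕ)) (C : ℝ), 0 ≤ C ∧ ∀ q u, 1 ≤ ‖u‖ →
      ‖kernelIntegral ν p k q u‖ ≤
        C * (1 + ‖u‖) ^ n * s.sup (schwartzSeminormFamily ℂ ℂ ℂ) q := by
  obtain ⟨n₁, s₁, C₁, hC₁, h₁⟩ := exists_twistConv_le (re_two_mul_gt hν) (2 * p) h.temperate₁
  obtain ⟨n₂, s₂, C₂, hC₂, h₂⟩ := exists_twistConv_le re_zero_gt 0 h.temperate₂
  refine ⟨n₁ + n₂ + 1, s₁ ∪ s₂, C₁ + C₂, by positivity, fun q u hu => ?_⟩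
  have hu0 : u ≠ 0 := by rintro rfl; norm_num at hu
  have hν' : |(-ν).re| < 1 := by rwa [neg_re, abs_neg]
  have a := seminorm_sup_mono (Finset.subset_union_left (s₁ := s₁) (s₂ := s₂)) q
  have b := seminorm_sup_mono (Finset.subset_union_right (s₁ := s₁) (s₂ := s₂)) q
  have c₁ := h₁ q u
  have c₂ := h₂ q u
  have d₁ := norm_twist_le_of_one_le (p := p) hν hu
  have d₂ := norm_twist_le_of_one_le (p := -p) hν' hu
  have hone : 1 ≤ 1 + ‖u‖ := by linarith
  have e₁ : (1 + ‖u‖) ^ n₁ ≤ (1 + ‖u‖) ^ (n₁ + n₂) := pow_le_pow_right₀ hone (by omega)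
  have e₂ : (1 + ‖u‖) ^ n₂ ≤ (1 + ‖u‖) ^ (n₁ + n₂) := pow_le_pow_right₀ hone (by omega)
  rw [h.integral_eq hν q hu0]
  set S := (s₁ ∪ s₂).sup (schwartzSeminormFamily ℂ ℂ ℂ) q
  have hS : 0 ≤ S := apply_nonneg _ _
  refine (norm_add_le _ _).trans ?_
  rw [norm_mul, norm_mul]
  calc _ ≤ (1 + ‖u‖) * (C₁ * (1 + ‖u‖) ^ (n₁ + n₂) * S) +
        (1 + ‖u‖) * (C₂ * (1 + ‖u‖) ^ (n₁ + n₂) * S) := by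
        gcongr
        · exact c₁.trans (by gcongr)
        · exact c₂.trans (by gcongr)
    _ = _ := by ring

/-- Each application of `besselOp` multiplies the integral by -16π²u, and 16π² ≥ 1 can be dropped.
-/
theorem IsBesselKernel.pow_mul_norm_integral_le (h : IsBesselKernel ν p k b₁ b₂)
    (hν : |ν.re| < 1) (N : ℕ) (q : 𝓢(ℂ, ℂ)) {u : ℂ} (hu : u ≠ 0) :
    ‖u‖ ^ N * ‖kernelIntegral ν p k q u‖ ≤
      ‖kernelIntegral ν p k ((besselOp (ν + p + 1) ^ N) q) u‖ := by
  induction N generalizing q with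
  | zero => simp
  | succ N ih =>
    have h1 := ih (besselOp (ν + p + 1) q)
    rw [h.integral_besselOp hν q hu, norm_mul, norm_mul, norm_neg, norm_mul, norm_pow, norm_real,
      Real.norm_of_nonneg Real.pi_pos.le] at h1
    have h2 : (1 : ℝ) ≤ ‖(16 : ℂ)‖ * Real.pi ^ 2 := by
      rw [RCLike.norm_ofNat]
      nlinarith [Real.pi_gt_three]
    rw [pow_succ (besselOp (ν + p + 1)), mul_apply_eq_comp]
    refine le_trans ?_ h1
    calc _ = ‖u‖ ^ N * (1 * ‖u‖ * ‖kernelIntegral ν p k q u‖) := by ring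
      _ ≤ _ := by gcongr

/-- Multipliers of temperate growth that vanish near the origin. -/
def outerMultipliers : Set (ℂ → ℂ) :=
  {θ | θ.HasTemperateGrowth ∧ ∀ z, ‖z‖ < 1 → θ z = 0}

theorem outerMultipliers_eventuallyEq {θ : ℂ → ℂ} (hθ : θ ∈ outerMultipliers) {z : ℂ}
    (hz : ‖z‖ < 1) : θ =ᶠ[nhds z] fun _ => 0 := by
  have : {z : ℂ | ‖z‖ < 1} ∈ nhds z := (isOpen_lt continuous_norm continuous_const).mem_nhds hz
  filter_upwards [this] with w hw using hθ.2 w hw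

theorem outerMultipliers_closed : ∀ θ ∈ outerMultipliers, Differentiable ℝ θ ∧
    dz θ ∈ outerMultipliers ∧ dzbar θ ∈ outerMultipliers := by
  intro θ hθ
  have h : ∀ z, ‖z‖ < 1 → HasWirt θ 0 0 z := fun z hz =>
    (hasWirt_const 0 z).congr_of_eventuallyEq (outerMultipliers_eventuallyEq hθ hz)
  exact ⟨hθ.1.differentiable, ⟨hθ.1.dz, fun z hz => (h z hz).dz⟩,
    ⟨hθ.1.dzbar, fun z hz => (h z hz).dzbar⟩⟩

theorem outerMultipliers_eventuallyEq_of_zero : ∀ θ ∈ outerMultipliers,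
    ∀ z ∉ ({0}ᶜ : Set ℂ), θ =ᶠ[nhds z] fun _ => 0 := by
  intro θ hθ z hz
  rw [Set.notMem_compl_iff, Set.mem_singleton_iff] at hz
  exact outerMultipliers_eventuallyEq hθ (by simp [hz])

theorem IsBesselKernel.schwartzBound_outer (h : IsBesselKernel ν p k b₁ b₂) (hν : |ν.re| < 1)
    {θ : ℂ → ℂ} (hθ : θ ∈ outerMultipliers) (lam : ℂ) (m : ℤ) :
    SchwartzBound fun q z => ‖θ z * (twist lam m z * kernelIntegral ν p k q z)‖ := by
  intro n
  obtain ⟨n₁, s, C, hC, h₁⟩ := h.exists_norm_integral_le hν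
  obtain ⟨n₂, C', hC', h₂⟩ := hθ.1.bound
  obtain ⟨n₃, hn₃⟩ := exists_nat_ge lam.re
  -- The powers of ‖z‖ to be absorbed: n from the required decay, n₁ from the growth of the
  -- integral, n₂ from θ, n₃ from the twist.
  set N := n + n₁ + n₂ + n₃
  obtain ⟨t, C'', hC'', h₃⟩ := exists_seminorm_sup_le (besselOp (ν + p + 1) ^ N) s
  refine ⟨t, C' * 2 ^ N * C * C'', by positivity, fun q z => ?_⟩
  beta_reduce
  set S := t.sup (schwartzSeminormFamily ℂ ℂ ℂ) q
  have hS : 0 ≤ S := apply_nonneg _ _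
  rcases lt_or_ge ‖z‖ 1 with hz | hz
  · rw [hθ.2 z hz, zero_mul, norm_zero, mul_zero]
    positivity
  have hz0 : z ≠ 0 := by rintro rfl; norm_num at hz
  have hzp : 0 < ‖z‖ := by linarith
  have htw : ‖twist lam m z‖ ≤ ‖z‖ ^ n₃ := by
    rw [norm_twist _ _ hz0, ← Real.rpow_natCast]
    exact Real.rpow_le_rpow_of_exponent_le hz hn₃
  have h4 := h.pow_mul_norm_integral_le hν N q hz0
  have h5 := (h₁ ((besselOp (ν + p + 1) ^ N) q) z hz).trans
    (mul_le_mul_of_nonneg_left (h₃ q) (by positivity))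
  have h6 : 1 + ‖z‖ ≤ 2 * ‖z‖ := by linarith
  have h7 : 1 ≤ 2 * ‖z‖ := by linarith
  have h8 : ‖z‖ ^ N * ‖kernelIntegral ν p k q z‖ ≤ C * (2 * ‖z‖) ^ n₁ * (C'' * S) := by
    refine h4.trans (h5.trans ?_)
    gcongr
  rw [norm_mul, norm_mul]
  have h9 : ‖z‖ ^ (n₁ + n₂) * (‖z‖ ^ n * (‖z‖ ^ n₃ * ‖kernelIntegral ν p k q z‖)) ≤
      C * (2 * ‖z‖) ^ n₁ * (C'' * S) := by
    refine le_trans (le_of_eq ?_) h8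
    simp only [N, pow_add]; ring
  have h10 : ‖z‖ ^ n * (‖z‖ ^ n₃ * ‖kernelIntegral ν p k q z‖) * ‖z‖ ^ n₂ ≤
      C * 2 ^ n₁ * (C'' * S) := by
    have hpos : 0 < ‖z‖ ^ n₁ := by positivity
    refine le_of_mul_le_mul_left ?_ hpos
    refine le_trans (le_of_eq ?_) (h9.trans (le_of_eq ?_))
    · rw [pow_add]; ring
    · rw [mul_pow]; ring
  calc _ ≤ ‖z‖ ^ n * (C' * (2 * ‖z‖) ^ n₂ * (‖z‖ ^ n₃ * ‖kernelIntegral ν p k q z‖)) := by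
        gcongr
        exact (h₂ z).trans (by gcongr)
    _ = C' * 2 ^ n₂ *
        (‖z‖ ^ n * (‖z‖ ^ n₃ * ‖kernelIntegral ν p k q z‖) * ‖z‖ ^ n₂) := by
        rw [mul_pow]; ring
    _ ≤ C' * 2 ^ n₂ * (C * 2 ^ n₁ * (C'' * S)) := by gcongr
    _ = C' * 2 ^ (n₂ + n₁) * C * C'' * S := by rw [pow_add]; ring
    _ ≤ _ := by
        gcongr
        · norm_num
        · simp only [N]; omega

/-- The operator `q ↦ θ · twist · kernelIntegral q`, for a multiplier `θ` that vanishes near the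
origin, is continuous on Schwartz functions. -/
theorem IsBesselKernel.exists_outer (h : IsBesselKernel ν p k b₁ b₂) (hν : |ν.re| < 1)
    {θ : ℂ → ℂ} (hθ : θ ∈ outerMultipliers) (lam : ℂ) (m : ℤ) :
    ∃ T : 𝓢(ℂ, ℂ) →L[ℂ] 𝓢(ℂ, ℂ), ∀ q z,
      T q z = θ z * (twist lam m z * kernelIntegral ν p k q z) := by
  have hzero : ∀ z, z = 0 → θ z = 0 := by
    rintro z rfl
    exact hθ.2 0 (by simp)
  refine exists_schwartzCLM _ (fun q r z => ?_) (fun c q z => ?_) (fun n => ?_)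
  · by_cases hz : z = 0
    · simp [hzero z hz]
    · rw [h.integral_add hν _ _ hz]; ring
  · by_cases hz : z = 0
    · simp [hzero z hz]
    · rw [h.integral_smul hν _ _ hz]; ring
  -- All exponents are treated at once, because each derivative divides by z or z̄, that is, shifts
  -- (λ, m), while the rest of its effect is an operator on q.
  · have key := iteratedFDeriv_bound_of_family (J := ℂ × ℤ) (Q := 𝓢(ℂ, ℂ)) (U := {0}ᶜ)
      outerMultipliers_closed outerMultipliers_eventuallyEq_of_zero
      (F := fun j q z => twist j.1 j.2 z * kernelIntegral ν p k q z)
      (d := fun j => (j.1 - 1, j.2 - 1)) (d' := fun j => (j.1 - 1, j.2 + 1))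
      (D := fun j q => (((j.1 + j.2) / 2) • ContinuousLinearMap.id ℂ 𝓢(ℂ, ℂ) + eulerOp ν p :
        𝓢(ℂ, ℂ) →L[ℂ] 𝓢(ℂ, ℂ)) q)
      (D' := fun j q => (((j.1 - j.2) / 2) • ContinuousLinearMap.id ℂ 𝓢(ℂ, ℂ) + eulerBarOp ν p :
        𝓢(ℂ, ℂ) →L[ℂ] 𝓢(ℂ, ℂ)) q)
      ?_ (P := SchwartzBound) (fun f g hf hg => hf.add hg) (fun f g hfg hg => hg.mono hfg)
      (fun j f hf => hf.comp _) (fun j f hf => hf.comp _)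
      (fun θ hθ j => h.schwartzBound_outer hν hθ j.1 j.2) n θ hθ (lam, m)
    · exact key
    · intro j q z hz
      have hz : z ≠ 0 := hz
      refine ((hasWirt_twist j.1 j.2 hz).mul (h.hasWirt hν q hz)).congr_deriv ?_ ?_
      · simp only [add_apply, smul_apply, ContinuousLinearMap.id_apply]
        rw [h.integral_add hν _ _ hz, h.integral_smul hν _ _ hz, sub_eq_add_neg, sub_eq_add_neg,
          twist_add _ _ _ _ hz]
        ring
      · simp only [add_apply, smul_apply, ContinuousLinearMap.id_apply]
        rw [h.integral_add hν _ _ hz, h.integral_smul hν _ _ hz, sub_eq_add_neg j.1 1,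
          twist_add _ _ _ _ hz]
        ring

end

/-- The operator `q ↦ θ · twistConv q`, for a Schwartz function `θ`, is continuous on Schwartz
functions. -/
theorem exists_mul_twistConv {lam : ℂ} (hl : -2 < lam.re) (m : ℤ) {b : ℂ → ℂ}
    (hb : b.HasTemperateGrowth) (θ : 𝓢(ℂ, ℂ)) :
    ∃ T : 𝓢(ℂ, ℂ) →L[ℂ] 𝓢(ℂ, ℂ), ∀ q z, T q z = θ z * twistConv lam m b q z := by
  refine exists_schwartzCLM _ (fun q r z => ?_) (fun c q z => ?_) (fun n => ?_)
  · rw [twistConv_add hl m hb, mul_add]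
  · rw [twistConv_smul hl m hb]; ring
  -- The index ranges over all temperate b, since differentiation in u replaces b by its Wirtinger
  -- derivatives.
  · refine iteratedFDeriv_bound_of_family (J := {b : ℂ → ℂ // b.HasTemperateGrowth})
      (Q := 𝓢(ℂ, ℂ)) (Θ := Set.range fun θ : 𝓢(ℂ, ℂ) => (θ : ℂ → ℂ)) (U := Set.univ)
      ?_ (fun _ _ z hz => absurd (Set.mem_univ z) hz)
      (F := fun b q z => twistConv lam m b.1 q z)
      (d := fun b => ⟨dz b.1, b.2.dz⟩) (d' := fun b => ⟨dzbar b.1, b.2.dzbar⟩)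
      (D := fun _ q => schwartzMulZ q) (D' := fun _ q => schwartzMulZBar q)
      (fun b q z _ => hasWirt_twistConv hl m b.2 q z)
      (P := SchwartzBound) (fun f g hf hg => hf.add hg) (fun f g hfg hg => hg.mono hfg)
      (fun j f hf => hf.comp _) (fun j f hf => hf.comp _) ?_ n θ ⟨θ, rfl⟩ ⟨b, hb⟩
    · rintro _ ⟨θ, rfl⟩
      exact ⟨θ.differentiable, ⟨schwartzDz θ, funext (schwartzDz_apply θ)⟩,
        ⟨schwartzDzbar θ, funext (schwartzDzbar_apply θ)⟩⟩
    · rintro _ ⟨θ, rfl⟩ ⟨b, hb⟩ j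
      obtain ⟨n, s, C, hC, h⟩ := exists_twistConv_le hl m hb
      set M := 2 ^ (j + n) * (Finset.Iic (j + n, 0)).sup (schwartzSeminormFamily ℂ ℂ ℂ) θ
      refine ⟨s, M * C, mul_nonneg (mul_nonneg (by positivity) (apply_nonneg _ _)) hC,
        fun q z => ?_⟩
      beta_reduce
      have h1 : (1 + ‖z‖) ^ (j + n) * ‖θ z‖ ≤ M := by
        have := SchwartzMap.one_add_le_sup_seminorm_apply (𝕜 := ℂ) (m := (j + n, 0)) le_rfl le_rfl
          θ z
        rwa [norm_iteratedFDeriv_zero] at this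
      set S := s.sup (schwartzSeminormFamily ℂ ℂ ℂ) q
      have hS : 0 ≤ S := apply_nonneg _ _
      rw [norm_mul]
      calc _ ≤ (1 + ‖z‖) ^ j * (‖θ z‖ * (C * (1 + ‖z‖) ^ n * S)) := by
            gcongr
            · linarith
            · exact h q z
        _ = ((1 + ‖z‖) ^ (j + n) * ‖θ z‖) * (C * S) := by rw [pow_add]; ring
        _ ≤ M * (C * S) := by gcongr
        _ = _ := by ring

/-! ### Gluing the descriptions near the origin and at infinity. -/

theorem exists_cutoff : ∃ θ : 𝓢(ℂ, ℂ), HasCompactSupport θ ∧ ∀ z, ‖z‖ ≤ 1 → θ z = 1 := by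
  let f : ContDiffBump (0 : ℂ) := ⟨1, 2, one_pos, one_lt_two⟩
  have h1 : ContDiff ℝ ((⊤ : ℕ∞) : WithTop ℕ∞) fun z => (f z : ℂ) :=
    ofRealCLM.contDiff.comp f.contDiff
  have h2 : HasCompactSupport fun z => (f z : ℂ) :=
    f.hasCompactSupport.comp_left (g := fun x : ℝ => (x : ℂ)) ofReal_zero
  refine ⟨h2.toSchwartzMap h1, h2, fun z hz => ?_⟩
  have : f z = 1 := f.one_of_mem_closedBall (by simpa using hz)
  change (f z : ℂ) = 1
  rw [this, ofReal_one]

theorem one_sub_mem_outerMultipliers {θ : 𝓢(ℂ, ℂ)} (hθ : ∀ z, ‖z‖ ≤ 1 → θ z = 1) :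
    (fun z => 1 - θ z) ∈ outerMultipliers :=
  ⟨(Function.HasTemperateGrowth.const 1).sub θ.hasTemperateGrowth,
    fun z hz => by simp [hθ z hz.le]⟩

/-- The integral operator lifts to continuous operators on Schwartz functions. -/
theorem IsBesselKernel.exists_lift {ν : ℂ} {p : ℤ} {k b₁ b₂ : ℂ → ℂ}
    (h : IsBesselKernel ν p k b₁ b₂) (hν : |ν.re| < 1) :
    ∃ T₁ T₂ : 𝓢(ℂ, ℂ) →L[ℂ] 𝓢(ℂ, ℂ), ∀ q u, u ≠ 0 → kernelIntegral ν p k q u =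
      twist ν p u * T₁ q u + twist (-ν) (-p) u * T₂ q u := by
  obtain ⟨θ, -, hθ⟩ := exists_cutoff
  obtain ⟨S₁, h₁⟩ := exists_mul_twistConv (re_two_mul_gt hν) (2 * p) h.temperate₁ θ
  obtain ⟨S₂, h₂⟩ := exists_mul_twistConv re_zero_gt 0 h.temperate₂ θ
  obtain ⟨S₃, h₃⟩ := h.exists_outer hν (one_sub_mem_outerMultipliers hθ) ν p
  -- Near the origin θ keeps both powers. The rest, 1 - θ times the integral, is Schwartz even after
  -- multiplication by |u|^ν (u/|u|)^p; it is put entirely into the second component, whose twist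
  -- undoes that factor.
  refine ⟨S₁, S₂ + S₃, fun q u hu => ?_⟩
  rw [add_apply, add_apply, h₁, h₂, h₃]
  linear_combination (-(1 - θ u) * kernelIntegral ν p k q u) * twist_neg_mul ν p hu +
    θ u * h.integral_eq hν q hu

/-! ### The Bessel kernel -/

/-- The function `w ↦ S_μ(w) S_μ'(w̄)`, where `S_μ` is `besselEntire μ`. -/
def besselPair (μ μ' w : ℂ) : ℂ := besselEntire μ w * besselEntire μ' (starRingEnd ℂ w)

theorem hasWirt_besselPair (μ μ' w : ℂ) :
    HasWirt (besselPair μ μ') (-besselPair (μ + 1) μ' w) (-besselPair μ (μ' + 1) w) w :=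
  ((HasDerivAt.hasWirt (hasDerivAt_besselEntire μ w)).mul
    (HasDerivAt.hasWirt (hasDerivAt_besselEntire μ' (starRingEnd ℂ w))).comp_conj).congr_deriv
    (by rw [besselPair]; ring) (by rw [besselPair]; ring)

theorem besselPair_sub_one (μ μ' w : ℂ) :
    besselPair (μ - 1) μ' w = μ * besselPair μ μ' w - w * besselPair (μ + 1) μ' w := by
  rw [besselPair, besselEntire_sub_one, besselPair, besselPair]; ring

theorem besselPair_sub_one_right (μ μ' w : ℂ) : besselPair μ (μ' - 1) w =
    μ' * besselPair μ μ' w - starRingEnd ℂ w * besselPair μ (μ' + 1) w := by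
  rw [besselPair, besselEntire_sub_one, besselPair, besselPair]; ring

theorem contDiff_besselPair (μ μ' : ℂ) {n : WithTop ℕ∞} : ContDiff ℝ n (besselPair μ μ') := by
  have h : ∀ μ, ContDiff ℝ n (besselEntire μ) := fun μ =>
    (differentiable_besselEntire μ).contDiff.restrict_scalars ℝ
  exact (h μ).mul ((h μ').comp conjCLE.contDiff)

theorem besselProd_eq (ν : ℂ) (m n : ℤ) (w : ℂ) :
    besselProd ν m n w = besselPair (-(ν + m)) (-(ν + n)) w +
      (-(-1) ^ (m + n)) * (twist (2 * ν + m + n) (m - n) w * besselPair (ν + m) (ν + n) w) := by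
  rw [besselProd, besselPair, besselPair]; ring

/-- Differentiation raises the order of the bare series with a minus sign and lowers that of w^μ
times the series without one. Both change m (or n) to one less, and the discrepancy of sign is that
of (-1)^(m+n). -/
theorem hasWirt_besselProd (ν : ℂ) (m n : ℤ) {w : ℂ} (hw : w ≠ 0) :
    HasWirt (besselProd ν m n) (-besselProd ν (m - 1) n w) (-besselProd ν m (n - 1) w) w := by
  have h1 : (-1 : ℂ) ^ (m - 1 + n) = -(-1) ^ (m + n) := by
    rw [show m - 1 + n = m + n - 1 by ring, zpow_sub_one₀ (by norm_num)]; norm_num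
  have h2 : (-1 : ℂ) ^ (m + (n - 1)) = -(-1) ^ (m + n) := by
    rw [show m + (n - 1) = m + n - 1 by ring, zpow_sub_one₀ (by norm_num)]; norm_num
  have h3 : twist (2 * ν + m + n) (m - n) w =
      w * twist (2 * ν + m + n - 1) (m - n - 1) w := by
    conv_rhs => enter [1]; rw [← twist_one_one w]
    rw [← twist_add _ _ _ _ hw]
    congr 1 <;> ring
  have h4 : twist (2 * ν + m + n) (m - n) w =
      starRingEnd ℂ w * twist (2 * ν + m + n - 1) (m - n + 1) w := by
    conv_rhs => enter [1]; rw [← twist_one_neg_one w]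
    rw [← twist_add _ _ _ _ hw]
    congr 1 <;> ring
  have key := (hasWirt_besselPair (-(ν + m)) (-(ν + n)) w).add
    (((hasWirt_twist (2 * ν + m + n) (m - n) hw).mul
      (hasWirt_besselPair (ν + m) (ν + n) w)).const_mul (-(-1) ^ (m + n)))
  rw [show besselProd ν m n = _ from funext (besselProd_eq ν m n)]
  refine key.congr_deriv ?_ ?_
  · rw [besselProd_eq, h1]
    push_cast
    rw [show -(ν + (m - 1 : ℂ)) = -(ν + m) + 1 by ring,
      show ν + ((m : ℂ) - 1) = ν + m - 1 by ring, besselPair_sub_one,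
      show 2 * ν + ((m : ℂ) - 1) + n = 2 * ν + m + n - 1 by ring,
      show m - 1 - n = m - n - 1 by ring, h3]
    ring
  · rw [besselProd_eq, h2]
    push_cast
    rw [show -(ν + (n - 1 : ℂ)) = -(ν + n) + 1 by ring,
      show ν + ((n : ℂ) - 1) = ν + n - 1 by ring, besselPair_sub_one_right,
      show 2 * ν + (m : ℂ) + (n - 1) = 2 * ν + m + n - 1 by ring,
      show m - (n - 1) = m - n + 1 by ring, h4]
    ring

/-- The family of all `besselProd` is closed under Wirtinger derivatives, so pointwise bounds for
every (m, n) yield polynomial bounds for all derivatives. The scalar in the index records the signs.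
-/
theorem temperate_outer_mul_besselProd {ν : ℂ} (hν : ∀ n : ℤ, ν ≠ n) (m n : ℤ) {θ : ℂ → ℂ}
    (hθ : θ ∈ outerMultipliers) : (fun w => θ w * besselProd ν m n w).HasTemperateGrowth := by
  have key := fun N => iteratedFDeriv_bound_of_family (J := ℂ × ℤ × ℤ) (Q := Unit) (U := {0}ᶜ)
      outerMultipliers_closed outerMultipliers_eventuallyEq_of_zero
      (F := fun j _ w => j.1 * besselProd ν j.2.1 j.2.2 w)
      (d := fun j => (-j.1, j.2.1 - 1, j.2.2)) (d' := fun j => (-j.1, j.2.1, j.2.2 - 1))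
      (D := fun _ => id) (D' := fun _ => id) ?_
      (P := fun g => ∃ (C : ℝ) (k : ℕ), 0 ≤ C ∧ ∀ q z, g q z ≤ C * (1 + ‖z‖) ^ k)
      ?_ ?_ (fun _ _ h => h) (fun _ _ h => h) ?_ N θ hθ (1, m, n)
  · constructor
    · rw [contDiff_infty]
      intro N
      simpa using (key N).1 ()
    · intro N
      obtain ⟨C, k, -, h⟩ := (key N).2
      exact ⟨k, C, fun z => by simpa using h () z⟩
  · rintro ⟨c, m, n⟩ _ z hz
    have hz : z ≠ 0 := hz
    exact ((hasWirt_besselProd ν m n hz).const_mul c).congr_deriv (by simp) (by simp)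
  · rintro f g ⟨C, k, hC, hf⟩ ⟨C', k', hC', hg⟩
    refine ⟨C + C', k + k', by positivity, fun q z => ?_⟩
    have h1 : 1 ≤ 1 + ‖z‖ := by linarith [norm_nonneg z]
    rw [add_mul]
    refine add_le_add ((hf q z).trans ?_) ((hg q z).trans ?_)
    · exact mul_le_mul_of_nonneg_left (pow_le_pow_right₀ h1 (by omega)) ‹_›
    · exact mul_le_mul_of_nonneg_left (pow_le_pow_right₀ h1 (by omega)) ‹_›
  · rintro f g hfg ⟨C, k, hC, hg⟩
    exact ⟨C, k, hC, fun q z => (hfg q z).trans (hg q z)⟩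
  · rintro θ hθ ⟨c, m, n⟩
    obtain ⟨C, hC, N, h⟩ := norm_besselProd_le ν hν m n
    obtain ⟨k, C', hC', h'⟩ := hθ.1.bound
    refine ⟨C' * (‖c‖ * C), k + N, by positivity, fun _ z => ?_⟩
    beta_reduce
    rcases lt_or_ge ‖z‖ 1 with hz | hz
    · rw [hθ.2 z hz, zero_mul, norm_zero]
      positivity
    rw [norm_mul, norm_mul]
    calc _ ≤ (C' * (1 + ‖z‖) ^ k) * (‖c‖ * (C * (1 + ‖z‖) ^ N)) := by
          gcongr
          · exact h' z
          · exact (h z hz).trans (by gcongr; linarith)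
      _ = _ := by rw [pow_add]; ring

theorem temperate_cutoff_mul_besselPair {θ : 𝓢(ℂ, ℂ)} (hθ : HasCompactSupport θ) (μ μ' : ℂ) :
    (fun w => θ w * besselPair μ μ' w).HasTemperateGrowth := by
  have h1 : HasCompactSupport fun w => θ w * besselPair μ μ' w := hθ.mul_right
  have h2 : ContDiff ℝ ((⊤ : ℕ∞) : WithTop ℕ∞) fun w => θ w * besselPair μ μ' w :=
    (θ.smooth _).mul (contDiff_besselPair μ μ')
  exact (h1.toSchwartzMap h2).hasTemperateGrowth

theorem nablaFun_congr {f g : ℂ → ℂ} (h : ∀ z, z ≠ 0 → f z = g z) {z : ℂ} (hz : z ≠ 0) :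
    nablaFun f z = nablaFun g z := by
  have : f =ᶠ[nhds z] g := by
    filter_upwards [isOpen_ne.mem_nhds hz] with w hw using h w hw
  rw [nablaFun, nablaFun, this.fderiv_eq]

theorem nablaFun_twist_add (ν : ℂ) (p : ℤ) {f g : ℂ → ℂ} (hf : Differentiable ℝ f)
    (hg : Differentiable ℝ g) {z : ℂ} (hz : z ≠ 0) :
    nablaFun (fun z => twist ν p z * f z + twist (-ν) (-p) z * g z) z =
      twist ν p z * ((ν + p) / 2 * f z + z * dz f z) +
        twist (-ν) (-p) z * (-((ν + p) / 2) * g z + z * dz g z) := by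
  have h := ((hasWirt_twist ν p hz).mul (hf z).hasWirt).add
    ((hasWirt_twist (-ν) (-p) hz).mul (hg z).hasWirt)
  have h1 : ∀ (ν : ℂ) (p : ℤ), z * twist (ν - 1) (p - 1) z = twist ν p z := by
    intro ν p
    conv_lhs => enter [1]; rw [← twist_one_one z]
    rw [← twist_add _ _ _ _ hz]
    congr 1 <;> ring
  rw [nablaFun_eq, h.dz, ← h1 ν p, ← h1 (-ν) (-p)]
  push_cast
  ring

/-- Conjugating 4∇² - (ν+p)² by either power removes its constant term, leaving z times an operator
with polynomial coefficients on the regular factor. -/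
theorem four_nablaFun_nablaFun_twist_add (ν : ℂ) (p : ℤ) {f g : ℂ → ℂ} (hf : Differentiable ℝ f)
    (hg : Differentiable ℝ g) (hf' : Differentiable ℝ (dz f)) (hg' : Differentiable ℝ (dz g))
    {z : ℂ} (hz : z ≠ 0) :
    4 * nablaFun (nablaFun fun z => twist ν p z * f z + twist (-ν) (-p) z * g z) z -
      (ν + p) ^ 2 * (twist ν p z * f z + twist (-ν) (-p) z * g z) =
      z * (twist ν p z * besselOpFun (ν + p + 1) f z +
        twist (-ν) (-p) z * besselOpFun (2 - (ν + p + 1)) g z) := by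
  have key : ∀ (c : ℂ) {f : ℂ → ℂ}, Differentiable ℝ f → Differentiable ℝ (dz f) → ∀ z,
      HasWirt (fun z => c * f z + z * dz f z) (c * dz f z + (1 * dz f z + z * dz (dz f) z))
        (c * dzbar f z + (0 * dz f z + z * dzbar (dz f) z)) z := fun c f hf hf' z =>
    ((hf z).hasWirt.const_mul c).add ((hasWirt_id z).mul (hf' z).hasWirt)
  rw [nablaFun_congr (fun z hz => nablaFun_twist_add ν p hf hg hz) hz,
    nablaFun_twist_add ν p (fun z => (key _ hf hf' z).differentiableAt)
      (fun z => (key _ hg hg' z).differentiableAt) hz, (key _ hf hf' z).dz, (key _ hg hg' z).dz,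
    besselOpFun, besselOpFun]
  ring

theorem besselOpFun_besselPair (c a μ μ' w : ℂ) :
    besselOpFun (μ + 1) (fun w => c * besselPair μ μ' (a * w)) w =
      -(4 * a) * (c * besselPair μ μ' (a * w)) := by
  have h1 : ∀ μ w, HasWirt (fun w => besselPair μ μ' (a * w)) (-(a * besselPair (μ + 1) μ' (a * w)))
      (starRingEnd ℂ a * -besselPair μ (μ' + 1) (a * w)) w := fun μ w =>
    (hasWirt_besselPair μ μ' (a * w)).comp_mul_left.congr_deriv (by ring) rfl
  have h2 : dz (fun w => c * besselPair μ μ' (a * w)) =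
      fun w => -(c * a) * besselPair (μ + 1) μ' (a * w) := by
    ext w
    rw [((h1 μ w).const_mul c).dz]; ring
  have h3 := besselPair_sub_one (μ + 1) μ' (a * w)
  rw [add_sub_cancel_right] at h3
  rw [besselOpFun, h2, ((h1 (μ + 1) w).const_mul _).dz, h3]
  ring

/-- The kernel `w ↦ B_{ν,p}(√w)` of the Hankel transform. -/
def besselKernel (ν : ℂ) (p : ℤ) (w : ℂ) : ℂ := besselB ν p (w ^ (1 / 2 : ℂ))

theorem besselJC_eq_twist (ν : ℂ) (p : ℤ) {z : ℂ} (hz : z ≠ 0) :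
    besselJC ν p z = twist ν p (z ^ 2 / 4) * besselPair (ν + p) (ν - p) (z ^ 2 / 4) := by
  have hz2 : z / 2 ≠ 0 := div_ne_zero hz two_ne_zero
  have hn := ofReal_norm_ne_zero hz2
  have h1 : z / (‖z‖ : ℂ) = z / 2 / ((‖z / 2‖ : ℝ) : ℂ) := by
    rw [norm_div]; push_cast; simp; field_simp
  rw [besselJC, besselSeries_eq, besselSeries_eq, besselPair, map_div₀, map_pow,
    Complex.conj_ofNat, show z ^ 2 / 4 = z / 2 * (z / 2) by ring, twist_mul, twist_of_ne _ _ hz2,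
    ← h1, two_mul ν, cpow_add _ _ hn, two_mul p, zpow_add₀ (div_ne_zero hz (ofReal_norm_ne_zero hz))]
  ring

theorem besselKernel_eq (ν : ℂ) (p : ℤ) {w : ℂ} (hw : w ≠ 0) :
    besselKernel ν p w = 1 / Complex.sin (Real.pi * ν) *
      (twist (-ν) (-p) (4 * Real.pi ^ 2 * w) *
          besselPair (-(ν + p)) (-(ν - p)) (4 * Real.pi ^ 2 * w) -
        twist ν p (4 * Real.pi ^ 2 * w) * besselPair (ν + p) (ν - p) (4 * Real.pi ^ 2 * w)) := by
  have hpi : (Real.pi : ℂ) ≠ 0 := ofReal_ne_zero.2 Real.pi_ne_zero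
  have h1 : (w ^ (1 / 2 : ℂ)) ^ 2 = w := by
    rw [one_div]; exact_mod_cast cpow_nat_inv_pow w two_ne_zero
  have h2 : w ^ (1 / 2 : ℂ) ≠ 0 := by
    intro h; rw [h] at h1; exact hw (by rw [← h1]; ring)
  have h3 : 4 * Real.pi * w ^ (1 / 2 : ℂ) ≠ 0 := mul_ne_zero (mul_ne_zero (by norm_num) hpi) h2
  have h4 : (4 * Real.pi * w ^ (1 / 2 : ℂ)) ^ 2 / 4 = 4 * Real.pi ^ 2 * w := by
    rw [mul_pow, h1]; ring
  rw [besselKernel, besselB, besselJC_eq_twist _ _ h3, besselJC_eq_twist _ _ h3, h4]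
  congr 5 <;> push_cast <;> ring

theorem exists_isBesselKernel {ν : ℂ} (hν : ∀ n : ℤ, ν ≠ n) (p : ℤ) :
    ∃ b₁ b₂ : ℂ → ℂ, IsBesselKernel ν p (besselKernel ν p) b₁ b₂ := by
  obtain ⟨θ, hc, hθ⟩ := exists_cutoff
  obtain ⟨a, ha⟩ : ∃ a : ℂ, a = 4 * Real.pi ^ 2 := ⟨_, rfl⟩
  obtain ⟨s, hs⟩ : ∃ s : ℂ, s = 1 / Complex.sin (Real.pi * ν) := ⟨_, rfl⟩
  have ha0 : a ≠ 0 := by simp [ha, Real.pi_ne_zero]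
  let α : ℂ := -(s * twist ν p a)
  let β : ℂ := s * twist (-ν) (-p) a
  let s₁ : ℂ → ℂ := fun w => α * besselPair (ν + p) (ν - p) (a * w)
  let s₂ : ℂ → ℂ := fun w => β * besselPair (-(ν + p)) (-(ν - p)) (a * w)
  -- The separate series are kept only where θ ≠ 0; where θ = 0 the whole kernel sits in b₂ as
  -- `besselProd`, the combination whose exponential growth cancels.
  let b₁ : ℂ → ℂ := fun w => α * (θ (a * w) * besselPair (ν + p) (ν - p) (a * w))
  let b₂ : ℂ → ℂ := fun w => β * (θ (a * w) * besselPair (-(ν + p)) (-(ν - p)) (a * w)) +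
    β * ((1 - θ (a * w)) * besselProd ν p (-p) (a * w))
  have hb₁ : b₁.HasTemperateGrowth := (Function.HasTemperateGrowth.const α).mul
    ((temperate_cutoff_mul_besselPair hc _ _).comp_mul_left a)
  have hb₂ : b₂.HasTemperateGrowth :=
    ((Function.HasTemperateGrowth.const β).mul
      ((temperate_cutoff_mul_besselPair hc _ _).comp_mul_left a)).add
    ((Function.HasTemperateGrowth.const β).mul ((temperate_outer_mul_besselProd hν p (-p)
      (one_sub_mem_outerMultipliers hθ)).comp_mul_left a))
  have hk : ∀ w, w ≠ 0 → besselKernel ν p w = twist ν p w * s₁ w + twist (-ν) (-p) w * s₂ w := by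
    intro w hw
    rw [besselKernel_eq ν p hw, ← ha, ← hs, twist_mul, twist_mul]
    simp only [s₁, s₂, α, β]
    ring
  have hb : ∀ w, w ≠ 0 → besselKernel ν p w = twist ν p w * b₁ w + twist (-ν) (-p) w * b₂ w := by
    intro w hw
    have h1 : twist (2 * ν + p + (-p : ℤ)) (p - -p) (a * w) =
        twist ν p (a * w) * twist ν p (a * w) := by
      rw [← twist_add _ _ _ _ (mul_ne_zero ha0 hw)]
      congr 1
      · push_cast; ring
      · ring
    have h2 := twist_neg_mul ν p (mul_ne_zero ha0 hw)
    have h3 : besselProd ν p (-p) (a * w) = besselPair (-(ν + p)) (-(ν - p)) (a * w) -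
        twist ν p (a * w) * twist ν p (a * w) * besselPair (ν + p) (ν - p) (a * w) := by
      rw [besselProd_eq, h1, add_neg_cancel, zpow_zero]
      push_cast
      rw [← sub_eq_add_neg ν]
      ring
    rw [hk w hw]
    rw [twist_mul ν p a w] at h2 h3
    rw [twist_mul (-ν) (-p) a w] at h2
    simp only [s₁, s₂, b₁, b₂, α, β, h3]
    linear_combination (1 - θ (a * w)) * s * twist ν p a * twist ν p w *
      besselPair (ν + p) (ν - p) (a * w) * h2
  have hsd : ∀ c μ μ' : ℂ, Differentiable ℝ (fun w => c * besselPair μ μ' (a * w)) ∧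
      Differentiable ℝ (dz fun w => c * besselPair μ μ' (a * w)) := by
    intro c μ μ'
    have h1 : ∀ c μ w, HasWirt (fun w => c * besselPair μ μ' (a * w))
        (c * (a * -besselPair (μ + 1) μ' (a * w)))
        (c * (starRingEnd ℂ a * -besselPair μ (μ' + 1) (a * w))) w := fun c μ w =>
      (hasWirt_besselPair μ μ' (a * w)).comp_mul_left.const_mul c
    refine ⟨fun w => (h1 c μ w).differentiableAt, ?_⟩
    have h2 : dz (fun w => c * besselPair μ μ' (a * w)) =
        fun w => -(c * a) * besselPair (μ + 1) μ' (a * w) := by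
      ext w
      rw [(h1 c μ w).dz]; ring
    rw [h2]
    exact fun w => (h1 _ _ w).differentiableAt
  refine ⟨b₁, b₂, hb₁, hb₂, hb, fun w hw => ?_⟩
  -- The cutoff prevents reading the equation off b₁ and b₂ separately. The decompositions (b₁, b₂)
  -- and (s₁, s₂) give the same function, so ∇² of it can be computed with the series s₁, s₂, for
  -- which each summand solves its own equation.
  have e₁ := four_nablaFun_nablaFun_twist_add ν p hb₁.differentiable hb₂.differentiable
    hb₁.dz.differentiable hb₂.dz.differentiable hw
  have e₂ := four_nablaFun_nablaFun_twist_add ν p (hsd α (ν + p) (ν - p)).1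
    (hsd β (-(ν + p)) (-(ν - p))).1 (hsd α (ν + p) (ν - p)).2 (hsd β (-(ν + p)) (-(ν - p))).2 hw
  have e₃ : nablaFun (nablaFun fun z => twist ν p z * b₁ z + twist (-ν) (-p) z * b₂ z) w =
      nablaFun (nablaFun fun z => twist ν p z * s₁ z + twist (-ν) (-p) z * s₂ z) w :=
    nablaFun_congr (fun z hz => nablaFun_congr (fun z hz => by rw [← hb z hz, hk z hz]) hz) hw
  rw [besselOpFun_besselPair, show 2 - (ν + p + 1) = -(ν + p) + 1 by ring,
    besselOpFun_besselPair] at e₂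
  have e₄ := hk w hw
  rw [← hb w hw, e₃] at e₁
  refine mul_left_cancel₀ hw (e₁.symm.trans ?_)
  simp only [s₁, s₂] at e₄ ⊢
  linear_combination e₂ + (16 * Real.pi ^ 2 * w - (ν + p) ^ 2) * e₄ - 4 * w * (twist ν p w *
    (α * besselPair (ν + p) (ν - p) (a * w)) + twist (-ν) (-p) w *
    (β * besselPair (-(ν + p)) (-(ν - p)) (a * w))) * ha

/-! ### Bessel's equation in both variables -/

/-- With α = (ν+p)/2, `besselOp` is z^(-1)(4(∇+α)² - 4α²), and moving ∇ + α past multiplication by z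
gives ∇ + α + 1 = -`eulerOp`. -/
theorem besselOp_schwartzMulZ (ν : ℂ) (p : ℤ) (q : 𝓢(ℂ, ℂ)) :
    besselOp (ν + p + 1) (schwartzMulZ q) =
      (4 : ℂ) • eulerOp ν p (eulerOp ν p q) + (-(ν + p) ^ 2) • q := by
  have h1 : ∀ q z, HasWirt (schwartzMulZ q) (q z + z * schwartzDz q z) (z * dzbar q z) z := by
    intro q z
    rw [show (schwartzMulZ q : ℂ → ℂ) = fun z => z * q z from funext (schwartzMulZ_apply q)]
    exact ((hasWirt_id z).mul (q.differentiableAt (x := z)).hasWirt).congr_deriv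
      (by rw [schwartzDz_apply]; ring) (by ring)
  have h2 : ∀ q, schwartzDz (schwartzMulZ q) = q + schwartzMulZ (schwartzDz q) := by
    intro q
    ext z
    rw [schwartzDz_apply, (h1 q z).dz, add_apply, schwartzMulZ_apply]
  have h3 : ∀ q, schwartzNabla q = schwartzMulZ (schwartzDz q) := by
    intro q
    ext z
    rw [schwartzNabla_eq, schwartzMulZ_apply]
  ext z
  rw [besselOp_apply, h2]
  simp only [eulerOp_apply, add_apply, smul_apply, smul_eq_mul, map_add, map_smul, h2, h3,
    schwartzMulZ_apply]
  ring

theorem IsBesselKernel.integral_eulerOp_sq {ν : ℂ} {p : ℤ} {k b₁ b₂ : ℂ → ℂ}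
    (h : IsBesselKernel ν p k b₁ b₂) (hν : |ν.re| < 1) (q : 𝓢(ℂ, ℂ)) {u : ℂ} (hu : u ≠ 0) :
    4 * kernelIntegral ν p k (eulerOp ν p (eulerOp ν p q)) u =
      (ν + p) ^ 2 * kernelIntegral ν p k q u -
        16 * Real.pi ^ 2 * (u * kernelIntegral ν p k (schwartzMulZ q) u) := by
  have h1 := h.integral_besselOp hν (schwartzMulZ q) hu
  rw [besselOp_schwartzMulZ, h.integral_add hν _ _ hu, h.integral_smul hν _ _ hu,
    h.integral_smul hν _ _ hu] at h1
  linear_combination h1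

/-- The operator `q ↦ q(z̄)` on Schwartz functions. -/
def schwartzConj : 𝓢(ℂ, ℂ) →L[ℂ] 𝓢(ℂ, ℂ) := SchwartzMap.compCLMOfContinuousLinearEquiv ℂ conjCLE

theorem schwartzConj_apply (q : 𝓢(ℂ, ℂ)) (z : ℂ) : schwartzConj q z = q (starRingEnd ℂ z) := rfl

theorem schwartzConj_mulZBar (q : 𝓢(ℂ, ℂ)) :
    schwartzConj (schwartzMulZBar q) = schwartzMulZ (schwartzConj q) := by
  ext z
  rw [schwartzConj_apply, schwartzMulZBar_apply, schwartzMulZ_apply, schwartzConj_apply, conj_conj]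

theorem schwartzConj_eulerBarOp (ν : ℂ) (p : ℤ) (q : 𝓢(ℂ, ℂ)) :
    schwartzConj (eulerBarOp ν p q) = eulerOp ν (-p) (schwartzConj q) := by
  ext z
  have h1 : dz (schwartzConj q) z = dzbar q (starRingEnd ℂ z) :=
    ((q.differentiableAt (x := starRingEnd ℂ z)).hasWirt.comp_conj).dz
  rw [schwartzConj_apply, eulerBarOp_apply, eulerOp_apply, smul_apply, smul_apply, add_apply,
    add_apply, smul_apply, smul_apply, schwartzNabla_apply, schwartzNablaBar_apply, nablaFun_eq,
    nablaBarFun_eq, h1, conj_conj, schwartzConj_apply, Int.cast_neg, ← sub_eq_add_neg]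

theorem kernelIntegral_conj {k k' : ℂ → ℂ} (hk : ∀ w, w ≠ 0 → k (starRingEnd ℂ w) = k' w)
    (ν : ℂ) (p : ℤ) (q : 𝓢(ℂ, ℂ)) {u : ℂ} (hu : u ≠ 0) :
    kernelIntegral ν p k q (starRingEnd ℂ u) = kernelIntegral ν (-p) k' (schwartzConj q) u := by
  rw [kernelIntegral, kernelIntegral, ← conjLIE.measurePreserving.integral_comp
    conjLIE.toHomeomorph.measurableEmbedding]
  refine integral_congr_ae (ae_ne_zero.mono fun z hz => ?_)
  simp only [conjLIE_apply, twist_conj, ← map_mul, hk _ (mul_ne_zero hu hz), schwartzConj_apply]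

/-- The substitution z ↦ z̄ exchanges the barred and unbarred operators and p with -p, so only the
holomorphic Bessel equation is needed. -/
theorem integral_eulerBarOp_sq {ν : ℂ} {p : ℤ} {k k' b₁ b₂ : ℂ → ℂ}
    (h : IsBesselKernel ν (-p) k' b₁ b₂) (hk : ∀ w, w ≠ 0 → k (starRingEnd ℂ w) = k' w)
    (hν : |ν.re| < 1) (q : 𝓢(ℂ, ℂ)) {u : ℂ} (hu : u ≠ 0) :
    4 * kernelIntegral ν p k (eulerBarOp ν p (eulerBarOp ν p q)) u =
      (ν - p) ^ 2 * kernelIntegral ν p k q u -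
        16 * Real.pi ^ 2 * (starRingEnd ℂ u * kernelIntegral ν p k (schwartzMulZBar q) u) := by
  have hcu : starRingEnd ℂ u ≠ 0 := by simpa using hu
  have h1 := h.integral_eulerOp_sq hν (schwartzConj q) hcu
  simp only [← schwartzConj_eulerBarOp, ← schwartzConj_mulZBar, ← kernelIntegral_conj hk _ _ _ hcu,
    conj_conj, Int.cast_neg, ← sub_eq_add_neg] at h1
  exact h1

theorem besselKernel_conj (ν : ℂ) (p : ℤ) {w : ℂ} (hw : w ≠ 0) :
    besselKernel ν p (starRingEnd ℂ w) = besselKernel ν (-p) w := by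
  have hcw : starRingEnd ℂ w ≠ 0 := by simpa using hw
  have h1 : 4 * (Real.pi : ℂ) ^ 2 * starRingEnd ℂ w = starRingEnd ℂ (4 * Real.pi ^ 2 * w) := by
    simp [Complex.conj_ofNat]
  have h2 : ∀ μ μ' w, besselPair μ μ' (starRingEnd ℂ w) = besselPair μ' μ w := by
    intro μ μ' w
    rw [besselPair, besselPair, conj_conj, mul_comm]
  rw [besselKernel_eq _ _ hw, besselKernel_eq _ _ hcw, h1, twist_conj, twist_conj, h2, h2]
  push_cast
  rw [sub_neg_eq_add, ← sub_eq_add_neg]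

/-! ### The Hankel transform on test functions -/

section

variable {ν : ℂ} {p : ℤ}

theorem Ssis.nabla_sisProj (q : 𝓢(ℂ, ℂ) × 𝓢(ℂ, ℂ)) :
    Ssis.nabla (sisProj ν p q) = sisProj ν p (nablaLift ν p q) :=
  Subtype.ext (nablaFun_sisMap q)

theorem Ssis.nablaBar_sisProj (q : 𝓢(ℂ, ℂ) × 𝓢(ℂ, ℂ)) :
    Ssis.nablaBar (sisProj ν p q) = sisProj ν p (nablaBarLift ν p q) :=
  Subtype.ext (nablaBarFun_sisMap q)

theorem Ssis.mulZ_sisProj (q : 𝓢(ℂ, ℂ) × 𝓢(ℂ, ℂ)) :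
    Ssis.mulZ (sisProj ν p q) = sisProj ν p (schwartzMulZ q.1, schwartzMulZ q.2) :=
  Subtype.ext (smul_sisMap temperate_id q)

theorem Ssis.mulZBar_sisProj (q : 𝓢(ℂ, ℂ) × 𝓢(ℂ, ℂ)) :
    Ssis.mulZBar (sisProj ν p q) = sisProj ν p (schwartzMulZBar q.1, schwartzMulZBar q.2) :=
  Subtype.ext (smul_sisMap temperate_conj q)

theorem nablaLift_add_self (q : 𝓢(ℂ, ℂ) × 𝓢(ℂ, ℂ)) :
    nablaLift ν p q + q = -(eulerOp ν p q.1, eulerOp (-ν) (-p) q.2) := by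
  refine Prod.ext ?_ ?_
  · ext z
    simp [nablaLift, eulerOp]; ring
  · ext z
    simp [nablaLift, eulerOp]; ring

theorem nablaBarLift_add_self (q : 𝓢(ℂ, ℂ) × 𝓢(ℂ, ℂ)) :
    nablaBarLift ν p q + q = -(eulerBarOp ν p q.1, eulerBarOp (-ν) (-p) q.2) := by
  refine Prod.ext ?_ ?_
  · ext z
    simp [nablaBarLift, eulerBarOp]; ring
  · ext z
    simp [nablaBarLift, eulerBarOp]; ring

/-- The Hankel integral of the test function given by a pair of Schwartz functions. -/
def hankelPair (ν : ℂ) (p : ℤ) (q : 𝓢(ℂ, ℂ) × 𝓢(ℂ, ℂ)) (u : ℂ) : ℂ :=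
  4 * Real.pi ^ 2 * (kernelIntegral ν p (besselKernel ν p) q.1 u +
    kernelIntegral (-ν) (-p) (besselKernel ν p) q.2 u)

theorem hankelIntegral_sisMap (hν : ∀ n : ℤ, ν ≠ n) (hν' : |ν.re| < 1)
    (q : 𝓢(ℂ, ℂ) × 𝓢(ℂ, ℂ)) {u : ℂ} (hu : u ≠ 0) :
    Integrable (hankelIntegrand ν p (sisMap ν p q) u) ∧
      hankelIntegral ν p (sisMap ν p q) u = hankelPair ν p q u := by
  obtain ⟨b₁, b₂, h⟩ := exists_isBesselKernel hν p
  have hν'' : |(-ν).re| < 1 := by rwa [neg_re, abs_neg]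
  have i₁ := h.integrable hν' q.1 hu
  have i₂ := h.swap.integrable hν'' q.2 hu
  have h1 : hankelIntegrand ν p (sisMap ν p q) u = fun z =>
      twist ν p z * q.1 z * besselKernel ν p (u * z) +
        twist (-ν) (-p) z * q.2 z * besselKernel ν p (u * z) :=
    funext fun z => add_mul _ _ _
  rw [hankelIntegral, h1]
  refine ⟨i₁.add i₂, ?_⟩
  rw [integral_add i₁ i₂, hankelPair, kernelIntegral, kernelIntegral]
  ring

theorem exists_isHankelTransform (hν : ∀ n : ℤ, ν ≠ n) (hν' : |ν.re| < 1) :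
    ∃ H : Ssis ν p →L[ℂ] Ssis ν p, IsHankelTransform ν p H := by
  obtain ⟨b₁, b₂, h⟩ := exists_isBesselKernel hν p
  have hν'' : |(-ν).re| < 1 := by rwa [neg_re, abs_neg]
  obtain ⟨T₁, T₂, hT⟩ := h.exists_lift hν'
  obtain ⟨S₁, S₂, hS⟩ := h.swap.exists_lift hν''
  let fst := ContinuousLinearMap.fst ℂ 𝓢(ℂ, ℂ) 𝓢(ℂ, ℂ)
  let snd := ContinuousLinearMap.snd ℂ 𝓢(ℂ, ℂ) 𝓢(ℂ, ℂ)
  let c : ℂ := 4 * Real.pi ^ 2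
  -- Test functions carry the value 0 at the origin by convention, which the integral need not
  -- respect.
  let A : (ℂ → ℂ) → ℂ → ℂ := fun φ u => if u = 0 then 0 else hankelIntegral ν p φ u
  -- S₁ and S₂ come from the swapped kernel, so S₁ belongs to the power -ν and S₂ to ν.
  let D := (c • (T₁.comp fst + S₂.comp snd)).prod (c • (T₂.comp fst + S₁.comp snd))
  have hA : ∀ q, A (sisMap ν p q) = sisMap ν p (D q) := by
    intro q
    ext u
    have hD : sisMap ν p (D q) u = twist ν p u * (c * (T₁ q.1 u + S₂ q.2 u)) +
      twist (-ν) (-p) u * (c * (T₂ q.1 u + S₁ q.2 u)) := rfl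
    rw [hD]
    by_cases hu : u = 0
    · simp [A, hu, twist_at_zero]
    · simp only [A, if_neg hu]
      rw [(hankelIntegral_sisMap hν hν' q hu).2, hankelPair, hT _ _ hu, hS _ _ hu, neg_neg,
        neg_neg]
      ring
  refine ⟨Ssis.lift A D hA, fun φ u hu => ?_⟩
  obtain ⟨q, rfl⟩ := sisProj_surjective φ
  refine ⟨(hankelIntegral_sisMap hν hν' q hu).1, ?_⟩
  rw [Ssis.lift_apply]
  exact if_neg hu

theorem IsHankelTransform.apply_sisProj {H : Ssis ν p →L[ℂ] Ssis ν p}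
    (hH : IsHankelTransform ν p H) (hν : ∀ n : ℤ, ν ≠ n) (hν' : |ν.re| < 1)
    (q : 𝓢(ℂ, ℂ) × 𝓢(ℂ, ℂ)) {u : ℂ} (hu : u ≠ 0) : H (sisProj ν p q) u = hankelPair ν p q u :=
  (hH _ u hu).2.trans (hankelIntegral_sisMap hν hν' q hu).2

theorem hasWirt_hankelPair (hν : ∀ n : ℤ, ν ≠ n) (hν' : |ν.re| < 1)
    (q : 𝓢(ℂ, ℂ) × 𝓢(ℂ, ℂ)) {u : ℂ} (hu : u ≠ 0) : HasWirt (hankelPair ν p q)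
      (twist (-1) (-1) u * hankelPair ν p (eulerOp ν p q.1, eulerOp (-ν) (-p) q.2) u)
      (twist (-1) 1 u * hankelPair ν p (eulerBarOp ν p q.1, eulerBarOp (-ν) (-p) q.2) u) u := by
  obtain ⟨b₁, b₂, h⟩ := exists_isBesselKernel hν p
  have hν'' : |(-ν).re| < 1 := by rwa [neg_re, abs_neg]
  exact (((h.hasWirt hν' q.1 hu).add (h.swap.hasWirt hν'' q.2 hu)).const_mul
    (4 * Real.pi ^ 2)).congr_deriv (by rw [hankelPair]; ring) (by rw [hankelPair]; ring)

/-! ### The identities for test functions. -/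

variable {H : Ssis ν p →L[ℂ] Ssis ν p}

theorem IsHankelTransform.nabla_apply (hH : IsHankelTransform ν p H) (hν : ∀ n : ℤ, ν ≠ n)
    (hν' : |ν.re| < 1) (φ : Ssis ν p) : Ssis.nabla (H φ) = -H (Ssis.nabla φ + φ) := by
  obtain ⟨q, rfl⟩ := sisProj_surjective φ
  rw [Ssis.nabla_sisProj, ← map_add, nablaLift_add_self, map_neg, map_neg, neg_neg]
  refine Ssis.ext fun u => ?_
  by_cases hu : u = 0
  · rw [hu, Ssis.apply_zero, Ssis.apply_zero]
  have h1 := twist_neg_mul 1 1 hu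
  rw [twist_one_one] at h1
  rw [Ssis.nabla_apply, nablaFun_congr (fun u hu => hH.apply_sisProj hν hν' q hu) hu,
    hH.apply_sisProj hν hν' _ hu, nablaFun_eq, (hasWirt_hankelPair hν hν' q hu).dz, ← mul_assoc,
    h1, one_mul]

theorem IsHankelTransform.nablaBar_apply (hH : IsHankelTransform ν p H) (hν : ∀ n : ℤ, ν ≠ n)
    (hν' : |ν.re| < 1) (φ : Ssis ν p) : Ssis.nablaBar (H φ) = -H (Ssis.nablaBar φ + φ) := by
  obtain ⟨q, rfl⟩ := sisProj_surjective φ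
  rw [Ssis.nablaBar_sisProj, ← map_add, nablaBarLift_add_self, map_neg, map_neg, neg_neg]
  refine Ssis.ext fun u => ?_
  by_cases hu : u = 0
  · rw [hu, Ssis.apply_zero, Ssis.apply_zero]
  have h1 := twist_neg_mul 1 (-1) hu
  rw [twist_one_neg_one, neg_neg] at h1
  have h2 : nablaBarFun (H (sisProj ν p q)) u = nablaBarFun (hankelPair ν p q) u := by
    have : H (sisProj ν p q) =ᶠ[nhds u] hankelPair ν p q := by
      filter_upwards [isOpen_ne.mem_nhds hu] with v hv using hH.apply_sisProj hν hν' q hv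
    rw [nablaBarFun, nablaBarFun, this.fderiv_eq]
  rw [Ssis.nablaBar_apply, h2, hH.apply_sisProj hν hν' _ hu, nablaBarFun_eq,
    (hasWirt_hankelPair hν hν' q hu).dzbar, ← mul_assoc, h1, one_mul]

theorem nabla_add_nabla_add (q : 𝓢(ℂ, ℂ) × 𝓢(ℂ, ℂ)) :
    Ssis.nabla (Ssis.nabla (sisProj ν p q) + sisProj ν p q) +
      (Ssis.nabla (sisProj ν p q) + sisProj ν p q) =
    sisProj ν p (eulerOp ν p (eulerOp ν p q.1), eulerOp (-ν) (-p) (eulerOp (-ν) (-p) q.2)) := by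
  rw [Ssis.nabla_sisProj, ← map_add, Ssis.nabla_sisProj, ← map_add, nablaLift_add_self,
    nablaLift_add_self]
  simp

theorem nablaBar_add_nablaBar_add (q : 𝓢(ℂ, ℂ) × 𝓢(ℂ, ℂ)) :
    Ssis.nablaBar (Ssis.nablaBar (sisProj ν p q) + sisProj ν p q) +
      (Ssis.nablaBar (sisProj ν p q) + sisProj ν p q) =
    sisProj ν p (eulerBarOp ν p (eulerBarOp ν p q.1),
      eulerBarOp (-ν) (-p) (eulerBarOp (-ν) (-p) q.2)) := by
  rw [Ssis.nablaBar_sisProj, ← map_add, Ssis.nablaBar_sisProj, ← map_add, nablaBarLift_add_self,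
    nablaBarLift_add_self]
  simp

theorem IsHankelTransform.nabla_sq_apply (hH : IsHankelTransform ν p H) (hν : ∀ n : ℤ, ν ≠ n)
    (hν' : |ν.re| < 1) (φ : Ssis ν p) :
    (4 : ℂ) • H (Ssis.nabla (Ssis.nabla φ + φ) + (Ssis.nabla φ + φ)) =
      (ν + p) ^ 2 • H φ + (-(16 * (Real.pi : ℂ) ^ 2)) • Ssis.mulZ (H (Ssis.mulZ φ)) := by
  obtain ⟨q, rfl⟩ := sisProj_surjective φ
  obtain ⟨b₁, b₂, h⟩ := exists_isBesselKernel hν p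
  have hν'' : |(-ν).re| < 1 := by rwa [neg_re, abs_neg]
  rw [nabla_add_nabla_add, Ssis.mulZ_sisProj]
  refine Ssis.ext fun u => ?_
  by_cases hu : u = 0
  · rw [hu, Ssis.apply_zero, Ssis.apply_zero]
  have e₁ := h.integral_eulerOp_sq hν' q.1 hu
  have e₂ := h.swap.integral_eulerOp_sq hν'' q.2 hu
  push_cast at e₂
  simp only [Ssis.smul_apply, Ssis.add_apply, Ssis.mulZ_apply, hH.apply_sisProj hν hν' _ hu,
    hankelPair]
  linear_combination 4 * Real.pi ^ 2 * (e₁ + e₂)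

theorem IsHankelTransform.nablaBar_sq_apply (hH : IsHankelTransform ν p H)
    (hν : ∀ n : ℤ, ν ≠ n) (hν' : |ν.re| < 1) (φ : Ssis ν p) :
    (4 : ℂ) • H (Ssis.nablaBar (Ssis.nablaBar φ + φ) + (Ssis.nablaBar φ + φ)) =
      (ν - p) ^ 2 • H φ + (-(16 * (Real.pi : ℂ) ^ 2)) • Ssis.mulZBar (H (Ssis.mulZBar φ)) := by
  obtain ⟨q, rfl⟩ := sisProj_surjective φ
  obtain ⟨b₁, b₂, h⟩ := exists_isBesselKernel hν (-p)
  have hν'' : |(-ν).re| < 1 := by rwa [neg_re, abs_neg]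
  have hk : ∀ w, w ≠ 0 → besselKernel ν p (starRingEnd ℂ w) = besselKernel ν (-p) w :=
    fun w hw => besselKernel_conj ν p hw
  rw [nablaBar_add_nablaBar_add, Ssis.mulZBar_sisProj]
  refine Ssis.ext fun u => ?_
  by_cases hu : u = 0
  · rw [hu, Ssis.apply_zero, Ssis.apply_zero]
  have e₁ := integral_eulerBarOp_sq h hk hν' q.1 hu
  have e₂ := integral_eulerBarOp_sq h.swap hk hν'' q.2 hu
  push_cast at e₂
  simp only [Ssis.smul_apply, Ssis.add_apply, Ssis.mulZBar_apply, hH.apply_sisProj hν hν' _ hu,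
    hankelPair]
  linear_combination 4 * Real.pi ^ 2 * (e₁ + e₂)

end

end Hankel

end

/-! ### The identities for distributions, by duality. -/

open Hankel in
theorem mainTheorem9 (ν : ℂ) (p : ℤ) (hν : ∀ n : ℤ, ν ≠ n) (hν' : |ν.re| < 1) :
    ∃ H : Hankel.Ssis ν p →L[ℂ] Hankel.Ssis ν p, Hankel.IsHankelTransform ν p H ∧
      ∀ f : Hankel.Tsis ν p,
        (f.hankel H).nabla = -(f.nabla + f).hankel H ∧
        (f.hankel H).nablaBar = -(f.nablaBar + f).hankel H ∧
        (f.hankel H).nabla.nabla = (f.nabla.nabla + (2 : ℂ) • f.nabla + f).hankel H ∧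
        (f.hankel H).nablaBar.nablaBar =
          (f.nablaBar.nablaBar + (2 : ℂ) • f.nablaBar + f).hankel H ∧
        (4 : ℂ) • (f.hankel H).nabla.nabla = (ν + p) ^ 2 • f.hankel H -
          (16 * (Real.pi : ℂ) ^ 2) • (f.mulZ.hankel H).mulZ ∧
        (4 : ℂ) • (f.hankel H).nablaBar.nablaBar = (ν - p) ^ 2 • f.hankel H -
          (16 * (Real.pi : ℂ) ^ 2) • (f.mulZBar.hankel H).mulZBar := by
  obtain ⟨H, hH⟩ := Hankel.exists_isHankelTransform (p := p) hν hν'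
  have hn := hH.nabla_apply hν hν'
  have hb := hH.nablaBar_apply hν hν'
  have ap : ∀ (f : Tsis ν p) φ, f.hankel H φ = f (H φ) := fun f φ => rfl
  have mz : ∀ (f : Tsis ν p) φ, f.mulZ φ = f (Ssis.mulZ φ) := fun f φ => rfl
  have mb : ∀ (f : Tsis ν p) φ, f.mulZBar φ = f (Ssis.mulZBar φ) := fun f φ => rfl
  refine ⟨H, hH, fun f => ⟨?_, ?_, ?_, ?_, ?_, ?_⟩⟩ <;> refine ContinuousLinearMap.ext fun φ => ?_
  -- Both sides send φ to f(∇Hφ): the left by `hn`, the right because ∇f + f pairs with a test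
  -- function ψ to -f(∇ψ).
  · simp only [Tsis.nabla_apply, ap, neg_apply, add_apply, map_add, hn, map_neg]
    ring
  · simp only [Tsis.nablaBar_apply, ap, neg_apply, add_apply, map_add, hb, map_neg]
    ring
  · simp only [Tsis.nabla_apply, ap, smul_apply, smul_eq_mul, add_apply, map_add, hn, map_neg]
    ring
  · simp only [Tsis.nablaBar_apply, ap, smul_apply, smul_eq_mul, add_apply, map_add, hb, map_neg]
    ring
  -- Two distributional ∇ evaluate f at H((∇+1)²φ), which is what the second-order identity for test
  -- functions computes.
  · have := congrArg f (hH.nabla_sq_apply hν hν' φ)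
    simp only [map_add, map_smul, smul_eq_mul] at this
    simp only [Tsis.nabla_apply, ap, mz, smul_apply, smul_eq_mul, sub_apply, map_add]
    linear_combination this
  · have := congrArg f (hH.nablaBar_sq_apply hν hν' φ)
    simp only [map_add, map_smul, smul_eq_mul] at this
    simp only [Tsis.nablaBar_apply, ap, mb, smul_apply, smul_eq_mul, sub_apply, map_add]
    linear_combination this
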